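/- Write $\log_2 T=\log\log T$. For real $x\ge 1$ and $y$, let $\Psi(x,y)$ be the number of positive integers $n\le x$ all of whose prime factors are at most $y$ (the $y$-friable integers up to $x$), and for real $t$ let $\Psi(x,y;t)=\sum n^{it}$, the sum being over the same integers $n$. The following holds unconditionally. (1) There is an absolute constant $C>0$ such that for all real $T,x,y$ with $2\le x\le T^{1/3}$ and $y\ge \log x\,\log T\,(\log_2 T)^5$, the inequality $$\Big|\sum_{n\le x}n^{it}-\Psi(x,y;t)\Big|\le C\,\frac{\Psi(x,y)}{(\log_2T)^2}$$ holds for all $t\in[1,T]$ outside a set of Lebesgue measure at most $T^{1-1/\log x}$. (2) There is an absolute constant $T_0$ such that for all real $T\ge T_0$ and $2\le x\le T^{1/3}$, the inequality $$\Big|\sum_{n\le x}n^{it}\Big|\le\Psi\big(x,(\log T+(\log x)^2)(\log_2T)^5\big)$$ holds for all $t\in[1,T]$ outside a set of Lebesgue measure at most $T^{1-1/(\log_2T)^2}$. -/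

import Mathlib

/-- `n` is a `y`-friable positive integer: every prime factor of `n` is at most `y`. -/
def IsFriable (y : ℝ) (n : ℕ) : Prop :=
  n ≠ 0 ∧ ∀ p : ℕ, p.Prime → p ∣ n → (p : ℝ) ≤ y

open Classical in
/-- The `y`-friable integers `1 ≤ n ≤ x`. -/
noncomputable def friableUpTo (x y : ℝ) : Finset ℕ :=
  (Finset.Icc 1 ⌊x⌋₊).filter (IsFriable y)

/-- `Ψ(x, y)`, the number of `y`-friable integers up to `x`. -/
noncomputable def friableCount (x y : ℝ) : ℝ :=
  ((friableUpTo x y).card : ℝ)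

/-- `Ψ(x, y; t)`, the sum of `n ^ (i t)` over the `y`-friable integers `n ≤ x`. -/
noncomputable def friableSum (x y t : ℝ) : ℂ :=
  ∑ n ∈ friableUpTo x y, (n : ℂ) ^ (Complex.I * (t : ℂ))

/-- The zeta sum: the sum of `n ^ (i t)` over the integers `1 ≤ n ≤ x`. -/
noncomputable def zetaSum (x t : ℝ) : ℂ :=
  ∑ n ∈ Finset.Icc 1 ⌊x⌋₊, (n : ℂ) ^ (Complex.I * (t : ℂ))

/-! The method is that of high moments. With k = ⌊log T / log x⌋ the k-th power of a Dirichlet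
polynomial supported on n ≤ x has length at most T, so its mean square against a Gaussian of width T
is at most a constant times T times the sum of its squared coefficients, which count k-tuples with a
given product. By Markov's inequality, everything rests on bounding pairs of k-tuples with equal
products.

To do so, forget the y-friable part of each n and keep only its part b composed of primes exceeding
y. Equality of products is relaxed to equality of products of rough parts. An integer l has at most
k^Ω(l) ordered factorizations into k factors, so Cauchy–Schwarz bounds the count by the k-th power
of the sum over b of k^Ω(b) Ψ(x/b, y)². The term b = 1 is Ψ(x, y)². For the others let F(z) be the
largest value of Ψ(u/z, y)/Ψ(u, y) for 1 ≤ u ≤ x. This F is submultiplicative, so an Euler product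
bounds the whole sum by Ψ(x, y)² exp(2k Σ F(p)²), over primes y < p ≤ x. The estimate Σ F(p)² ≪ (log
x)² log y / y (`exists_sum_friableRatio_sq_le`) then gives `exists_volume_zetaSum_le`. Removing the
friable integers removes b = 1, which replaces exp by exp − 1.

For the first assertion the exponent is O((log₂ T)⁻⁴), so exp − 1 is equally small, and the
threshold Ψ(x, y)/(log₂ T)² beats its square root by a constant factor as large as desired.

For the second, the moment bound is used at a level z smaller than the stated level Y by a factor
(log₂ T)². It remains to show that Ψ(x, Y) exceeds Ψ(x, z) by enough to absorb the exponential
(`exists_friableCount_exp_lower`). This follows by iterating Buchstab's identity over the primes in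
(z, Y], given the lower bound Ψ(x/p, p) ≫ Ψ(x, p) log x / (p log p)
(`exists_friableCount_div_self_lower`), which comes from Hildebrand's identity for Σ log n over
friable n. Only Chebyshev-strength information on primes is needed. -/

/-! ### Chebyshev-type estimates for primes. -/

/-- The primes `p` with `a < p ≤ b` (for nonnegative `a`, `b`). -/
noncomputable def primesIoc (a b : ℝ) : Finset ℕ :=
  (Finset.Ioc ⌊a⌋₊ ⌊b⌋₊).filter Nat.Prime

theorem mem_primesIoc {a b : ℝ} (ha : 0 ≤ a) (hb : 0 ≤ b) {p : ℕ} :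
    p ∈ primesIoc a b ↔ p.Prime ∧ a < p ∧ (p : ℝ) ≤ b := by
  simp only [primesIoc, Finset.mem_filter, Finset.mem_Ioc, Nat.floor_lt ha, Nat.le_floor_iff hb]
  tauto

theorem theta_sub_theta {a b : ℝ} (hab : a ≤ b) :
    Chebyshev.theta b - Chebyshev.theta a = ∑ p ∈ primesIoc a b, Real.log p := by
  have h : ⌊a⌋₊ ≤ ⌊b⌋₊ := Nat.floor_le_floor hab
  rw [Chebyshev.theta, Chebyshev.theta, primesIoc,
    ← Finset.Ioc_union_Ioc_eq_Ioc (Nat.zero_le _) h, Finset.filter_union, Finset.sum_union]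
  · ring
  · apply Finset.disjoint_filter_filter
    rw [Finset.disjoint_left]
    intro n hn hn'
    simp only [Finset.mem_Ioc] at hn hn'
    omega

theorem exists_theta_lower : ∃ c : ℝ, 0 < c ∧ c ≤ 1 ∧ ∀ z : ℝ, 2 ≤ z → c * z ≤ Chebyshev.theta z := by
  have hlarge : ∀ z : ℝ, (20 : ℝ) ^ 4 ≤ z → 0.1 * z ≤ Chebyshev.theta z := by
    intro z hz
    have hz0 : (0 : ℝ) < z := by linarith [show (0 : ℝ) < 20 ^ 4 by norm_num]
    have h := Chebyshev.theta_ge' (x := z) (by linarith [show (1 : ℝ) ≤ 20 ^ 4 by norm_num])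
    -- In terms of the fourth root u the error terms are O(u³), negligible against z = u⁴ once u ≥
    -- 20; this fixes the threshold 20⁴.
    set u : ℝ := z ^ (1 / 4 : ℝ) with hu
    have hu4 : u ^ 4 = z := by
      rw [hu, ← Real.rpow_natCast, ← Real.rpow_mul hz0.le]; norm_num
    have hu0 : 0 ≤ u := by positivity
    have hu20 : 20 ≤ u := by
      by_contra hlt
      push Not at hlt
      have := pow_lt_pow_left₀ hlt hu0 (n := 4) (by norm_num)
      linarith
    have hlog : Real.log z ≤ 4 * u := by
      have := Real.log_le_rpow_div hz0.le (ε := 1 / 4) (by norm_num)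
      linarith
    have hlog0 : 0 ≤ Real.log z := Real.log_nonneg (by linarith [show (1 : ℝ) ≤ 20 ^ 4 by norm_num])
    have hsq : √z = u ^ 2 := by
      rw [← hu4, show u ^ 4 = (u ^ 2) ^ 2 by ring, Real.sqrt_sq (by positivity)]
    have hlog2 : Real.log (z + 2) ≤ 1 + 4 * u := by
      calc Real.log (z + 2) ≤ Real.log (2 * z) := Real.log_le_log (by linarith) (by
            linarith [show (2 : ℝ) ≤ 20 ^ 4 by norm_num])
        _ = Real.log 2 + Real.log z := Real.log_mul (by norm_num) hz0.ne'
        _ ≤ 1 + 4 * u := by linarith [Real.log_two_lt_d9]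
    rw [hsq] at h
    have h3 : 2 * u ^ 2 * Real.log z ≤ 2 * u ^ 2 * (4 * u) := by gcongr
    have hl2 := Real.log_two_gt_d9
    have h4 : (z - 1) * 0.69 ≤ (z - 1) * Real.log 2 := by
      apply mul_le_mul_of_nonneg_left (by linarith)
      linarith [show (1 : ℝ) ≤ 20 ^ 4 by norm_num]
    have h5 : 20 * u ^ 3 ≤ z := by
      rw [← hu4]; nlinarith [pow_nonneg hu0 3]
    have h6 : 8000 * u ≤ z := by
      rw [← hu4]
      have : (20 : ℝ) ^ 3 ≤ u ^ 3 := pow_le_pow_left₀ (by norm_num) hu20 3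
      nlinarith
    linarith
  have hl := Real.log_pos (x := 2) (by norm_num)
  refine ⟨min 0.1 (Real.log 2 / 20 ^ 4), by positivity, (min_le_left _ _).trans (by norm_num), ?_⟩
  intro z hz
  by_cases h : (20 : ℝ) ^ 4 ≤ z
  · refine le_trans ?_ (hlarge z h)
    gcongr
    exact min_le_left _ _
  · push Not at h
    have h2 : Chebyshev.theta 2 = Real.log 2 := by
      rw [Chebyshev.theta]
      norm_num
      rw [show (Finset.Ioc 0 2).filter Nat.Prime = {2} by decide]
      simp
    calc min 0.1 (Real.log 2 / 20 ^ 4) * z ≤ (Real.log 2 / 20 ^ 4) * 20 ^ 4 := by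
          gcongr
          exact min_le_right _ _
      _ = Real.log 2 := by field_simp
      _ ≤ Chebyshev.theta z := h2 ▸ Chebyshev.theta_mono hz

/-- The ratio 2^s is taken large enough that the upper Chebyshev bound at w/2^s is at most half of
the lower one at w, so explicit constants never matter. -/
theorem exists_theta_sub_theta_lower : ∃ s : ℕ, 0 < s ∧ ∃ c : ℝ, 0 < c ∧
    ∀ w : ℝ, 2 ≤ w → c * w ≤ Chebyshev.theta w - Chebyshev.theta (w / 2 ^ s) := by
  obtain ⟨c, hc, -, h⟩ := exists_theta_lower
  obtain ⟨s, hs⟩ := pow_unbounded_of_one_lt (2 * Real.log 4 / c) (one_lt_two)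
  have hl4 : 0 < Real.log 4 := Real.log_pos (by norm_num)
  refine ⟨s + 1, by omega, c / 2, by positivity, fun w hw => ?_⟩
  have h1 := h w hw
  have h2 := Chebyshev.theta_le_log4_mul_x (x := w / 2 ^ (s + 1)) (by positivity)
  have h3 : Real.log 4 * (w / 2 ^ (s + 1)) ≤ c / 2 * w := by
    rw [div_lt_iff₀ hc] at hs
    rw [← mul_div_assoc, div_le_iff₀ (by positivity)]
    have : (2 : ℝ) ^ (s + 1) = 2 * 2 ^ s := by ring
    rw [this]
    have : (0 : ℝ) < 2 ^ s := by positivity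
    nlinarith
  linarith

theorem exists_card_primesIoc_lower : ∃ s : ℕ, 0 < s ∧ ∃ c : ℝ, 0 < c ∧
    ∀ w : ℝ, 2 ≤ w → c * w / Real.log w ≤ (primesIoc (w / 2 ^ s) w).card := by
  obtain ⟨s, hs, c, hc, h⟩ := exists_theta_sub_theta_lower
  refine ⟨s, hs, c, hc, fun w hw => ?_⟩
  have hle : w / 2 ^ s ≤ w := div_le_self (by linarith) (one_le_pow₀ (by norm_num))
  have hlog : 0 < Real.log w := Real.log_pos (by linarith)
  rw [div_le_iff₀ hlog]
  refine (h w hw).trans ?_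
  rw [theta_sub_theta hle, ← nsmul_eq_mul]
  apply Finset.sum_le_card_nsmul
  intro p hp
  rw [mem_primesIoc (by positivity) (by linarith)] at hp
  exact Real.log_le_log (by exact_mod_cast hp.1.pos) hp.2.2

theorem card_primesIoc_le {V : ℝ} (hV : 1 < V) :
    ((primesIoc V (2 * V)).card : ℝ) ≤ 2 * Real.log 4 * V / Real.log V := by
  have hlog : 0 < Real.log V := Real.log_pos hV
  rw [le_div_iff₀ hlog]
  calc ((primesIoc V (2 * V)).card : ℝ) * Real.log V ≤ ∑ p ∈ primesIoc V (2 * V), Real.log p := by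
        rw [← nsmul_eq_mul]
        apply Finset.card_nsmul_le_sum
        intro p hp
        rw [mem_primesIoc (by linarith) (by linarith)] at hp
        exact Real.log_le_log (by linarith) hp.2.1.le
    _ = Chebyshev.theta (2 * V) - Chebyshev.theta V := (theta_sub_theta (by linarith)).symm
    _ ≤ Real.log 4 * (2 * V) := by
        linarith [Chebyshev.theta_le_log4_mul_x (x := 2 * V) (by linarith),
          Chebyshev.theta_nonneg V]
    _ = _ := by ring

theorem primesIoc_subset {a b a' b' : ℝ} (h : a' ≤ a) (h' : b ≤ b') :
    primesIoc a b ⊆ primesIoc a' b' := by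
  apply Finset.filter_subset_filter
  exact Finset.Ioc_subset_Ioc (Nat.floor_le_floor h) (Nat.floor_le_floor h')

/-- A substitute for Mertens' theorem. Cut (z, Y] into blocks of ratio 2^s; each contributes at
least c / log Y, and there are about log(Y/z) of them. The condition K z ≤ Y leaves room for one
full block. -/
theorem exists_sum_inv_primesIoc_lower : ∃ K : ℝ, 1 < K ∧ ∃ c : ℝ, 0 < c ∧
    ∀ z Y : ℝ, 1 ≤ z → K * z ≤ Y →
      c * Real.log (Y / z) / Real.log Y ≤ ∑ p ∈ primesIoc z Y, (1 : ℝ) / p := by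
  obtain ⟨s, hs, c, hc, h⟩ := exists_card_primesIoc_lower
  have hK2 : (2 : ℝ) ≤ 2 ^ s := by
    calc (2 : ℝ) = 2 ^ 1 := by norm_num
      _ ≤ 2 ^ s := pow_le_pow_right₀ (by norm_num) hs
  have hblock : ∀ z Y : ℝ, 1 ≤ z → 2 ^ s * z ≤ Y →
      c / Real.log Y ≤ ∑ p ∈ primesIoc z (2 ^ s * z), (1 : ℝ) / p := by
    intro z Y hz hY
    have hw : 2 ≤ 2 ^ s * z := by nlinarith
    have h1 := h _ hw
    rw [mul_div_cancel_left₀ z (by positivity)] at h1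
    have hlogw : 0 < Real.log (2 ^ s * z) := Real.log_pos (by linarith)
    calc c / Real.log Y ≤ c / Real.log (2 ^ s * z) := by
          gcongr
      _ = (c * (2 ^ s * z) / Real.log (2 ^ s * z)) * (1 / (2 ^ s * z)) := by
          field_simp
      _ ≤ (primesIoc z (2 ^ s * z)).card * (1 / (2 ^ s * z)) := by gcongr
      _ ≤ ∑ p ∈ primesIoc z (2 ^ s * z), (1 : ℝ) / p := by
          rw [← nsmul_eq_mul]
          apply Finset.card_nsmul_le_sum
          intro p hp
          rw [mem_primesIoc (by linarith) (by linarith)] at hp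
          have : (0 : ℝ) < p := by exact_mod_cast hp.1.pos
          exact one_div_le_one_div_of_le this hp.2.2
  have hind : ∀ n : ℕ, ∀ z Y : ℝ, 1 ≤ z → (2 ^ s) ^ n * z ≤ Y →
      n * (c / Real.log Y) ≤ ∑ p ∈ primesIoc z Y, (1 : ℝ) / p := by
    intro n
    induction n with
    | zero =>
      intro z Y _ _
      simp only [Nat.cast_zero, zero_mul]
      positivity
    | succ n ih =>
      intro z Y hz hY
      have hn1 : (1 : ℝ) ≤ (2 ^ s) ^ n := one_le_pow₀ (by linarith)
      have hY1 : 2 ^ s * z ≤ Y := by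
        refine le_trans ?_ hY
        rw [pow_succ, mul_assoc]
        exact le_mul_of_one_le_left (by positivity) hn1
      have h1 := hblock z Y hz hY1
      have h2 := ih (2 ^ s * z) Y (by nlinarith) (by
        refine le_trans (le_of_eq ?_) hY; ring)
      have hdis : Disjoint (primesIoc z (2 ^ s * z)) (primesIoc (2 ^ s * z) Y) := by
        rw [Finset.disjoint_left]
        intro p hp hp'
        rw [mem_primesIoc (by linarith) (by nlinarith)] at hp
        rw [mem_primesIoc (by nlinarith) (by nlinarith)] at hp'
        linarith [hp.2.2, hp'.2.1]
      have hsub : primesIoc z (2 ^ s * z) ∪ primesIoc (2 ^ s * z) Y ⊆ primesIoc z Y :=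
        Finset.union_subset (primesIoc_subset le_rfl hY1) (primesIoc_subset (by nlinarith) le_rfl)
      have h3 := Finset.sum_le_sum_of_subset_of_nonneg hsub
        (f := fun p : ℕ => (1 : ℝ) / p) (fun _ _ _ => by positivity)
      rw [Finset.sum_union hdis] at h3
      push_cast
      linarith
  have hlK : 0 < Real.log (2 ^ s) := Real.log_pos (by linarith)
  refine ⟨2 ^ s, by linarith, c / (2 * Real.log (2 ^ s)), by positivity, fun z Y hz hY => ?_⟩
  set r := Real.log (Y / z) / Real.log (2 ^ s) with hr
  have hz0 : 0 < z := by linarith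
  have hYz : 2 ^ s ≤ Y / z := by rwa [le_div_iff₀ hz0]
  have hr1 : 1 ≤ r := by
    rw [hr, one_le_div hlK]
    exact Real.log_le_log (by positivity) hYz
  have hfl : r / 2 ≤ ⌊r⌋₊ := by
    have h1 := Nat.lt_floor_add_one r
    have h2 : (1 : ℝ) ≤ ⌊r⌋₊ := by exact_mod_cast Nat.le_floor (by simpa using hr1)
    linarith
  have hY1 : 1 ≤ Y := by nlinarith
  have hlY : 0 ≤ Real.log Y := Real.log_nonneg hY1
  have hpow : (2 ^ s : ℝ) ^ ⌊r⌋₊ * z ≤ Y := by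
    rw [← le_div_iff₀ hz0, ← Real.log_le_log_iff (by positivity) (by positivity), Real.log_pow]
    calc (⌊r⌋₊ : ℝ) * Real.log (2 ^ s) ≤ r * Real.log (2 ^ s) := by
          gcongr
          exact Nat.floor_le (by linarith)
      _ = Real.log (Y / z) := by rw [hr]; field_simp
  refine le_trans ?_ (hind ⌊r⌋₊ z Y hz hpow)
  calc c / (2 * Real.log (2 ^ s)) * Real.log (Y / z) / Real.log Y = r / 2 * (c / Real.log Y) := by
        rw [hr]; field_simp
    _ ≤ _ := by gcongr

/-! ### Basic properties of friable integers and their counting function. -/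

theorem mem_friableUpTo {x y : ℝ} {n : ℕ} :
    n ∈ friableUpTo x y ↔ (n : ℝ) ≤ x ∧ IsFriable y n := by
  simp only [friableUpTo, Finset.mem_filter, Finset.mem_Icc]
  constructor
  · rintro ⟨⟨h1, h2⟩, h3⟩
    exact ⟨(Nat.le_floor_iff' (by omega)).1 h2, h3⟩
  · rintro ⟨h1, h2⟩
    exact ⟨⟨Nat.one_le_iff_ne_zero.2 h2.1, (Nat.le_floor_iff' h2.1).2 h1⟩, h2⟩

theorem isFriable_one (y : ℝ) : IsFriable y 1 :=
  ⟨one_ne_zero, fun _ hp h => absurd (Nat.dvd_one.1 h) hp.one_lt.ne'⟩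

theorem IsFriable.of_dvd {y : ℝ} {m n : ℕ} (hn : IsFriable y n) (h : m ∣ n) : IsFriable y m :=
  ⟨ne_zero_of_dvd_ne_zero hn.1 h, fun p hp hpm => hn.2 p hp (hpm.trans h)⟩

theorem IsFriable.mul {y : ℝ} {m n : ℕ} (hm : IsFriable y m) (hn : IsFriable y n) :
    IsFriable y (m * n) :=
  ⟨mul_ne_zero hm.1 hn.1, fun p hp h =>
    ((Nat.Prime.dvd_mul hp).1 h).elim (hm.2 p hp) (hn.2 p hp)⟩

theorem isFriable_of_le {y : ℝ} {n : ℕ} (hn : n ≠ 0) (h : (n : ℝ) ≤ y) : IsFriable y n :=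
  ⟨hn, fun _ _ hpn => le_trans (by exact_mod_cast Nat.le_of_dvd (Nat.pos_of_ne_zero hn) hpn) h⟩

theorem IsFriable.mono {y y' : ℝ} (h : y ≤ y') {n : ℕ} (hn : IsFriable y n) : IsFriable y' n :=
  ⟨hn.1, fun p hp hpn => (hn.2 p hp hpn).trans h⟩

theorem IsFriable.prod {y : ℝ} {ι : Type*} {s : Finset ι} {f : ι → ℕ}
    (h : ∀ i ∈ s, IsFriable y (f i)) : IsFriable y (∏ i ∈ s, f i) := by
  classical
  induction s using Finset.induction_on with
  | empty => simpa using isFriable_one y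
  | insert a s ha ih =>
    rw [Finset.prod_insert ha]
    exact (h _ (by simp)).mul (ih fun i hi => h i (by simp [hi]))

theorem friableUpTo_mono {x x' y y' : ℝ} (hx : x ≤ x') (hy : y ≤ y') :
    friableUpTo x y ⊆ friableUpTo x' y' := fun n hn => by
  rw [mem_friableUpTo] at hn ⊢
  exact ⟨hn.1.trans hx, hn.2.mono hy⟩

theorem friableCount_mono {x x' y y' : ℝ} (hx : x ≤ x') (hy : y ≤ y') :
    friableCount x y ≤ friableCount x' y' := by
  unfold friableCount
  exact_mod_cast Finset.card_le_card (friableUpTo_mono hx hy)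

theorem friableCount_nonneg (x y : ℝ) : 0 ≤ friableCount x y := by
  unfold friableCount; positivity

theorem one_le_friableCount {x : ℝ} (hx : 1 ≤ x) (y : ℝ) : 1 ≤ friableCount x y := by
  have : (1 : ℕ) ≤ (friableUpTo x y).card :=
    Finset.card_pos.2 ⟨1, mem_friableUpTo.2 ⟨by simpa using hx, isFriable_one y⟩⟩
  unfold friableCount
  exact_mod_cast this

theorem friableCount_eq_zero {x : ℝ} (hx : x < 1) (y : ℝ) : friableCount x y = 0 := by
  have : friableUpTo x y = ∅ := by
    apply Finset.eq_empty_of_forall_notMem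
    intro n hn
    rw [mem_friableUpTo] at hn
    have : (1 : ℝ) ≤ n := by exact_mod_cast Nat.one_le_iff_ne_zero.2 hn.2.1
    linarith [hn.1]
  simp [friableCount, this]

theorem friableCount_le_self {x : ℝ} (hx : 0 ≤ x) (y : ℝ) : friableCount x y ≤ x := by
  classical
  calc friableCount x y ≤ ((Finset.Icc 1 ⌊x⌋₊).card : ℝ) := by
        unfold friableCount friableUpTo
        refine Nat.cast_le.2 (Finset.card_le_card ?_)
        exact Finset.filter_subset _ _
    _ = ⌊x⌋₊ := by simp
    _ ≤ x := Nat.floor_le hx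

theorem friableUpTo_eq_Icc {x y : ℝ} (hxy : x ≤ y) :
    friableUpTo x y = Finset.Icc 1 ⌊x⌋₊ := by
  ext n
  rw [mem_friableUpTo, Finset.mem_Icc]
  constructor
  · rintro ⟨h1, h2⟩
    exact ⟨Nat.one_le_iff_ne_zero.2 h2.1, (Nat.le_floor_iff' h2.1).2 h1⟩
  · rintro ⟨h1, h2⟩
    have h3 := (Nat.le_floor_iff' (by omega)).1 h2
    exact ⟨h3, isFriable_of_le (by omega) (h3.trans hxy)⟩

theorem friableCount_eq_floor {x y : ℝ} (hxy : x ≤ y) :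
    friableCount x y = ⌊x⌋₊ := by
  simp [friableCount, friableUpTo_eq_Icc hxy]

theorem card_friableUpTo_filter_dvd {x y : ℝ} {d : ℕ} (hd : IsFriable y d) :
    (((friableUpTo x y).filter (d ∣ ·)).card : ℝ) = friableCount (x / d) y := by
  have hd0 : (0 : ℝ) < d := by exact_mod_cast Nat.pos_of_ne_zero hd.1
  unfold friableCount
  rw [Nat.cast_inj]
  symm
  apply Finset.card_bij (fun m _ => d * m)
  · intro m hm
    rw [mem_friableUpTo, le_div_iff₀ hd0] at hm
    rw [Finset.mem_filter, mem_friableUpTo]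
    refine ⟨⟨?_, hd.mul hm.2⟩, dvd_mul_right _ _⟩
    push_cast
    linarith [hm.1, mul_comm (d : ℝ) m]
  · intro a _ b _ h
    exact Nat.eq_of_mul_eq_mul_left (Nat.pos_of_ne_zero hd.1) h
  · intro n hn
    rw [Finset.mem_filter, mem_friableUpTo] at hn
    obtain ⟨⟨h1, h2⟩, m, rfl⟩ := hn
    refine ⟨m, ?_, rfl⟩
    rw [mem_friableUpTo, le_div_iff₀ hd0]
    push_cast at h1
    exact ⟨by linarith [mul_comm (d : ℝ) m], h2.of_dvd (dvd_mul_left _ _)⟩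

theorem sum_friableUpTo_sum_dvd {x y : ℝ} (D : Finset ℕ) (hD : ∀ d ∈ D, IsFriable y d)
    (w : ℕ → ℝ) :
    ∑ n ∈ friableUpTo x y, ∑ d ∈ D.filter (· ∣ n), w d =
      ∑ d ∈ D, w d * friableCount (x / d) y := by
  simp_rw [Finset.sum_filter]
  rw [Finset.sum_comm]
  refine Finset.sum_congr rfl fun d hd => ?_
  rw [← Finset.sum_filter, Finset.sum_const, nsmul_eq_mul, card_friableUpTo_filter_dvd (hD d hd),
    mul_comm]

/-! ### Hildebrand's identity and the decay of Ψ under division. -/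

/-- The Chebyshev function `ψ` restricted to prime powers of primes at most `y`. -/
noncomputable def friablePsi (V y : ℝ) : ℝ :=
  ∑ d ∈ friableUpTo V y, ArithmeticFunction.vonMangoldt d

theorem friablePsi_nonneg (V y : ℝ) : 0 ≤ friablePsi V y :=
  Finset.sum_nonneg fun _ _ => ArithmeticFunction.vonMangoldt_nonneg

/-- Write log as the divisor sum of Λ; divisors of friable integers are friable, and exchanging a
divisor d with its cofactor m gives the right side. -/
theorem sum_log_friableUpTo (x y : ℝ) :
    ∑ n ∈ friableUpTo x y, Real.log n = ∑ m ∈ friableUpTo x y, friablePsi (x / m) y := by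
  have h1 : ∀ n ∈ friableUpTo x y, Real.log n =
      ∑ d ∈ (friableUpTo x y).filter (· ∣ n), ArithmeticFunction.vonMangoldt d := by
    intro n hn
    rw [← ArithmeticFunction.vonMangoldt_sum]
    congr 1
    ext d
    have hn' := mem_friableUpTo.1 hn
    rw [Finset.mem_filter, Nat.mem_divisors, mem_friableUpTo]
    constructor
    · rintro ⟨h, -⟩
      refine ⟨⟨le_trans ?_ hn'.1, hn'.2.of_dvd h⟩, h⟩
      exact_mod_cast Nat.le_of_dvd (Nat.pos_of_ne_zero hn'.2.1) h
    · rintro ⟨-, h⟩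
      exact ⟨h, hn'.2.1⟩
  rw [Finset.sum_congr rfl h1,
    sum_friableUpTo_sum_dvd _ (fun d hd => (mem_friableUpTo.1 hd).2)]
  simp_rw [friablePsi, friableCount, Finset.card_eq_sum_ones, Nat.cast_sum, Finset.mul_sum]
  rw [Finset.sum_comm']
  · refine Finset.sum_congr rfl fun m _ => Finset.sum_congr rfl fun d _ => by simp
  · intro d m
    simp only [mem_friableUpTo]
    constructor
    · rintro ⟨⟨h1, h2⟩, h3, h4⟩
      have hd0 : (0 : ℝ) < d := by exact_mod_cast Nat.pos_of_ne_zero h2.1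
      have hm0 : (0 : ℝ) < m := by exact_mod_cast Nat.pos_of_ne_zero h4.1
      have hd1 : (1 : ℝ) ≤ d := by exact_mod_cast Nat.one_le_iff_ne_zero.2 h2.1
      rw [le_div_iff₀ hd0] at h3
      rw [le_div_iff₀ hm0]
      exact ⟨⟨by linarith [mul_comm (d : ℝ) m], h2⟩, by nlinarith, h4⟩
    · rintro ⟨⟨h3, h2⟩, h1, h4⟩
      have hd0 : (0 : ℝ) < d := by exact_mod_cast Nat.pos_of_ne_zero h2.1
      have hm0 : (0 : ℝ) < m := by exact_mod_cast Nat.pos_of_ne_zero h4.1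
      have hm1 : (1 : ℝ) ≤ m := by exact_mod_cast Nat.one_le_iff_ne_zero.2 h4.1
      rw [le_div_iff₀ hm0] at h3
      rw [le_div_iff₀ hd0]
      exact ⟨⟨by nlinarith, h2⟩, by linarith [mul_comm (d : ℝ) m], h4⟩

theorem sum_log_friableUpTo_le (x y : ℝ) :
    ∑ n ∈ friableUpTo x y, Real.log n ≤ friableCount x y * Real.log x := by
  rw [friableCount, ← nsmul_eq_mul]
  apply Finset.sum_le_card_nsmul
  intro n hn
  rw [mem_friableUpTo] at hn
  exact Real.log_le_log (by exact_mod_cast Nat.pos_of_ne_zero hn.2.1) hn.1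

/-- In Σ log n = Σ Λ(d) Ψ(x/d, y), keep only the primes up to z and use monotonicity of Ψ. -/
theorem friableCount_div_mul_theta_le {x y z : ℝ} (hz : 0 < z) (hzy : z ≤ y) (hx : 0 ≤ x) :
    friableCount (x / z) y * Chebyshev.theta z ≤ friableCount x y * Real.log x := by
  have hp : ∀ p ∈ primesIoc 0 z, IsFriable y p := fun p hp => by
    rw [mem_primesIoc le_rfl hz.le] at hp
    exact isFriable_of_le hp.1.ne_zero (hp.2.2.trans hzy)
  calc friableCount (x / z) y * Chebyshev.theta z
      = ∑ p ∈ primesIoc 0 z, Real.log p * friableCount (x / z) y := by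
        rw [← Finset.sum_mul, ← theta_sub_theta hz.le, Chebyshev.theta_zero]; ring
    _ ≤ ∑ p ∈ primesIoc 0 z, Real.log p * friableCount (x / p) y := by
        apply Finset.sum_le_sum
        intro p hp
        rw [mem_primesIoc le_rfl hz.le] at hp
        have : (1 : ℝ) ≤ p := by exact_mod_cast hp.1.one_lt.le
        apply mul_le_mul_of_nonneg_left _ (Real.log_nonneg this)
        exact friableCount_mono (div_le_div_of_nonneg_left hx (by linarith) hp.2.2) le_rfl
    _ = ∑ n ∈ friableUpTo x y, ∑ p ∈ (primesIoc 0 z).filter (· ∣ n), Real.log p :=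
        (sum_friableUpTo_sum_dvd _ hp _).symm
    _ ≤ ∑ n ∈ friableUpTo x y, Real.log n := by
        apply Finset.sum_le_sum
        intro n hn
        have hn' := mem_friableUpTo.1 hn
        rw [← ArithmeticFunction.vonMangoldt_sum]
        calc ∑ p ∈ (primesIoc 0 z).filter (· ∣ n), Real.log p
            = ∑ p ∈ (primesIoc 0 z).filter (· ∣ n), ArithmeticFunction.vonMangoldt p := by
              refine Finset.sum_congr rfl fun p hp => ?_
              rw [Finset.mem_filter, mem_primesIoc le_rfl hz.le] at hp
              rw [ArithmeticFunction.vonMangoldt_apply_prime hp.1.1]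
          _ ≤ _ := by
              apply Finset.sum_le_sum_of_subset_of_nonneg
              · intro p hp
                rw [Finset.mem_filter] at hp
                exact Nat.mem_divisors.2 ⟨hp.2, hn'.2.1⟩
              · intros; exact ArithmeticFunction.vonMangoldt_nonneg
    _ ≤ _ := sum_log_friableUpTo_le x y

/-! ### The uniform ratio F and its submultiplicativity. -/

/-- The largest ratio `Ψ(x / z, y) / Ψ(x, y)` over `1 ≤ x ≤ X`. -/
noncomputable def friableRatio (X y z : ℝ) : ℝ :=
  sSup ((fun x => friableCount (x / z) y / friableCount x y) '' Set.Icc 1 X)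

theorem friableRatio_le {X y z c : ℝ} (hX : 1 ≤ X)
    (h : ∀ x, 1 ≤ x → x ≤ X → friableCount (x / z) y ≤ c * friableCount x y) :
    friableRatio X y z ≤ c := by
  apply csSup_le
  · exact ⟨_, 1, ⟨le_rfl, hX⟩, rfl⟩
  · rintro _ ⟨x, ⟨h1, h2⟩, rfl⟩
    have := one_le_friableCount h1 y
    simp only
    rw [div_le_iff₀ (by linarith)]
    exact h x h1 h2

theorem friableCount_div_le {X y z x : ℝ} (hz : 1 ≤ z) (hx : x ≤ X) :
    friableCount (x / z) y ≤ friableRatio X y z * friableCount x y := by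
  by_cases h1 : 1 ≤ x
  · have hp := one_le_friableCount h1 y
    rw [← div_le_iff₀ (by linarith)]
    apply le_csSup
    · refine ⟨1, ?_⟩
      rintro _ ⟨x, ⟨h1, h2⟩, rfl⟩
      have := one_le_friableCount h1 y
      simp only
      rw [div_le_one (by linarith)]
      exact friableCount_mono (div_le_self (by linarith) hz) le_rfl
    · exact ⟨x, ⟨h1, hx⟩, rfl⟩
  · push Not at h1
    rw [friableCount_eq_zero h1, friableCount_eq_zero, mul_zero]
    rw [div_lt_iff₀ (by linarith)]; linarith

theorem friableRatio_nonneg (X y z : ℝ) : 0 ≤ friableRatio X y z := by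
  apply Real.sSup_nonneg
  rintro _ ⟨x, -, rfl⟩
  exact div_nonneg (friableCount_nonneg _ _) (friableCount_nonneg _ _)

theorem friableRatio_le_one {X y z : ℝ} (hX : 1 ≤ X) (hz : 1 ≤ z) : friableRatio X y z ≤ 1 :=
  friableRatio_le hX fun x h1 _ => by
    rw [one_mul]
    exact friableCount_mono (div_le_self (by linarith) hz) le_rfl

theorem friableRatio_anti {X y z z' : ℝ} (hX : 1 ≤ X) (hz : 1 ≤ z) (h : z ≤ z') :
    friableRatio X y z' ≤ friableRatio X y z :=
  friableRatio_le hX fun x h1 h2 => le_trans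
    (friableCount_mono (div_le_div_of_nonneg_left (by linarith) (by linarith) h) le_rfl)
    (friableCount_div_le hz h2)

/-- This is why F is a supremum over all x ≤ X: after division by z one is still in range, or below
1 where Ψ vanishes. -/
theorem friableRatio_mul_le {X y z z' : ℝ} (hX : 1 ≤ X) (hz : 1 ≤ z) (hz' : 1 ≤ z') :
    friableRatio X y (z * z') ≤ friableRatio X y z * friableRatio X y z' :=
  friableRatio_le hX fun x h1 h2 => by
    have h3 : x / z ≤ X := (div_le_self (by linarith) hz).trans h2
    calc friableCount (x / (z * z')) y = friableCount (x / z / z') y := by rw [div_div]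
      _ ≤ friableRatio X y z' * friableCount (x / z) y := friableCount_div_le hz' h3
      _ ≤ friableRatio X y z' * (friableRatio X y z * friableCount x y) :=
        mul_le_mul_of_nonneg_left (friableCount_div_le hz h2) (friableRatio_nonneg _ _ _)
      _ = _ := by ring

theorem friableRatio_pow_le {X y z : ℝ} (hX : 1 ≤ X) (hz : 1 ≤ z) (n : ℕ) :
    friableRatio X y (z ^ n) ≤ friableRatio X y z ^ n := by
  induction n with
  | zero => simpa using friableRatio_le_one hX le_rfl
  | succ n ih =>
    rw [pow_succ, pow_succ]
    exact (friableRatio_mul_le hX (one_le_pow₀ hz) hz).trans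
      (mul_le_mul_of_nonneg_right ih (friableRatio_nonneg _ _ _))

theorem exists_friableRatio_le_log_div : ∃ C : ℝ, 1 ≤ C ∧ ∀ X y z : ℝ, 1 ≤ X → 2 ≤ z → z ≤ y →
    friableRatio X y z ≤ C * Real.log X / z := by
  obtain ⟨c, hc, hc1, h⟩ := exists_theta_lower
  refine ⟨1 / c, by rw [le_div_iff₀ hc]; linarith, fun X y z hX hz hzy => ?_⟩
  refine friableRatio_le hX fun x h1 h2 => ?_
  have h3 := friableCount_div_mul_theta_le (x := x) (by linarith) hzy (by linarith)
  have h4 := h z hz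
  have h5 : friableCount (x / z) y * (c * z) ≤ friableCount x y * Real.log X := by
    refine le_trans (mul_le_mul_of_nonneg_left h4 (friableCount_nonneg _ _)) (h3.trans ?_)
    exact mul_le_mul_of_nonneg_left (Real.log_le_log (by linarith) h2) (friableCount_nonneg _ _)
  have hcz : 0 < c * z := by positivity
  calc friableCount (x / z) y = friableCount (x / z) y * (c * z) / (c * z) := by field_simp
    _ ≤ friableCount x y * Real.log X / (c * z) := by gcongr
    _ = _ := by field_simp

/-! ### Bounding F at small arguments by factorial moments. -/

/-- The binomial coefficient counts m-element sets of primes of P dividing n. The product of such a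
set is friable and at least a^m, so each set is charged at most Ψ(x/a^m, y). -/
theorem sum_choose_card_filter_dvd_le {x y a : ℝ} (hx : 0 ≤ x) (ha : 0 < a) (P : Finset ℕ)
    (hP : ∀ p ∈ P, p.Prime ∧ a ≤ p ∧ (p : ℝ) ≤ y) (m : ℕ) :
    ∑ n ∈ friableUpTo x y, (((P.filter (· ∣ n)).card.choose m : ℕ) : ℝ) ≤
      (P.card.choose m : ℕ) * friableCount (x / a ^ m) y := by
  have h1 : ∀ n ∈ friableUpTo x y, (((P.filter (· ∣ n)).card.choose m : ℕ) : ℝ) =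
      ∑ R ∈ P.powersetCard m, if (∏ p ∈ R, p) ∣ n then (1 : ℝ) else 0 := by
    intro n _
    rw [← Finset.card_powersetCard, ← Finset.sum_filter, Finset.sum_const, nsmul_eq_mul, mul_one,
      Nat.cast_inj]
    congr 1
    ext R
    simp only [Finset.mem_powersetCard, Finset.mem_filter]
    constructor
    · rintro ⟨h1, h2⟩
      have h3 : R ⊆ P := h1.trans (Finset.filter_subset _ _)
      refine ⟨⟨h3, h2⟩, Finset.prod_primes_dvd n (fun p hp => (hP p (h3 hp)).1.prime) ?_⟩
      exact fun p hp => (Finset.mem_filter.1 (h1 hp)).2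
    · rintro ⟨⟨h1, h2⟩, h3⟩
      exact ⟨fun p hp => Finset.mem_filter.2 ⟨h1 hp, (Finset.dvd_prod_of_mem _ hp).trans h3⟩, h2⟩
  rw [Finset.sum_congr rfl h1, Finset.sum_comm, ← Finset.card_powersetCard, ← nsmul_eq_mul]
  apply Finset.sum_le_card_nsmul
  intro R hR
  rw [Finset.mem_powersetCard] at hR
  have hfri : IsFriable y (∏ p ∈ R, p) := IsFriable.prod fun p hp =>
    isFriable_of_le (hP p (hR.1 hp)).1.ne_zero (hP p (hR.1 hp)).2.2
  rw [← Finset.sum_filter, Finset.sum_const, nsmul_eq_mul, mul_one,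
    card_friableUpTo_filter_dvd hfri]
  apply friableCount_mono _ le_rfl
  apply div_le_div_of_nonneg_left hx (by positivity)
  push_cast
  rw [← hR.2, ← Finset.prod_const]
  exact Finset.prod_le_prod (fun _ _ => ha.le) fun p hp => (hP p (hR.1 hp)).2.1

/-- This converts an m-th factorial moment into a bound for the mean. If ω ≥ 2m, the falling
factorial is at least (ω/2)^m, and for ω > τ one has ω ≤ τ (ω/τ)^m. -/
theorem natCast_le_add_descFactorial {ω m : ℕ} (hm : 1 ≤ m) {τ : ℝ} (hτ : 0 < τ) :
    (ω : ℝ) ≤ 2 * m + τ + τ * (2 / τ) ^ m * (ω.descFactorial m : ℕ) := by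
  have hm0 : (0 : ℝ) ≤ m := Nat.cast_nonneg m
  have hlast : 0 ≤ τ * (2 / τ) ^ m * (ω.descFactorial m : ℕ) := by positivity
  by_cases h1 : ω < 2 * m
  · have : (ω : ℝ) ≤ 2 * m := by exact_mod_cast h1.le
    linarith
  by_cases h2 : (ω : ℝ) ≤ τ
  · linarith
  push Not at h1 h2
  have h3 : ((ω + 1 - m : ℕ) : ℝ) ^ m ≤ (ω.descFactorial m : ℕ) := by
    exact_mod_cast Nat.pow_sub_le_descFactorial ω m
  have h4 : (ω : ℝ) / 2 ≤ ((ω + 1 - m : ℕ) : ℝ) := by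
    have : ω ≤ 2 * (ω + 1 - m) := by omega
    have : (ω : ℝ) ≤ 2 * ((ω + 1 - m : ℕ) : ℝ) := by exact_mod_cast this
    linarith
  have h5 : ((ω : ℝ) / 2) ^ m ≤ (ω.descFactorial m : ℕ) :=
    (pow_le_pow_left₀ (by positivity) h4 m).trans h3
  have h6 : (ω : ℝ) / τ ≤ ((ω : ℝ) / τ) ^ m :=
    le_self_pow₀ ((one_le_div hτ).2 h2.le) (by omega)
  have h7 : (ω : ℝ) ≤ τ * (2 / τ) ^ m * (ω.descFactorial m : ℕ) := by
    calc (ω : ℝ) = τ * (ω / τ) := by field_simp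
      _ ≤ τ * ((ω : ℝ) / τ) ^ m := by gcongr
      _ = τ * (2 / τ) ^ m * ((ω : ℝ) / 2) ^ m := by
          rw [mul_assoc, ← mul_pow]; congr 2; field_simp
      _ ≤ _ := by gcongr
  linarith

/-- The left side is controlled by the mean number of divisors from P of a friable integer. The m-th
factorial moment is at most (|P|ρ)^m, so the mean is O(m + |P|ρ): decay of F at the large argument
a^m is transferred down to b. -/
theorem friableRatio_mul_card_le {X y a b ρ : ℝ} (hX : 1 ≤ X) (ha : 1 ≤ a) (hρ : 0 < ρ)
    (P : Finset ℕ) (hP : ∀ p ∈ P, p.Prime ∧ a ≤ p ∧ (p : ℝ) ≤ b) (hPne : P.Nonempty) (hby : b ≤ y)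
    {m : ℕ} (hm : 1 ≤ m) (h : friableRatio X y (a ^ m) ≤ ρ ^ m) :
    friableRatio X y b * P.card ≤ 2 * m + 4 * P.card * ρ := by
  have hPc : (0 : ℝ) < P.card := by exact_mod_cast Finset.card_pos.2 hPne
  rw [← le_div_iff₀ hPc]
  refine friableRatio_le hX fun x h1 h2 => ?_
  rw [div_mul_eq_mul_div, le_div_iff₀ hPc]
  -- Chosen so that (2/τ) |P| ρ = 1, which makes the moment term contribute only τ Ψ(x, y).
  set τ : ℝ := 2 * P.card * ρ with hτ
  have hτ0 : 0 < τ := by positivity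
  have hΨ := friableCount_nonneg x y
  have hP' : ∀ p ∈ P, p.Prime ∧ a ≤ p ∧ (p : ℝ) ≤ y := fun p hp =>
    ⟨(hP p hp).1, (hP p hp).2.1, (hP p hp).2.2.trans hby⟩
  have hlow : friableCount (x / b) y * P.card ≤
      ∑ n ∈ friableUpTo x y, ((P.filter (· ∣ n)).card : ℝ) := by
    have := sum_friableUpTo_sum_dvd (x := x) (y := y) P
      (fun p hp => isFriable_of_le (hP' p hp).1.ne_zero (hP' p hp).2.2) (fun _ => 1)
    simp only [Finset.sum_const, nsmul_eq_mul, mul_one, one_mul] at this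
    rw [this, mul_comm, ← nsmul_eq_mul]
    apply Finset.card_nsmul_le_sum
    intro p hp
    apply friableCount_mono _ le_rfl
    apply div_le_div_of_nonneg_left (by linarith) _ (hP p hp).2.2
    linarith [(hP p hp).2.1]
  refine hlow.trans ?_
  have hdesc : ∑ n ∈ friableUpTo x y, (((P.filter (· ∣ n)).card.descFactorial m : ℕ) : ℝ) ≤
      (P.card : ℝ) ^ m * (ρ ^ m * friableCount x y) := by
    simp_rw [Nat.descFactorial_eq_factorial_mul_choose, Nat.cast_mul]
    rw [← Finset.mul_sum]
    calc (m.factorial : ℝ) * ∑ n ∈ friableUpTo x y, (((P.filter (· ∣ n)).card.choose m : ℕ) : ℝ)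
        ≤ (m.factorial : ℝ) * ((P.card.choose m : ℕ) * friableCount (x / a ^ m) y) := by
          gcongr
          exact sum_choose_card_filter_dvd_le (by linarith) (by linarith) P hP' m
      _ = ((P.card.descFactorial m : ℕ) : ℝ) * friableCount (x / a ^ m) y := by
          rw [Nat.descFactorial_eq_factorial_mul_choose]; push_cast; ring
      _ ≤ (P.card : ℝ) ^ m * (ρ ^ m * friableCount x y) := by
          apply mul_le_mul _ _ (friableCount_nonneg _ _) (by positivity)
          · exact_mod_cast Nat.descFactorial_le_pow _ _
          · exact (friableCount_div_le (one_le_pow₀ ha) h2).trans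
              (mul_le_mul_of_nonneg_right h hΨ)
  calc ∑ n ∈ friableUpTo x y, ((P.filter (· ∣ n)).card : ℝ)
      ≤ ∑ n ∈ friableUpTo x y, (2 * m + τ + τ * (2 / τ) ^ m *
          ((P.filter (· ∣ n)).card.descFactorial m : ℕ)) :=
        Finset.sum_le_sum fun n _ => natCast_le_add_descFactorial hm hτ0
    _ = friableCount x y * (2 * m + τ) + τ * (2 / τ) ^ m *
          ∑ n ∈ friableUpTo x y, (((P.filter (· ∣ n)).card.descFactorial m : ℕ) : ℝ) := by
        rw [Finset.sum_add_distrib, Finset.sum_const, nsmul_eq_mul, Finset.mul_sum, friableCount]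
    _ ≤ friableCount x y * (2 * m + τ) + τ * (2 / τ) ^ m *
          ((P.card : ℝ) ^ m * (ρ ^ m * friableCount x y)) := by gcongr
    _ = friableCount x y * (2 * m + τ) + τ * ((2 / τ * P.card * ρ) ^ m * friableCount x y) := by
        rw [mul_pow, mul_pow]; ring
    _ = friableCount x y * (2 * m + τ) + τ * friableCount x y := by
        have : 2 / τ * P.card * ρ = 1 := by rw [hτ]; field_simp
        rw [this, one_pow, one_mul]
    _ = (2 * m + 4 * P.card * ρ) * friableCount x y := by rw [hτ]; ring

/-- Apply the moment argument to the primes in (2^(i−s), 2^i], of which there are ≫ 2^i / i, with m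
= I and ρ = 2^(−(i−s)/2). The bare bound F(z) ≪ log X / z is useless when z is below log X, which is
the range gained here. -/
theorem exists_friableRatio_two_pow_le : ∃ C : ℝ, 1 ≤ C ∧ ∀ (X y : ℝ) (I : ℕ), 1 ≤ X → 1 ≤ I →
    (2 : ℝ) ^ I ≤ y → friableRatio X y (2 ^ I) ≤ (√2)⁻¹ ^ I → ∀ i ≤ I,
      friableRatio X y (2 ^ i) ≤ C * (I * i / 2 ^ i + (√2)⁻¹ ^ i) := by
  obtain ⟨s, hs, c, hc, hcard⟩ := exists_card_primesIoc_lower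
  have h2 : (1 : ℝ) < √2 := by
    rw [Real.lt_sqrt (by norm_num)]; norm_num
  have hl2 : 0 < Real.log 2 := Real.log_pos (by norm_num)
  set r : ℝ := (√2)⁻¹ with hr
  have hr0 : 0 < r := by positivity
  have hr1 : r ≤ 1 := inv_le_one_of_one_le₀ h2.le
  have hrs : (√2) ^ s * r ^ s = 1 := by rw [← mul_pow, hr, mul_inv_cancel₀ (by positivity), one_pow]
  have hs1 : 1 ≤ (√2) ^ s := one_le_pow₀ h2.le
  refine ⟨max (2 * Real.log 2 / c) (4 * (√2) ^ s), le_max_of_le_right (by linarith), ?_⟩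
  intro X y I hX hI hIy hh i hi
  set C := max (2 * Real.log 2 / c) (4 * (√2) ^ s) with hC
  have hC1 : 2 * Real.log 2 / c ≤ C := le_max_left _ _
  have hC2 : 4 * (√2) ^ s ≤ C := le_max_right _ _
  have hC0 : 0 < C := lt_of_lt_of_le (by positivity) hC2
  -- For these boundedly many i the bound F ≤ 1 suffices, since C absorbs (√2)^s.
  by_cases his : i < s + 1
  · have h3 : 1 ≤ C * r ^ i := by
      calc (1 : ℝ) = (√2) ^ s * r ^ s := hrs.symm
        _ ≤ C * r ^ i := by
          have := pow_le_pow_of_le_one hr0.le hr1 (show i ≤ s by omega)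
          gcongr
          linarith
    have h4 : 0 ≤ C * (I * i / 2 ^ i) := by positivity
    have := friableRatio_le_one (y := y) hX (one_le_pow₀ (n := i) (one_le_two (α := ℝ)))
    rw [mul_add]
    linarith
  · push Not at his
    have hw2 : (2 : ℝ) ≤ 2 ^ i := by
      calc (2 : ℝ) = 2 ^ 1 := by norm_num
        _ ≤ 2 ^ i := pow_le_pow_right₀ (by norm_num) (by omega)
    have hdiv : (2 : ℝ) ^ i / 2 ^ s = 2 ^ (i - s) := by
      rw [div_eq_iff (by positivity), ← pow_add]; congr 1; omega
    have hP := hcard _ hw2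
    rw [hdiv, Real.log_pow] at hP
    set P := primesIoc (2 ^ (i - s)) (2 ^ i) with hPdef
    have hi0 : (0 : ℝ) < i := by exact_mod_cast (show 0 < i by omega)
    have hPc : (0 : ℝ) < P.card := lt_of_lt_of_le (by positivity) hP
    have hmem : ∀ p ∈ P, p.Prime ∧ (2 : ℝ) ^ (i - s) ≤ p ∧ (p : ℝ) ≤ 2 ^ i := fun p hp => by
      rw [mem_primesIoc (by positivity) (by positivity)] at hp
      exact ⟨hp.1, hp.2.1.le, hp.2.2⟩
    have hiy : (2 : ℝ) ^ i ≤ y := (pow_le_pow_right₀ (by norm_num) hi).trans hIy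
    -- Here (2^(i−s))^I = (2^I)^(i−s), so the hypothesis at 2^I is raised to the power i − s.
    have hpow : friableRatio X y ((2 ^ (i - s)) ^ I) ≤ (r ^ (i - s)) ^ I := by
      rw [← pow_mul, mul_comm, pow_mul, ← pow_mul r, mul_comm (i - s), pow_mul r]
      exact (friableRatio_pow_le hX (one_le_pow₀ one_le_two) _).trans
        (pow_le_pow_left₀ (friableRatio_nonneg _ _ _) hh _)
    have key := friableRatio_mul_card_le hX (one_le_pow₀ one_le_two) (ρ := r ^ (i - s))
      (by positivity) P hmem (Finset.card_pos.1 (by exact_mod_cast hPc)) hiy hI hpow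
    rw [← le_div_iff₀ hPc] at key
    refine key.trans ?_
    have e1 : (2 * (I : ℝ) + 4 * P.card * r ^ (i - s)) / P.card =
        2 * I / P.card + 4 * r ^ (i - s) := by field_simp
    rw [e1, mul_add]
    apply add_le_add
    · calc 2 * (I : ℝ) / P.card ≤ 2 * I / (c * 2 ^ i / (i * Real.log 2)) := by gcongr
        _ = 2 * Real.log 2 / c * (I * i / 2 ^ i) := by field_simp
        _ ≤ _ := by gcongr
    · have e2 : r ^ (i - s) = (√2) ^ s * r ^ i := by
        calc r ^ (i - s) = (√2 ^ s * r ^ s) * r ^ (i - s) := by rw [hrs, one_mul]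
          _ = √2 ^ s * (r ^ s * r ^ (i - s)) := by ring
          _ = _ := by rw [← pow_add]; congr 2; omega
      rw [e2, ← mul_assoc]
      gcongr

/-! ### The sum of F(p)² over primes beyond y. -/

theorem sum_sq_div_two_pow_le (N : ℕ) : ∑ i ∈ Finset.range N, (i : ℝ) ^ 2 / 2 ^ i ≤ 6 := by
  have h : ∑ i ∈ Finset.range N, (i : ℝ) ^ 2 / 2 ^ i =
      6 - 2 * ((N : ℝ) ^ 2 + 2 * N + 3) / 2 ^ N := by
    induction N with
    | zero => norm_num
    | succ n ih =>
      rw [Finset.sum_range_succ, ih]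
      push_cast
      rw [pow_succ]
      field_simp
      ring
  rw [h]
  have : 0 ≤ 2 * ((N : ℝ) ^ 2 + 2 * N + 3) / 2 ^ N := by positivity
  linarith

/-- With f(i) = 2^i F(2^i)², submultiplicativity gives f(I + i) ≤ f(I) f(i) ≤ f(i)/2, so the terms
beyond I amount to at most half of the full sum. -/
theorem sum_two_pow_mul_friableRatio_sq_le {X y : ℝ} (hX : 1 ≤ X) {I : ℕ}
    (h : 2 ^ I * friableRatio X y (2 ^ I) ^ 2 ≤ 1 / 2) (N : ℕ) :
    ∑ i ∈ Finset.range N, 2 ^ i * friableRatio X y (2 ^ i) ^ 2 ≤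
      2 * ∑ i ∈ Finset.range I, 2 ^ i * friableRatio X y (2 ^ i) ^ 2 := by
  set f : ℕ → ℝ := fun i => 2 ^ i * friableRatio X y (2 ^ i) ^ 2 with hf
  have hf0 : ∀ i, 0 ≤ f i := fun i => by positivity
  have hmul : ∀ i, f (I + i) ≤ 1 / 2 * f i := by
    intro i
    have h1 : friableRatio X y (2 ^ (I + i)) ≤ friableRatio X y (2 ^ I) * friableRatio X y (2 ^ i) := by
      rw [pow_add]
      exact friableRatio_mul_le hX (one_le_pow₀ one_le_two) (one_le_pow₀ one_le_two)
    calc f (I + i) ≤ 2 ^ (I + i) * (friableRatio X y (2 ^ I) * friableRatio X y (2 ^ i)) ^ 2 := by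
          have := friableRatio_nonneg X y (2 ^ (I + i))
          simp only [hf]
          gcongr
      _ = 2 ^ I * friableRatio X y (2 ^ I) ^ 2 * f i := by simp only [hf]; ring
      _ ≤ _ := mul_le_mul_of_nonneg_right h (hf0 i)
  have hmono : ∑ i ∈ Finset.range N, f i ≤ ∑ i ∈ Finset.range (I + N), f i :=
    Finset.sum_le_sum_of_subset_of_nonneg (Finset.range_subset_range.2 (by omega))
      fun i _ _ => hf0 i
  rw [Finset.sum_range_add] at hmono
  have h2 : ∑ i ∈ Finset.range N, f (I + i) ≤ 1 / 2 * ∑ i ∈ Finset.range N, f i := by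
    rw [Finset.mul_sum]
    exact Finset.sum_le_sum fun i _ => hmul i
  linarith

/-- Cover (y, X] by dyadic blocks (2^(I+i), 2^(I+i+1)]. Each has ≪ 2^(I+i) / I primes, and there
F(p) ≤ F(2^I) F(2^i), so the factor depending on I comes out. -/
theorem sum_friableRatio_sq_primes_le {X y : ℝ} (hX : 1 ≤ X) {I : ℕ} (hI : 1 ≤ I)
    (hIy : (2 : ℝ) ^ I ≤ y) {B : ℝ}
    (hB : ∀ N : ℕ, ∑ i ∈ Finset.range N, 2 ^ i * friableRatio X y (2 ^ i) ^ 2 ≤ B) :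
    ∑ p ∈ primesIoc y X, friableRatio X y p ^ 2 ≤
      4 / I * (2 ^ I * friableRatio X y (2 ^ I) ^ 2) * B := by
  obtain ⟨N, hN⟩ := pow_unbounded_of_one_lt X (one_lt_two (α := ℝ))
  have hl2 : 0 < Real.log 2 := Real.log_pos (by norm_num)
  have hI0 : (0 : ℝ) < I := by exact_mod_cast hI
  have hy0 : 0 < y := lt_of_lt_of_le (by positivity) hIy
  have hsub : primesIoc y X ⊆
      (Finset.range N).biUnion fun i => primesIoc (2 ^ (I + i)) (2 * 2 ^ (I + i)) := by
    intro p hp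
    rw [mem_primesIoc hy0.le (by linarith)] at hp
    have hex : ∃ j : ℕ, (p : ℝ) ≤ 2 ^ j := ⟨N, hp.2.2.trans hN.le⟩
    classical
    set j := Nat.find hex with hj
    have hj1 : (p : ℝ) ≤ 2 ^ j := Nat.find_spec hex
    have hjI : I < j := by
      by_contra hle
      push Not at hle
      have : (2 : ℝ) ^ j ≤ 2 ^ I := pow_le_pow_right₀ (by norm_num) hle
      linarith [hp.2.1]
    have hjN : j ≤ N := Nat.find_min' hex (hp.2.2.trans hN.le)
    have hj2 : (2 : ℝ) ^ (j - 1) < p := by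
      by_contra hle
      push Not at hle
      exact Nat.find_min hex (m := j - 1) (by omega) hle
    rw [Finset.mem_biUnion]
    refine ⟨j - 1 - I, Finset.mem_range.2 (by omega), ?_⟩
    rw [mem_primesIoc (by positivity) (by positivity), show I + (j - 1 - I) = j - 1 by omega,
      ← pow_succ', show j - 1 + 1 = j by omega]
    exact ⟨hp.1, hj2, hj1⟩
  calc ∑ p ∈ primesIoc y X, friableRatio X y p ^ 2
      ≤ ∑ p ∈ (Finset.range N).biUnion fun i => primesIoc (2 ^ (I + i)) (2 * 2 ^ (I + i)),
          friableRatio X y p ^ 2 :=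
        Finset.sum_le_sum_of_subset_of_nonneg hsub fun _ _ _ => by positivity
    _ ≤ ∑ i ∈ Finset.range N, ∑ p ∈ primesIoc (2 ^ (I + i)) (2 * 2 ^ (I + i)),
          friableRatio X y p ^ 2 := by
        rw [Finset.sum_biUnion]
        intro i _ j _ hij
        rw [Function.onFun, Finset.disjoint_left]
        intro p hp hp'
        rw [mem_primesIoc (by positivity) (by positivity), ← pow_succ'] at hp hp'
        have h1 := (pow_lt_pow_iff_right₀ (one_lt_two (α := ℝ))).1 (hp.2.1.trans_le hp'.2.2)
        have h2 := (pow_lt_pow_iff_right₀ (one_lt_two (α := ℝ))).1 (hp'.2.1.trans_le hp.2.2)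
        omega
    _ ≤ ∑ i ∈ Finset.range N, 4 / I * (2 ^ I * friableRatio X y (2 ^ I) ^ 2) *
          (2 ^ i * friableRatio X y (2 ^ i) ^ 2) := by
        apply Finset.sum_le_sum
        intro i _
        have hbig : (1 : ℝ) < 2 ^ (I + i) := one_lt_pow₀ (by norm_num) (by omega)
        have hcard := card_primesIoc_le hbig
        have hmul : friableRatio X y (2 ^ (I + i)) ≤
            friableRatio X y (2 ^ I) * friableRatio X y (2 ^ i) := by
          rw [pow_add]
          exact friableRatio_mul_le hX (one_le_pow₀ one_le_two) (one_le_pow₀ one_le_two)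
        have hlog : I * Real.log 2 ≤ Real.log (2 ^ (I + i)) := by
          rw [Real.log_pow]
          gcongr
          simp
        have hlog4 : Real.log 4 = 2 * Real.log 2 := by
          rw [show (4 : ℝ) = 2 ^ 2 by norm_num, Real.log_pow]; norm_num
        calc ∑ p ∈ primesIoc (2 ^ (I + i)) (2 * 2 ^ (I + i)), friableRatio X y p ^ 2
            ≤ (primesIoc (2 ^ (I + i)) (2 * 2 ^ (I + i))).card *
                (friableRatio X y (2 ^ I) * friableRatio X y (2 ^ i)) ^ 2 := by
              rw [← nsmul_eq_mul]
              apply Finset.sum_le_card_nsmul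
              intro p hp
              rw [mem_primesIoc (by positivity) (by positivity)] at hp
              have := friableRatio_nonneg X y p
              gcongr
              exact (friableRatio_anti hX hbig.le hp.2.1.le).trans hmul
          _ ≤ (2 * Real.log 4 * 2 ^ (I + i) / (I * Real.log 2)) *
                (friableRatio X y (2 ^ I) * friableRatio X y (2 ^ i)) ^ 2 := by
              gcongr
              refine hcard.trans ?_
              have : 0 < Real.log 4 := Real.log_pos (by norm_num)
              gcongr
          _ = _ := by
              rw [hlog4]; field_simp; ring
    _ = 4 / I * (2 ^ I * friableRatio X y (2 ^ I) ^ 2) *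
          ∑ i ∈ Finset.range N, 2 ^ i * friableRatio X y (2 ^ i) ^ 2 := by rw [Finset.mul_sum]
    _ ≤ _ := mul_le_mul_of_nonneg_left (hB N) (by positivity)

/-- Take 2^I ≤ y < 2^(I+1). Then 2^I F(2^I)² ≪ (log X)²/y, while Σ 2^i F(2^i)² ≪ I²; with the factor
1/I from the prime count, one I ≪ log y survives. -/
theorem exists_sum_friableRatio_sq_le : ∃ C : ℝ, 1 ≤ C ∧ ∀ X y : ℝ, 1 ≤ X → 2 ≤ y →
    C * Real.log X ^ 2 ≤ y →
      ∑ p ∈ primesIoc y X, friableRatio X y p ^ 2 ≤ C * Real.log X ^ 2 * Real.log y / y := by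
  obtain ⟨C₁, hC₁, h₁⟩ := exists_friableRatio_le_log_div
  obtain ⟨C₂, hC₂, h₂⟩ := exists_friableRatio_two_pow_le
  have hl2 : 0 < Real.log 2 := Real.log_pos (by norm_num)
  -- 448 = 4 · 2 · (2 · 14) · 2: the block count, the loss y < 2 · 2^I, the doubled sum over i < I,
  -- and I ≤ 2 log y.
  refine ⟨448 * C₁ ^ 2 * C₂ ^ 2, ?_, ?_⟩
  · have := one_le_pow₀ hC₁ (n := 2)
    have := one_le_pow₀ hC₂ (n := 2)
    nlinarith
  intro X y hX hy hXy
  have hlX : 0 ≤ Real.log X := Real.log_nonneg hX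
  obtain ⟨I, hI1, hI2⟩ := exists_nat_pow_near (show 1 ≤ y by linarith) (one_lt_two (α := ℝ))
  have hI : 1 ≤ I := by
    by_contra h
    have : I = 0 := by omega
    subst this
    norm_num at hI2
    linarith
  have hI0 : (0 : ℝ) < I := by exact_mod_cast hI
  have h2I : (2 : ℝ) ≤ 2 ^ I := by
    calc (2 : ℝ) = 2 ^ 1 := by norm_num
      _ ≤ 2 ^ I := pow_le_pow_right₀ (by norm_num) hI
  have hF := h₁ X y (2 ^ I) hX h2I hI1
  have hF0 := friableRatio_nonneg X y (2 ^ I)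
  rw [pow_succ] at hI2
  have hlow : y / 2 ≤ 2 ^ I := by linarith
  have hA : 2 ^ I * friableRatio X y (2 ^ I) ^ 2 ≤ 2 * C₁ ^ 2 * Real.log X ^ 2 / y := by
    calc 2 ^ I * friableRatio X y (2 ^ I) ^ 2 ≤ 2 ^ I * (C₁ * Real.log X / 2 ^ I) ^ 2 := by gcongr
      _ = C₁ ^ 2 * Real.log X ^ 2 / 2 ^ I := by field_simp
      _ ≤ C₁ ^ 2 * Real.log X ^ 2 / (y / 2) := by gcongr
      _ = _ := by field_simp
  have hhalf : 2 ^ I * friableRatio X y (2 ^ I) ^ 2 ≤ 1 / 2 := by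
    refine hA.trans ?_
    rw [div_le_iff₀ (by linarith)]
    have h3 : 1 * (C₁ ^ 2 * Real.log X ^ 2) ≤ C₂ ^ 2 * (C₁ ^ 2 * Real.log X ^ 2) :=
      mul_le_mul_of_nonneg_right (one_le_pow₀ hC₂) (by positivity)
    nlinarith [mul_nonneg (sq_nonneg C₁) (sq_nonneg (Real.log X))]
  have hr : (√2)⁻¹ ^ 2 = (1 / 2 : ℝ) := by
    rw [inv_pow, Real.sq_sqrt (by norm_num)]; norm_num
  have hri : ∀ i : ℕ, 2 ^ i * ((√2)⁻¹ ^ i) ^ 2 = (1 : ℝ) := fun i => by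
    rw [← pow_mul, mul_comm i 2, pow_mul, hr, ← mul_pow]; norm_num
  have hroot : friableRatio X y (2 ^ I) ≤ (√2)⁻¹ ^ I := by
    apply le_of_sq_le_sq _ (by positivity)
    have h4 := hri I
    have : (2 : ℝ) ^ I * friableRatio X y (2 ^ I) ^ 2 ≤ 2 ^ I * ((√2)⁻¹ ^ I) ^ 2 := by
      rw [h4]; linarith
    exact le_of_mul_le_mul_left this (by positivity)
  have hcoef := h₂ X y I hX hI hI1 hroot
  have hsumI : ∑ i ∈ Finset.range I, 2 ^ i * friableRatio X y (2 ^ i) ^ 2 ≤ 14 * C₂ ^ 2 * I ^ 2 := by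
    calc ∑ i ∈ Finset.range I, 2 ^ i * friableRatio X y (2 ^ i) ^ 2
        ≤ ∑ i ∈ Finset.range I, 2 * C₂ ^ 2 * (I ^ 2 * ((i : ℝ) ^ 2 / 2 ^ i) + 1) := by
          apply Finset.sum_le_sum
          intro i hi
          have h5 := hcoef i (Finset.mem_range.1 hi).le
          have h6 := friableRatio_nonneg X y (2 ^ i)
          calc 2 ^ i * friableRatio X y (2 ^ i) ^ 2
              ≤ 2 ^ i * (C₂ * (I * i / 2 ^ i + (√2)⁻¹ ^ i)) ^ 2 := by gcongr
            _ ≤ 2 ^ i * (C₂ ^ 2 * (2 * ((I * i / 2 ^ i) ^ 2 + ((√2)⁻¹ ^ i) ^ 2))) := by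
                rw [mul_pow]
                gcongr
                exact add_sq_le
            _ = 2 * C₂ ^ 2 * (2 ^ i * (I * i / 2 ^ i) ^ 2 + 2 ^ i * ((√2)⁻¹ ^ i) ^ 2) := by ring
            _ = _ := by
                rw [hri]; congr 2; field_simp
      _ = 2 * C₂ ^ 2 * (I ^ 2 * ∑ i ∈ Finset.range I, (i : ℝ) ^ 2 / 2 ^ i + I) := by
          rw [← Finset.mul_sum, Finset.sum_add_distrib, ← Finset.mul_sum]; simp
      _ ≤ 2 * C₂ ^ 2 * (I ^ 2 * 6 + I ^ 2) := by
          have := sum_sq_div_two_pow_le I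
          have h7 : (I : ℝ) ≤ I ^ 2 := le_self_pow₀ (by exact_mod_cast hI) (by norm_num)
          gcongr
      _ = _ := by ring
  have hfin := sum_friableRatio_sq_primes_le hX hI hI1
    (fun N => (sum_two_pow_mul_friableRatio_sq_le hX hhalf N).trans
      (mul_le_mul_of_nonneg_left hsumI (by norm_num : (0 : ℝ) ≤ 2)))
  refine hfin.trans ?_
  have hIlog : (I : ℝ) ≤ 2 * Real.log y := by
    have h8 : I * Real.log 2 ≤ Real.log y := by
      rw [← Real.log_pow]; exact Real.log_le_log (by positivity) hI1
    nlinarith [Real.log_two_gt_d9]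
  calc 4 / I * (2 ^ I * friableRatio X y (2 ^ I) ^ 2) * (2 * (14 * C₂ ^ 2 * I ^ 2))
      ≤ 4 / I * (2 * C₁ ^ 2 * Real.log X ^ 2 / y) * (2 * (14 * C₂ ^ 2 * I ^ 2)) := by gcongr
    _ = 224 * C₁ ^ 2 * C₂ ^ 2 * Real.log X ^ 2 / y * I := by field_simp; ring
    _ ≤ 224 * C₁ ^ 2 * C₂ ^ 2 * Real.log X ^ 2 / y * (2 * Real.log y) := by
        have : 0 < y := by linarith
        gcongr
    _ = _ := by ring

/-! ### Counting tuples with equal products. -/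

/-- Each prime factor, counted with multiplicity, is allotted to one of the k slots; every
factorization arises in this way. -/
theorem card_finMulAntidiag_le (k : ℕ) {n : ℕ} (hn : n ≠ 0) :
    (Nat.finMulAntidiag k n).card ≤ k ^ ArithmeticFunction.cardFactors n := by
  induction n using induction_on_primes with
  | zero => exact absurd rfl hn
  | one => rw [Nat.finMulAntidiag_one]; simp
  | prime_mul p a hp ih =>
    have ha : a ≠ 0 := right_ne_zero_of_mul hn
    have hsub : Nat.finMulAntidiag k (p * a) ⊆
        (Finset.univ ×ˢ Nat.finMulAntidiag k a).image
          (fun q : Fin k × (Fin k → ℕ) => Function.update q.2 q.1 (p * q.2 q.1)) := by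
      intro f hf
      rw [Nat.mem_finMulAntidiag] at hf
      obtain ⟨i, -, q, hq⟩ := (Prime.dvd_finsetProd_iff hp.prime f).1
        (show p ∣ ∏ i, f i by rw [hf.1]; exact dvd_mul_right _ _)
      refine Finset.mem_image.2 ⟨(i, Function.update f i q), ?_, ?_⟩
      · rw [Finset.mem_product, Nat.mem_finMulAntidiag]
        refine ⟨Finset.mem_univ _, ?_, ha⟩
        have h1 := Finset.mul_prod_erase Finset.univ f (Finset.mem_univ i)
        simp only
        rw [Finset.prod_update_of_mem (Finset.mem_univ i), Finset.sdiff_singleton_eq_erase]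
        rw [hq, hf.1, mul_assoc] at h1
        exact Nat.eq_of_mul_eq_mul_left hp.pos h1
      · simp [← hq]
    calc (Nat.finMulAntidiag k (p * a)).card
        ≤ (Finset.univ ×ˢ Nat.finMulAntidiag k a : Finset (Fin k × (Fin k → ℕ))).card :=
          (Finset.card_le_card hsub).trans Finset.card_image_le
      _ = k * (Nat.finMulAntidiag k a).card := by simp [Finset.card_product]
      _ ≤ k * k ^ ArithmeticFunction.cardFactors a := Nat.mul_le_mul_left _ (ih ha)
      _ = k ^ ArithmeticFunction.cardFactors (p * a) := by
          rw [ArithmeticFunction.cardFactors_mul hp.ne_zero ha,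
            ArithmeticFunction.cardFactors_apply_prime hp, pow_add, pow_one]

theorem cardFactors_prod {ι : Type*} (s : Finset ι) {f : ι → ℕ} (h : ∀ i ∈ s, f i ≠ 0) :
    ArithmeticFunction.cardFactors (∏ i ∈ s, f i) =
      ∑ i ∈ s, ArithmeticFunction.cardFactors (f i) := by
  classical
  induction s using Finset.induction_on with
  | empty => simp
  | insert a s ha ih =>
    rw [Finset.prod_insert ha, Finset.sum_insert ha, ArithmeticFunction.cardFactors_mul
      (h a (by simp)) (Finset.prod_ne_zero_iff.2 fun i hi => h i (by simp [hi])),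
      ih fun i hi => h i (by simp [hi])]

set_option maxHeartbeats 1000000 in
/-- The number of pairs of `k`-tuples from `A` with equal products, where each element `n` is only
remembered through a multiplicative image `ρ n`. -/
theorem sum_sq_card_filter_prod_le {A : Finset ℕ} {ρ : ℕ → ℕ} (k : ℕ)
    (hρ : ∀ n ∈ A, ρ n ≠ 0) (hmul : ∀ ν : Fin k → ℕ, (∀ i, ν i ∈ A) → ρ (∏ i, ν i) = ∏ i, ρ (ν i))
    (M : Finset ℕ) :
    ∑ m ∈ M, (((Fintype.piFinset fun _ : Fin k => A).filter (∏ i, · i = m)).card : ℝ) ^ 2 ≤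
      (∑ b ∈ A.image ρ, (k : ℝ) ^ ArithmeticFunction.cardFactors b *
        ((A.filter (ρ · = b)).card : ℝ) ^ 2) ^ k := by
  classical
  set Q := Fintype.piFinset fun _ : Fin k => A with hQ
  have hmemQ : ∀ ν, ν ∈ Q ↔ ∀ i, ν i ∈ A := fun ν => Fintype.mem_piFinset
  set R := A.image ρ with hR
  set B := Fintype.piFinset fun _ : Fin k => R with hB
  set W : ℕ → ℝ := fun b => ((A.filter (ρ · = b)).card : ℝ) with hW
  have hR0 : ∀ b ∈ R, b ≠ 0 := fun b hb => by
    obtain ⟨n, hn, rfl⟩ := Finset.mem_image.1 hb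
    exact hρ n hn
  -- regroup by the image under `ρ`
  set a : ℕ → ℝ := fun m => ((Q.filter (∏ i, · i = m)).card : ℝ) with ha
  set e : ℕ → ℝ := fun l => ((Q.filter (fun ν => ∏ i, ρ (ν i) = l)).card : ℝ) with he
  set Lset := M.image ρ with hL
  have h1 : ∑ m ∈ M, a m ^ 2 ≤ ∑ l ∈ Lset, e l ^ 2 := by
    have h2 : ∀ l ∈ Lset, ∑ m ∈ M.filter (ρ · = l), a m ^ 2 ≤ e l ^ 2 := by
      intro l _
      have h3 : ∑ m ∈ M.filter (ρ · = l), a m ≤ e l := by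
        simp only [ha, he]
        rw [← Nat.cast_sum, Nat.cast_le, ← Finset.card_biUnion]
        · apply Finset.card_le_card
          intro ν hν
          rw [Finset.mem_biUnion] at hν
          obtain ⟨m, hm, hν⟩ := hν
          rw [Finset.mem_filter] at hm hν ⊢
          refine ⟨hν.1, ?_⟩
          rw [← hmul ν ((hmemQ ν).1 hν.1), hν.2, hm.2]
        · intro m _ m' _ hne
          rw [Function.onFun, Finset.disjoint_left]
          intro ν h h'
          rw [Finset.mem_filter] at h h'
          exact hne (h.2.symm.trans h'.2)
      refine le_trans ?_ (pow_le_pow_left₀ (Finset.sum_nonneg fun m _ => by positivity) h3 2)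
      exact Finset.sum_sq_le_sq_sum_of_nonneg fun m _ => by positivity
    calc ∑ m ∈ M, a m ^ 2 = ∑ l ∈ Lset, ∑ m ∈ M.filter (ρ · = l), a m ^ 2 :=
          (Finset.sum_fiberwise_of_maps_to (fun m hm => Finset.mem_image_of_mem _ hm) _).symm
      _ ≤ _ := Finset.sum_le_sum h2
  refine h1.trans ?_
  -- Sort the tuples by the images β of their entries; for fixed β the entries are chosen
  -- independently.
  have h4 : ∀ l, e l = ∑ β ∈ B.filter (∏ i, · i = l), ∏ i, W (β i) := by
    intro l
    have hmaps : ∀ ν ∈ Q.filter (fun ν => ∏ i, ρ (ν i) = l), (fun i => ρ (ν i)) ∈ B.filter (∏ i, · i = l) := by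
      intro ν hν
      rw [Finset.mem_filter] at hν ⊢
      refine ⟨?_, hν.2⟩
      rw [hB, Fintype.mem_piFinset]
      exact fun i => Finset.mem_image_of_mem _ ((hmemQ ν).1 hν.1 i)
    simp only [he]
    rw [Finset.card_eq_sum_card_fiberwise hmaps, Nat.cast_sum]
    refine Finset.sum_congr rfl fun β hβ => ?_
    simp only [hW]
    rw [← Nat.cast_prod, Nat.cast_inj, ← Fintype.card_piFinset]
    congr 1
    ext ν
    rw [Finset.mem_filter] at hβ
    simp only [Finset.mem_filter, Fintype.mem_piFinset, hmemQ]
    constructor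
    · rintro ⟨⟨h5, h6⟩, h7⟩ i
      exact ⟨h5 i, congrFun h7 i⟩
    · intro h
      have h8 : (fun i => ρ (ν i)) = β := funext fun i => (h i).2
      exact ⟨⟨fun i => (h i).1, by rw [← hβ.2, ← h8]⟩, h8⟩
  -- Cauchy–Schwarz over the at most k^Ω(l) factorizations β of l. Complete additivity of Ω spreads
  -- this factor over the coordinates, so that the total becomes a k-th power.
  have h5 : ∀ l, e l ^ 2 ≤ ∑ β ∈ B.filter (∏ i, · i = l),
      ∏ i, ((k : ℝ) ^ ArithmeticFunction.cardFactors (β i) * W (β i) ^ 2) := by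
    intro l
    by_cases hne : (B.filter (∏ i, · i = l)).Nonempty
    · obtain ⟨β₀, hβ₀⟩ := hne
      rw [Finset.mem_filter, hB, Fintype.mem_piFinset] at hβ₀
      have hl : l ≠ 0 := by
        rw [← hβ₀.2]
        exact Finset.prod_ne_zero_iff.2 fun i _ => hR0 _ (hβ₀.1 i)
      have hcard : ((B.filter (∏ i, · i = l)).card : ℝ) ≤
          (k : ℝ) ^ ArithmeticFunction.cardFactors l := by
        have : (B.filter (∏ i, · i = l)).card ≤ (Nat.finMulAntidiag k l).card := by
          apply Finset.card_le_card
          intro β hβ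
          rw [Finset.mem_filter] at hβ
          exact Nat.mem_finMulAntidiag.2 ⟨hβ.2, hl⟩
        exact_mod_cast this.trans (card_finMulAntidiag_le k hl)
      rw [h4]
      calc (∑ β ∈ B.filter (∏ i, · i = l), ∏ i, W (β i)) ^ 2
          ≤ (B.filter (∏ i, · i = l)).card * ∑ β ∈ B.filter (∏ i, · i = l), (∏ i, W (β i)) ^ 2 :=
            sq_sum_le_card_mul_sum_sq
        _ ≤ (k : ℝ) ^ ArithmeticFunction.cardFactors l *
              ∑ β ∈ B.filter (∏ i, · i = l), (∏ i, W (β i)) ^ 2 :=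
            mul_le_mul_of_nonneg_right hcard (Finset.sum_nonneg fun _ _ => sq_nonneg _)
        _ = _ := by
            rw [Finset.mul_sum]
            refine Finset.sum_congr rfl fun β hβ => ?_
            rw [Finset.mem_filter, hB, Fintype.mem_piFinset] at hβ
            rw [Finset.prod_mul_distrib, Finset.prod_pow, Finset.prod_pow_eq_pow_sum, ← hβ.2,
              cardFactors_prod _ fun i _ => hR0 _ (hβ.1 i)]
    · rw [Finset.not_nonempty_iff_eq_empty] at hne
      rw [h4, hne]
      simp
  calc ∑ l ∈ Lset, e l ^ 2 ≤ ∑ l ∈ Lset, ∑ β ∈ B.filter (∏ i, · i = l),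
      ∏ i, ((k : ℝ) ^ ArithmeticFunction.cardFactors (β i) * W (β i) ^ 2) :=
        Finset.sum_le_sum fun l _ => h5 l
    _ ≤ ∑ β ∈ B, ∏ i, ((k : ℝ) ^ ArithmeticFunction.cardFactors (β i) * W (β i) ^ 2) := by
        rw [Finset.sum_fiberwise_eq_sum_filter]
        apply Finset.sum_le_sum_of_subset_of_nonneg (Finset.filter_subset _ _)
        intro β _ _
        exact Finset.prod_nonneg fun i _ => by positivity
    _ = _ := by
        rw [Finset.sum_pow']

/-! ### The Gaussian mean value theorem. -/

theorem natCast_cpow_I_mul {m : ℕ} (hm : m ≠ 0) (t : ℝ) :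
    (m : ℂ) ^ (Complex.I * (t : ℂ)) = Complex.exp (Complex.I * (Real.log m : ℝ) * t) := by
  rw [Complex.cpow_def_of_ne_zero (by exact_mod_cast hm), Complex.natCast_log]
  congr 1
  ring

/-- Expand the square; each cross term is the Fourier transform of a Gaussian at log m − log n. -/
theorem integrable_and_integral_gaussian_mul_norm_sq {T : ℝ} (hT : 0 < T) (s : Finset ℕ)
    (hs : ∀ m ∈ s, m ≠ 0) (a : ℕ → ℝ) :
    MeasureTheory.Integrable (fun t : ℝ =>
      Real.exp (-(t / T) ^ 2) * ‖∑ m ∈ s, (a m : ℂ) * (m : ℂ) ^ (Complex.I * (t : ℂ))‖ ^ 2) ∧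
    ∫ t : ℝ, Real.exp (-(t / T) ^ 2) *
        ‖∑ m ∈ s, (a m : ℂ) * (m : ℂ) ^ (Complex.I * (t : ℂ))‖ ^ 2 =
      √Real.pi * T * ∑ m ∈ s, ∑ n ∈ s, a m * a n *
        Real.exp (-(T ^ 2 * (Real.log m - Real.log n) ^ 2 / 4)) := by
  set b : ℂ := ((1 / T ^ 2 : ℝ) : ℂ) with hb
  have hbre : 0 < b.re := by rw [hb, Complex.ofReal_re]; positivity
  set g : ℕ → ℕ → ℝ → ℂ := fun m n t =>
    ((a m * a n : ℝ) : ℂ) * (Complex.exp (Complex.I * ((Real.log m - Real.log n : ℝ) : ℂ) * t) *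
      Complex.exp (-b * (t : ℂ) ^ 2)) with hg
  have hpt : ∀ t : ℝ, ((Real.exp (-(t / T) ^ 2) *
      ‖∑ m ∈ s, (a m : ℂ) * (m : ℂ) ^ (Complex.I * (t : ℂ))‖ ^ 2 : ℝ) : ℂ) =
      ∑ m ∈ s, ∑ n ∈ s, g m n t := by
    intro t
    have hF : ∑ m ∈ s, (a m : ℂ) * (m : ℂ) ^ (Complex.I * (t : ℂ)) =
        ∑ m ∈ s, (a m : ℂ) * Complex.exp (Complex.I * (Real.log m : ℝ) * t) :=
      Finset.sum_congr rfl fun m hm => by rw [natCast_cpow_I_mul (hs m hm)]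
    rw [hF]
    rw [Complex.ofReal_mul, Complex.ofReal_pow, Complex.ofReal_exp, ← Complex.mul_conj', map_sum, Finset.sum_mul_sum, Finset.mul_sum]
    refine Finset.sum_congr rfl fun m _ => ?_
    rw [Finset.mul_sum]
    refine Finset.sum_congr rfl fun n _ => ?_
    simp only [hg, hb, map_mul, Complex.conj_ofReal, ← Complex.exp_conj, Complex.conj_I]
    have e1 : Complex.exp ((-(t / T) ^ 2 : ℝ) : ℂ) =
        Complex.exp (-((1 / T ^ 2 : ℝ) : ℂ) * (t : ℂ) ^ 2) := by
      congr 1; push_cast; field_simp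
    have e2 : Complex.exp (Complex.I * ((Real.log m - Real.log n : ℝ) : ℂ) * t) =
        Complex.exp (Complex.I * (Real.log m : ℝ) * t) *
          Complex.exp (-Complex.I * (Real.log n : ℝ) * t) := by
      rw [← Complex.exp_add]; congr 1; push_cast; ring
    rw [e1, e2, Complex.ofReal_mul]
    ring
  have hgint : ∀ m n, MeasureTheory.Integrable (g m n) := by
    intro m n
    apply MeasureTheory.Integrable.const_mul
    have h2 := integrable_cexp_quadratic hbre
      (Complex.I * ((Real.log m - Real.log n : ℝ) : ℂ)) 0
    refine h2.congr (Filter.Eventually.of_forall fun t => ?_)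
    simp only
    rw [← Complex.exp_add]
    congr 1
    ring
  have hintsum : MeasureTheory.Integrable (fun t => ∑ m ∈ s, ∑ n ∈ s, g m n t) :=
    MeasureTheory.integrable_finsetSum _ fun m _ => MeasureTheory.integrable_finsetSum _ fun n _ =>
      hgint m n
  constructor
  · have h := hintsum.re
    refine h.congr (Filter.Eventually.of_forall fun t => ?_)
    simp only
    rw [← hpt t]
    simp only [RCLike.re_to_complex, Complex.ofReal_re]
  · have hval : ∀ m n, ∫ t, g m n t = ((√Real.pi * T * (a m * a n *
        Real.exp (-(T ^ 2 * (Real.log m - Real.log n) ^ 2 / 4))) : ℝ) : ℂ) := by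
      intro m n
      simp only [hg]
      rw [MeasureTheory.integral_const_mul, fourierIntegral_gaussian hbre]
      have e1 : ((Real.pi : ℂ) / b) ^ (1 / 2 : ℂ) = ((√Real.pi * T : ℝ) : ℂ) := by
        rw [hb, ← Complex.ofReal_div, show (1 / 2 : ℂ) = ((1 / 2 : ℝ) : ℂ) by push_cast; rfl,
          ← Complex.ofReal_cpow (by positivity), ← Real.sqrt_eq_rpow]
        congr 1
        rw [div_div_eq_mul_div, div_one, Real.sqrt_mul Real.pi_pos.le, Real.sqrt_sq hT.le]
      have e2 : Complex.exp (-((Real.log m - Real.log n : ℝ) : ℂ) ^ 2 / (4 * b)) =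
          ((Real.exp (-(T ^ 2 * (Real.log m - Real.log n) ^ 2 / 4)) : ℝ) : ℂ) := by
        rw [Complex.ofReal_exp]
        congr 1
        rw [hb]
        push_cast
        field_simp
      rw [e1, e2]
      push_cast
      ring
    apply Complex.ofReal_injective
    rw [← integral_complex_ofReal]
    simp_rw [hpt]
    rw [MeasureTheory.integral_finsetSum _ fun m _ =>
      MeasureTheory.integrable_finsetSum _ fun n _ => hgint m n]
    rw [Complex.ofReal_mul, Complex.ofReal_sum, Finset.mul_sum]
    refine Finset.sum_congr rfl fun m _ => ?_
    rw [MeasureTheory.integral_finsetSum _ fun n _ => hgint m n, Complex.ofReal_sum, Finset.mul_sum]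
    refine Finset.sum_congr rfl fun n _ => ?_
    rw [hval, Complex.ofReal_mul]

theorem abs_sub_le_mul_abs_log_sub_log {m n T : ℝ} (hm : 0 < m) (hn : 0 < n) (hmT : m ≤ T)
    (hnT : n ≤ T) : |m - n| ≤ T * |Real.log m - Real.log n| := by
  wlog h : m ≤ n generalizing m n
  · rw [abs_sub_comm, abs_sub_comm (Real.log m)]
    exact this hn hm hnT hmT (by linarith)
  have hl := Real.one_sub_inv_le_log_of_pos (div_pos hn hm)
  rw [Real.log_div hn.ne' hm.ne', inv_div] at hl
  have hle : 0 ≤ Real.log n - Real.log m := by linarith [Real.log_le_log hm h]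
  rw [abs_sub_comm, abs_of_nonneg (by linarith), abs_sub_comm, abs_of_nonneg hle]
  calc n - m = n * (1 - m / n) := by field_simp
    _ ≤ n * (Real.log n - Real.log m) := by gcongr
    _ ≤ T * (Real.log n - Real.log m) := by gcongr

theorem summable_exp_neg_int_sq : Summable fun j : ℤ => Real.exp (-((j : ℝ) ^ 2 / 4)) := by
  have hnat : Summable fun n : ℕ => Real.exp (-((n : ℝ) ^ 2 / 4)) := by
    refine Summable.of_nonneg_of_le (fun _ => by positivity) (fun n => ?_)
      (Real.summable_exp_neg_nat.mul_left (Real.exp 1))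
    rw [← Real.exp_add]
    apply Real.exp_le_exp.2
    nlinarith [sq_nonneg ((n : ℝ) - 2)]
  apply Summable.of_nat_of_neg
  · simpa using hnat
  · simpa using hnat

/-- For m, n ≤ T one has T |log m − log n| ≥ |m − n|, so the kernel is dominated by exp(−(m −
n)²/4), whose row sums are bounded. With a m * a n ≤ (a m ^ 2 + a n ^ 2) / 2 only the diagonal
remains. -/
theorem exists_integral_gaussian_mul_norm_sq_le : ∃ K : ℝ, 1 ≤ K ∧ ∀ (T : ℝ) (s : Finset ℕ)
    (a : ℕ → ℝ), 0 < T → (∀ m ∈ s, m ≠ 0 ∧ (m : ℝ) ≤ T) → (∀ m, 0 ≤ a m) →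
    ∫ t : ℝ, Real.exp (-(t / T) ^ 2) *
        ‖∑ m ∈ s, (a m : ℂ) * (m : ℂ) ^ (Complex.I * (t : ℂ))‖ ^ 2 ≤
      K * T * ∑ m ∈ s, a m ^ 2 := by
  set κ : ℝ := ∑' j : ℤ, Real.exp (-((j : ℝ) ^ 2 / 4)) with hκ
  have hκ0 : 0 ≤ κ := tsum_nonneg fun _ => by positivity
  refine ⟨max 1 (√Real.pi * κ), le_max_left _ _, fun T s a hT hs ha => ?_⟩
  rw [(integrable_and_integral_gaussian_mul_norm_sq hT s (fun m hm => (hs m hm).1) a).2]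
  set E : ℕ → ℕ → ℝ := fun m n => Real.exp (-(((m : ℝ) - n) ^ 2 / 4)) with hE
  have hEsymm : ∀ m n, E m n = E n m := fun m n => by simp only [hE]; congr 3; ring
  have hEsum : ∀ m, ∑ n ∈ s, E m n ≤ κ := by
    intro m
    have hinj : Set.InjOn (fun n : ℕ => ((m : ℤ) - n)) s := fun x _ y _ h => by
      simpa using h
    calc ∑ n ∈ s, E m n = ∑ j ∈ s.image (fun n : ℕ => ((m : ℤ) - n)), Real.exp (-((j : ℝ) ^ 2 / 4)) := by
          rw [Finset.sum_image hinj]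
          simp [hE]
      _ ≤ κ := summable_exp_neg_int_sq.sum_le_tsum _ fun _ _ => by positivity
  have h1 : ∑ m ∈ s, ∑ n ∈ s, a m * a n *
      Real.exp (-(T ^ 2 * (Real.log m - Real.log n) ^ 2 / 4)) ≤ κ * ∑ m ∈ s, a m ^ 2 := by
    calc ∑ m ∈ s, ∑ n ∈ s, a m * a n * Real.exp (-(T ^ 2 * (Real.log m - Real.log n) ^ 2 / 4))
        ≤ ∑ m ∈ s, ∑ n ∈ s, (a m ^ 2 * E m n / 2 + a n ^ 2 * E n m / 2) := by
          refine Finset.sum_le_sum fun m hm => Finset.sum_le_sum fun n hn => ?_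
          have h2 : Real.exp (-(T ^ 2 * (Real.log m - Real.log n) ^ 2 / 4)) ≤ E m n := by
            apply Real.exp_le_exp.2
            have hm' := hs m hm
            have hn' := hs n hn
            have h3 := abs_sub_le_mul_abs_log_sub_log (m := m) (n := n)
              (by exact_mod_cast Nat.pos_of_ne_zero hm'.1)
              (by exact_mod_cast Nat.pos_of_ne_zero hn'.1) hm'.2 hn'.2
            have h4 := pow_le_pow_left₀ (abs_nonneg _) h3 2
            rw [mul_pow, sq_abs, sq_abs] at h4
            linarith
          have h5 : a m * a n ≤ (a m ^ 2 + a n ^ 2) / 2 := by nlinarith [sq_nonneg (a m - a n)]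
          rw [hEsymm n m]
          calc _ ≤ (a m ^ 2 + a n ^ 2) / 2 * E m n := by
                apply mul_le_mul h5 h2 (by positivity) (by positivity)
            _ = _ := by ring
      _ = ∑ m ∈ s, ∑ n ∈ s, a m ^ 2 * E m n := by
          simp_rw [Finset.sum_add_distrib]
          rw [Finset.sum_comm (f := fun m n => a n ^ 2 * E n m / 2), ← Finset.sum_add_distrib]
          refine Finset.sum_congr rfl fun m _ => ?_
          rw [← Finset.sum_add_distrib]
          refine Finset.sum_congr rfl fun n _ => by ring
      _ ≤ ∑ m ∈ s, a m ^ 2 * κ := by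
          refine Finset.sum_le_sum fun m _ => ?_
          rw [← Finset.mul_sum]
          exact mul_le_mul_of_nonneg_left (hEsum m) (sq_nonneg _)
      _ = κ * ∑ m ∈ s, a m ^ 2 := by rw [← Finset.sum_mul]; ring
  calc √Real.pi * T * ∑ m ∈ s, ∑ n ∈ s, a m * a n *
        Real.exp (-(T ^ 2 * (Real.log m - Real.log n) ^ 2 / 4))
      ≤ √Real.pi * T * (κ * ∑ m ∈ s, a m ^ 2) := by gcongr
    _ = (√Real.pi * κ) * (T * ∑ m ∈ s, a m ^ 2) := by ring
    _ ≤ max 1 (√Real.pi * κ) * (T * ∑ m ∈ s, a m ^ 2) := by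
        gcongr
        exact le_max_right _ _
    _ = _ := by ring

theorem sum_natCast_cpow_pow (A : Finset ℕ) (k : ℕ) (z : ℂ) :
    (∑ n ∈ A, (n : ℂ) ^ z) ^ k =
      ∑ m ∈ (Fintype.piFinset fun _ : Fin k => A).image (fun ν : Fin k → ℕ => ∏ i, ν i),
        ((((Fintype.piFinset fun _ : Fin k => A).filter (∏ i, · i = m)).card : ℝ) : ℂ) *
          (m : ℂ) ^ z := by
  classical
  rw [Finset.sum_pow']
  have h1 : ∀ ν ∈ Fintype.piFinset fun _ : Fin k => A,
      ∏ i, ((ν i : ℕ) : ℂ) ^ z = ((∏ i, ν i : ℕ) : ℂ) ^ z := by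
    intro ν _
    induction (Finset.univ : Finset (Fin k)) using Finset.induction_on with
    | empty => simp
    | insert i s hi ih =>
      rw [Finset.prod_insert hi, Finset.prod_insert hi, ih, Nat.cast_mul,
        Complex.natCast_mul_natCast_cpow]
  rw [Finset.sum_congr rfl h1, ← Finset.sum_fiberwise_of_maps_to
    (g := fun ν : Fin k → ℕ => ∏ i, ν i) (t := (Fintype.piFinset fun _ : Fin k => A).image (fun ν : Fin k → ℕ => ∏ i, ν i))
    (fun ν hν => Finset.mem_image_of_mem _ hν)]
  refine Finset.sum_congr rfl fun m _ => ?_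
  rw [Finset.sum_congr rfl (g := fun _ => (m : ℂ) ^ z)
    (fun ν hν => by rw [(Finset.mem_filter.1 hν).2]), Finset.sum_const, nsmul_eq_mul]
  push_cast
  rfl

/-! ### From moments to rarity of large values. -/

/-- The set of `t ∈ [1, T]` where a Dirichlet polynomial supported on integers `n ≤ x` is large is
small, by comparing moments with a multiplicative model. -/
theorem exists_volume_large_values_le : ∃ K : ℝ, 1 ≤ K ∧ ∀ (T x : ℝ) (A : Finset ℕ) (ρ : ℕ → ℕ)
    (k : ℕ) (B lam : ℝ), 0 < T → 0 ≤ x → x ^ k ≤ T → (∀ n ∈ A, n ≠ 0 ∧ (n : ℝ) ≤ x) →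
    (∀ n ∈ A, ρ n ≠ 0) →
    (∀ ν : Fin k → ℕ, (∀ i, ν i ∈ A) → ρ (∏ i, ν i) = ∏ i, ρ (ν i)) →
    ∑ b ∈ A.image ρ, (k : ℝ) ^ ArithmeticFunction.cardFactors b *
        ((A.filter (ρ · = b)).card : ℝ) ^ 2 ≤ B → 0 < lam →
    MeasureTheory.volume {t : ℝ | t ∈ Set.Icc 1 T ∧
        ¬ ‖∑ n ∈ A, (n : ℂ) ^ (Complex.I * (t : ℂ))‖ ≤ lam} ≤
      ENNReal.ofReal (K * T * (B / lam ^ 2) ^ k) := by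
  obtain ⟨K, hK, hKb⟩ := exists_integral_gaussian_mul_norm_sq_le
  refine ⟨K * Real.exp 1, ?_, ?_⟩
  · have := Real.one_le_exp (zero_le_one (α := ℝ))
    nlinarith
  intro T x A ρ k B lam hT hx hxT hA hρ hmul hB hlam
  classical
  set s : Finset ℕ := (Fintype.piFinset fun _ : Fin k => A).image (∏ i, · i) with hs
  set a : ℕ → ℝ := fun m =>
    (((Fintype.piFinset fun _ : Fin k => A).filter (∏ i, · i = m)).card : ℝ) with ha
  have hs' : ∀ m ∈ s, m ≠ 0 ∧ (m : ℝ) ≤ T := by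
    intro m hm
    obtain ⟨ν, hν, rfl⟩ := Finset.mem_image.1 hm
    rw [Fintype.mem_piFinset] at hν
    refine ⟨Finset.prod_ne_zero_iff.2 fun i _ => (hA _ (hν i)).1, le_trans ?_ hxT⟩
    push_cast
    calc ∏ i, (ν i : ℝ) ≤ ∏ _i : Fin k, x :=
          Finset.prod_le_prod (fun _ _ => by positivity) fun i _ => (hA _ (hν i)).2
      _ = x ^ k := by simp
  have hpow : ∀ t : ℝ, ‖∑ m ∈ s, (a m : ℂ) * (m : ℂ) ^ (Complex.I * (t : ℂ))‖ =
      ‖∑ n ∈ A, (n : ℂ) ^ (Complex.I * (t : ℂ))‖ ^ k := fun t => by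
    rw [← norm_pow, sum_natCast_cpow_pow A]
  have hle := hKb T s a hT hs' (fun m => by positivity)
  have hgint := (integrable_and_integral_gaussian_mul_norm_sq hT s (fun m hm => (hs' m hm).1) a).1
  have hsq : ∑ m ∈ s, a m ^ 2 ≤ B ^ k :=
    (sum_sq_card_filter_prod_le k hρ hmul s).trans
      (pow_le_pow_left₀ (Finset.sum_nonneg fun _ _ => by positivity) hB k)
  set f : ℝ → ℝ := fun t => Real.exp (-(t / T) ^ 2) *
        ‖∑ m ∈ s, (a m : ℂ) * (m : ℂ) ^ (Complex.I * (t : ℂ))‖ ^ 2 with hf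
  -- The Gaussian weight is at least 1/e on [1, T], whence the factor in Markov's threshold.
  set ε : ℝ := Real.exp (-1) * (lam ^ 2) ^ k with hε
  have hε0 : 0 < ε := by positivity
  have hmarkov := MeasureTheory.meas_ge_le_lintegral_div
    (μ := MeasureTheory.volume) (f := fun t => ENNReal.ofReal (f t))
    (hgint.aemeasurable.ennreal_ofReal) (ε := ENNReal.ofReal ε) (by simpa using hε0)
    ENNReal.ofReal_ne_top
  rw [← MeasureTheory.ofReal_integral_eq_lintegral_ofReal hgint
    (Filter.Eventually.of_forall fun t => by simp only [hf]; positivity)] at hmarkov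
  refine (MeasureTheory.measure_mono ?_).trans (hmarkov.trans ?_)
  · rintro t ⟨⟨ht1, ht2⟩, ht⟩
    push Not at ht
    simp only [Set.mem_ofPred_eq]
    apply ENNReal.ofReal_le_ofReal
    simp only [hf, hε]
    rw [hpow]
    have h1 : Real.exp (-1) ≤ Real.exp (-(t / T) ^ 2) := by
      apply Real.exp_le_exp.2
      have : (t / T) ^ 2 ≤ 1 := by
        apply pow_le_one₀ (by positivity)
        rw [div_le_one hT]; exact ht2
      linarith
    have h2 : (lam ^ 2) ^ k ≤ (‖∑ n ∈ A, (n : ℂ) ^ (Complex.I * (t : ℂ))‖ ^ k) ^ 2 := by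
      rw [← pow_mul, ← pow_mul, mul_comm 2 k]
      exact pow_le_pow_left₀ hlam.le ht.le _
    exact mul_le_mul h1 h2 (by positivity) (by positivity)
  · rw [← ENNReal.ofReal_div_of_pos hε0]
    apply ENNReal.ofReal_le_ofReal
    rw [div_le_iff₀ hε0]
    calc ∫ t, f t ≤ K * T * ∑ m ∈ s, a m ^ 2 := hle
      _ ≤ K * T * B ^ k := by gcongr
      _ = K * Real.exp 1 * T * (B / lam ^ 2) ^ k * ε := by
          rw [hε, div_pow, Real.exp_neg]; field_simp

/-! ### Rough parts and the Euler product over primes beyond y. -/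

open Classical in
/-- The largest divisor of `n` all of whose prime factors exceed `y`. -/
noncomputable def roughPart (y : ℝ) (n : ℕ) : ℕ :=
  ((n.primeFactorsList : Multiset ℕ).filter (fun p : ℕ => y < (p : ℝ))).prod

theorem roughPart_mul (y : ℝ) {m n : ℕ} (hm : m ≠ 0) (hn : n ≠ 0) :
    roughPart y (m * n) = roughPart y m * roughPart y n := by
  have h : ((m * n).primeFactorsList : Multiset ℕ) =
      (m.primeFactorsList : Multiset ℕ) + (n.primeFactorsList : Multiset ℕ) := by
    rw [Multiset.coe_add, Multiset.coe_eq_coe]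
    exact Nat.perm_primeFactorsList_mul hm hn
  rw [roughPart, h, Multiset.filter_add, Multiset.prod_add, roughPart, roughPart]

theorem roughPart_one (y : ℝ) : roughPart y 1 = 1 := by simp [roughPart]

theorem roughPart_prod (y : ℝ) {ι : Type*} (s : Finset ι) {f : ι → ℕ} (h : ∀ i ∈ s, f i ≠ 0) :
    roughPart y (∏ i ∈ s, f i) = ∏ i ∈ s, roughPart y (f i) := by
  classical
  induction s using Finset.induction_on with
  | empty => simp [roughPart_one]
  | insert a s ha ih =>
    rw [Finset.prod_insert ha, Finset.prod_insert ha, roughPart_mul y (h a (by simp))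
      (Finset.prod_ne_zero_iff.2 fun i hi => h i (by simp [hi])), ih fun i hi => h i (by simp [hi])]

theorem roughPart_ne_zero (y : ℝ) (n : ℕ) : roughPart y n ≠ 0 := by
  refine Multiset.prod_ne_zero fun h => ?_
  have := Multiset.mem_of_mem_filter h
  exact (Nat.prime_of_mem_primeFactorsList (Multiset.mem_coe.1 this)).ne_zero rfl

theorem exists_eq_roughPart_mul (y : ℝ) {n : ℕ} (hn : n ≠ 0) :
    ∃ m, n = roughPart y n * m ∧ IsFriable y m := by
  classical
  refine ⟨((n.primeFactorsList : Multiset ℕ).filter (fun p : ℕ => ¬ y < (p : ℝ))).prod, ?_, ?_⟩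
  · have h := Multiset.filter_add_not (fun p : ℕ => y < (p : ℝ)) (n.primeFactorsList : Multiset ℕ)
    have h2 := congrArg Multiset.prod h
    rw [Multiset.prod_add, Multiset.prod_coe, Nat.prod_primeFactorsList hn] at h2
    rw [roughPart]
    convert h2.symm
  · refine ⟨?_, fun p hp hpd => ?_⟩
    · refine Multiset.prod_ne_zero fun h => ?_
      have := Multiset.mem_of_mem_filter h
      exact (Nat.prime_of_mem_primeFactorsList (Multiset.mem_coe.1 this)).ne_zero rfl
    · obtain ⟨q, hq, hpq⟩ := hp.prime.exists_mem_multiset_dvd hpd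
      rw [Multiset.mem_filter, Multiset.mem_coe] at hq
      rw [(Nat.prime_dvd_prime_iff_eq hp (Nat.prime_of_mem_primeFactorsList hq.1)).1 hpq]
      exact not_lt.1 hq.2

theorem lt_of_prime_dvd_roughPart {y : ℝ} {n p : ℕ} (hp : p.Prime) (h : p ∣ roughPart y n) :
    y < p := by
  classical
  obtain ⟨q, hq, hpq⟩ := hp.prime.exists_mem_multiset_dvd h
  rw [Multiset.mem_filter, Multiset.mem_coe] at hq
  rw [(Nat.prime_dvd_prime_iff_eq hp (Nat.prime_of_mem_primeFactorsList hq.1)).1 hpq]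
  exact hq.2

/-- Dividing by the common rough part b maps this fibre injectively to friable integers up to x/b.
-/
theorem card_filter_roughPart_le {x y : ℝ} {A : Finset ℕ} (hA : ∀ n ∈ A, n ≠ 0 ∧ (n : ℝ) ≤ x)
    (b : ℕ) : ((A.filter (roughPart y · = b)).card : ℝ) ≤ friableCount (x / b) y := by
  unfold friableCount
  rw [Nat.cast_le]
  have hex : ∀ n ∈ A.filter (roughPart y · = b), ∃ m, n = b * m ∧ IsFriable y m ∧ 0 < b := by
    intro n hn
    rw [Finset.mem_filter] at hn
    obtain ⟨m, h1, h2⟩ := exists_eq_roughPart_mul y (hA n hn.1).1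
    rw [hn.2] at h1
    refine ⟨m, h1, h2, Nat.pos_of_ne_zero ?_⟩
    rw [← hn.2]; exact roughPart_ne_zero y n
  apply Finset.card_le_card_of_injOn (fun n => n / b)
  · intro n hn
    obtain ⟨m, h1, h2, h3⟩ := hex n hn
    have hn' := (Finset.mem_filter.1 hn).1
    simp only
    rw [h1, Nat.mul_div_cancel_left m h3]
    rw [Finset.mem_coe, mem_friableUpTo, le_div_iff₀ (by exact_mod_cast h3)]
    refine ⟨?_, h2⟩
    have := (hA n hn').2
    rw [h1] at this
    push_cast at this
    linarith [mul_comm (b : ℝ) m]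
  · intro n hn n' hn' h
    obtain ⟨m, h1, h2, h3⟩ := hex n hn
    obtain ⟨m', h1', -, -⟩ := hex n' hn'
    simp only at h
    rw [h1, h1', Nat.mul_div_cancel_left m h3, Nat.mul_div_cancel_left m' h3] at h
    rw [h1, h1', h]

/-- The completely multiplicative function with prescribed values at the primes. -/
noncomputable def completelyMul (φ : ℕ → ℝ) : ℕ →* ℝ where
  toFun n := if n = 0 then 0 else (n.primeFactorsList.map φ).prod
  map_one' := by simp
  map_mul' m n := by
    by_cases hm : m = 0
    · simp [hm]
    by_cases hn : n = 0
    · simp [hn]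
    rw [if_neg (mul_ne_zero hm hn), if_neg hm, if_neg hn,
      ((Nat.perm_primeFactorsList_mul hm hn).map φ).prod_eq, List.map_append, List.prod_append]

theorem completelyMul_prime (φ : ℕ → ℝ) {p : ℕ} (hp : p.Prime) : completelyMul φ p = φ p := by
  simp [completelyMul, hp.ne_zero, Nat.primeFactorsList_prime hp]

theorem completelyMul_nonneg {φ : ℕ → ℝ} (h : ∀ p, 0 ≤ φ p) (n : ℕ) : 0 ≤ completelyMul φ n := by
  simp only [completelyMul, MonoidHom.coe_mk, OneHom.coe_mk]
  split_ifs
  · exact le_rfl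
  · apply List.prod_nonneg
    intro a ha
    obtain ⟨p, -, rfl⟩ := List.mem_map.1 ha
    exact h p

/-- Peel off the prime factors of b one at a time; each costs a factor k F(p)². The bound X stays
fixed while x shrinks, which is what the induction needs. -/
theorem pow_cardFactors_mul_friableCount_sq_le {X y : ℝ} {k : ℕ} {φ : ℕ → ℝ} (b : ℕ) (hb : b ≠ 0)
    (hφ : ∀ p : ℕ, p.Prime → p ∣ b → φ p = k * friableRatio X y p ^ 2) {x : ℝ} (hx : x ≤ X)
    (hx0 : 0 ≤ x) :
    (k : ℝ) ^ ArithmeticFunction.cardFactors b * friableCount (x / b) y ^ 2 ≤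
      completelyMul φ b * friableCount x y ^ 2 := by
  induction b using induction_on_primes generalizing x with
  | zero => exact absurd rfl hb
  | one => simp
  | prime_mul p a hp ih =>
    have ha : a ≠ 0 := right_ne_zero_of_mul hb
    have hp1 : (1 : ℝ) ≤ p := by exact_mod_cast hp.one_lt.le
    have hxp : x / p ≤ X := (div_le_self hx0 hp1).trans hx
    have h1 := ih ha (fun q hq hqa => hφ q hq (hqa.mul_left p)) hxp (by positivity)
    have h2 := friableCount_div_le (y := y) hp1 hx
    have h3 := pow_le_pow_left₀ (friableCount_nonneg _ _) h2 2
    have hφp := hφ p hp (dvd_mul_right _ _)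
    have hcm : 0 ≤ k * friableCount (x / p) y ^ 2 := by positivity
    rw [ArithmeticFunction.cardFactors_mul hp.ne_zero ha,
      ArithmeticFunction.cardFactors_apply_prime hp, pow_add, pow_one, map_mul,
      completelyMul_prime φ hp, hφp, Nat.cast_mul, ← div_div]
    have hnn : 0 ≤ completelyMul φ a := by
      by_contra hneg
      push Not at hneg
      simp only [completelyMul, MonoidHom.coe_mk, OneHom.coe_mk, if_neg ha] at hneg
      have : 0 ≤ (a.primeFactorsList.map φ).prod := by
        apply List.prod_nonneg
        intro r hr
        obtain ⟨q, hq, rfl⟩ := List.mem_map.1 hr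
        rw [hφ q (Nat.prime_of_mem_primeFactorsList hq)
          ((Nat.dvd_of_mem_primeFactorsList hq).mul_left p)]
        positivity
      linarith
    calc (k : ℝ) * k ^ ArithmeticFunction.cardFactors a * friableCount (x / p / a) y ^ 2
        = k * (k ^ ArithmeticFunction.cardFactors a * friableCount (x / p / a) y ^ 2) := by ring
      _ ≤ k * (completelyMul φ a * friableCount (x / p) y ^ 2) := by gcongr
      _ ≤ k * (completelyMul φ a * (friableRatio X y p * friableCount x y) ^ 2) := by gcongr
      _ = _ := by ring

/-- Bound the sum by the Euler product over S and use (1 − u)⁻¹ ≤ e^(2u) for 0 ≤ u ≤ 1/2. -/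
theorem sum_completelyMul_le {S : Finset ℕ} (hS : ∀ p ∈ S, p.Prime) {φ : ℕ → ℝ}
    (h0 : ∀ p, 0 ≤ φ p) (h1 : ∀ p, φ p ≤ 1 / 2) (R : Finset ℕ)
    (hR : ∀ b ∈ R, b ≠ 0 ∧ ∀ p : ℕ, p.Prime → p ∣ b → p ∈ S) :
    ∑ b ∈ R, completelyMul φ b ≤ Real.exp (2 * ∑ p ∈ S, φ p) := by
  classical
  have hE := EulerProduct.summable_and_hasSum_factoredNumbers_prod_filter_prime_geometric
    (f := completelyMul φ) (fun {p} hp => by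
      rw [completelyMul_prime φ hp, Real.norm_eq_abs, abs_of_nonneg (h0 p)]; linarith [h1 p]) S
  have hmem : ∀ b ∈ R, b ∈ Nat.factoredNumbers S := fun b hb => by
    rw [Nat.mem_factoredNumbers_iff_forall_le]
    refine ⟨(hR b hb).1, fun p _ hp hpb => (hR b hb).2 p hp hpb⟩
  have h2 : ∑ b ∈ R, completelyMul φ b ≤ ∏ p ∈ S with p.Prime, (1 - completelyMul φ p)⁻¹ := by
    have h3 : ∑ b ∈ R, completelyMul φ b =
        ∑ b ∈ R.subtype (· ∈ Nat.factoredNumbers S), completelyMul φ (b : ℕ) := by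
      rw [Finset.sum_subtype_of_mem _ hmem]
    rw [h3]
    exact sum_le_hasSum _ (fun b _ => completelyMul_nonneg h0 _) hE.2
  refine h2.trans ?_
  rw [Finset.filter_true_of_mem hS, Finset.mul_sum, Real.exp_sum]
  apply Finset.prod_le_prod
  · intro p hp
    rw [completelyMul_prime φ (hS p hp)]
    have := h1 p
    exact inv_nonneg.2 (by linarith)
  · intro p hp
    rw [completelyMul_prime φ (hS p hp)]
    have ha := h0 p
    have hb := h1 p
    rw [inv_le_comm₀ (by linarith) (by positivity), ← Real.exp_neg]
    have h4 : Real.exp (-(2 * φ p)) ≤ (1 + 2 * φ p)⁻¹ := by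
      rw [Real.exp_neg]
      apply inv_anti₀ (by linarith)
      linarith [Real.add_one_le_exp (2 * φ p)]
    refine h4.trans ?_
    rw [inv_le_iff_one_le_mul₀ (by linarith)]
    nlinarith

theorem sum_pow_cardFactors_mul_friableCount_sq_le {x y s : ℝ} {k : ℕ} (hx : 1 ≤ x) (hy : 0 ≤ y)
    (hs : k * ∑ p ∈ primesIoc y x, friableRatio x y p ^ 2 ≤ s)
    (hhalf : ∀ p ∈ primesIoc y x, k * friableRatio x y p ^ 2 ≤ 1 / 2) (R : Finset ℕ)
    (hR : ∀ b ∈ R, b ≠ 0 ∧ (b : ℝ) ≤ x ∧ ∀ p : ℕ, p.Prime → p ∣ b → y < p) :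
    ∑ b ∈ R, (k : ℝ) ^ ArithmeticFunction.cardFactors b * friableCount (x / b) y ^ 2 ≤
      Real.exp (2 * s) * friableCount x y ^ 2 := by
  classical
  set S := primesIoc y x with hS
  set φ : ℕ → ℝ := fun p => if p ∈ S then k * friableRatio x y p ^ 2 else 0 with hφ
  have hSp : ∀ p ∈ S, p.Prime := fun p hp => ((mem_primesIoc hy (by linarith)).1 hp).1
  have hR' : ∀ b ∈ R, b ≠ 0 ∧ ∀ p : ℕ, p.Prime → p ∣ b → p ∈ S := fun b hb => by
    obtain ⟨h1, h2, h3⟩ := hR b hb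
    refine ⟨h1, fun p hp hpb => (mem_primesIoc hy (by linarith)).2 ⟨hp, h3 p hp hpb, ?_⟩⟩
    exact le_trans (by exact_mod_cast Nat.le_of_dvd (Nat.pos_of_ne_zero h1) hpb) h2
  have hsum : ∑ p ∈ S, φ p = k * ∑ p ∈ S, friableRatio x y p ^ 2 := by
    rw [Finset.mul_sum]
    exact Finset.sum_congr rfl fun p hp => by simp only [hφ, if_pos hp]
  have hle := sum_completelyMul_le hSp (φ := φ)
    (fun p => by simp only [hφ]; split_ifs <;> positivity)
    (fun p => by
      simp only [hφ]; split_ifs with h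
      · exact hhalf p h
      · norm_num) R hR'
  calc ∑ b ∈ R, (k : ℝ) ^ ArithmeticFunction.cardFactors b * friableCount (x / b) y ^ 2
      ≤ ∑ b ∈ R, completelyMul φ b * friableCount x y ^ 2 := by
        refine Finset.sum_le_sum fun b hb => ?_
        refine pow_cardFactors_mul_friableCount_sq_le b (hR b hb).1 ?_ le_rfl (by linarith)
        intro p hp hpb
        simp only [hφ, if_pos ((hR' b hb).2 p hp hpb)]
    _ = (∑ b ∈ R, completelyMul φ b) * friableCount x y ^ 2 := by rw [Finset.sum_mul]
    _ ≤ Real.exp (2 * ∑ p ∈ S, φ p) * friableCount x y ^ 2 := by gcongr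
    _ ≤ _ := by
        rw [hsum]
        gcongr

/-! ### Rarity of large values of zeta sums. -/

/-- Large values of zeta sums, and of their non-friable parts, are rare. -/
theorem exists_volume_zetaSum_le : ∃ K C : ℝ, 1 ≤ K ∧ 1 ≤ C ∧ ∀ (T x y lam : ℝ) (k : ℕ),
    0 < T → 1 ≤ x → 2 ≤ y → C * Real.log x ^ 2 ≤ y → C * k * Real.log x ^ 2 ≤ y ^ 2 → x ^ k ≤ T →
    0 < lam →
    MeasureTheory.volume {t : ℝ | t ∈ Set.Icc 1 T ∧ ¬ ‖zetaSum x t - friableSum x y t‖ ≤ lam} ≤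
      ENNReal.ofReal (K * T * ((Real.exp (C * k * Real.log x ^ 2 * Real.log y / y) - 1) *
        friableCount x y ^ 2 / lam ^ 2) ^ k) ∧
    MeasureTheory.volume {t : ℝ | t ∈ Set.Icc 1 T ∧ ¬ ‖zetaSum x t‖ ≤ lam} ≤
      ENNReal.ofReal (K * T * (Real.exp (C * k * Real.log x ^ 2 * Real.log y / y) *
        friableCount x y ^ 2 / lam ^ 2) ^ k) := by
  classical
  obtain ⟨K, hK, hvol⟩ := exists_volume_large_values_le
  obtain ⟨C₁, hC₁, h₁⟩ := exists_friableRatio_le_log_div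
  obtain ⟨C₂, hC₂, h₂⟩ := exists_sum_friableRatio_sq_le
  -- The first summand secures k F(p)² ≤ 1/2 for every p > y, the second bounds the sum of these
  -- terms.
  set C : ℝ := 2 * C₁ ^ 2 + 2 * C₂ with hC
  refine ⟨K, C, hK, by nlinarith, ?_⟩
  intro T x y lam k hT hx hy hCy hCk hxT hlam
  have hlx : 0 ≤ Real.log x := Real.log_nonneg hx
  have hly : 0 < Real.log y := Real.log_pos (by linarith)
  have hlx2 : 0 ≤ Real.log x ^ 2 := by positivity
  have hk0 : (0 : ℝ) ≤ k := Nat.cast_nonneg k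
  have hsum := h₂ x y hx hy (by nlinarith)
  set s : ℝ := C * k * Real.log x ^ 2 * Real.log y / y / 2 with hs
  have hs2 : C * k * Real.log x ^ 2 * Real.log y / y = 2 * s := by rw [hs]; ring
  have hks : k * ∑ p ∈ primesIoc y x, friableRatio x y p ^ 2 ≤ s := by
    calc k * ∑ p ∈ primesIoc y x, friableRatio x y p ^ 2
        ≤ k * (C₂ * Real.log x ^ 2 * Real.log y / y) := by gcongr
      _ = C₂ * (k * Real.log x ^ 2 * Real.log y / y) := by ring
      _ ≤ C / 2 * (k * Real.log x ^ 2 * Real.log y / y) := by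
          have : C₂ ≤ C / 2 := by rw [hC]; nlinarith
          gcongr
      _ = s := by rw [hs]; ring
  have hhalf : ∀ p ∈ primesIoc y x, k * friableRatio x y p ^ 2 ≤ 1 / 2 := by
    intro p hp
    rw [mem_primesIoc (by linarith) (by linarith)] at hp
    have h3 : friableRatio x y p ≤ C₁ * Real.log x / y :=
      (friableRatio_anti hx (by linarith) hp.2.1.le).trans (h₁ x y y hx hy le_rfl)
    have h4 := pow_le_pow_left₀ (friableRatio_nonneg _ _ _) h3 2
    calc k * friableRatio x y p ^ 2 ≤ k * (C₁ * Real.log x / y) ^ 2 := by gcongr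
      _ = (C₁ ^ 2 * k * Real.log x ^ 2) / y ^ 2 := by ring
      _ ≤ 1 / 2 := by
          rw [div_le_iff₀ (by positivity)]
          have : 2 * C₁ ^ 2 * k * Real.log x ^ 2 ≤ C * k * Real.log x ^ 2 := by
            have : 2 * C₁ ^ 2 ≤ C := by rw [hC]; linarith
            gcongr
          linarith
  have hmain : ∀ A : Finset ℕ, A ⊆ Finset.Icc 1 ⌊x⌋₊ →
      (∀ n ∈ A, n ≠ 0 ∧ (n : ℝ) ≤ x) ∧
      (∀ b ∈ A.image (roughPart y), b ≠ 0 ∧ (b : ℝ) ≤ x ∧ ∀ p : ℕ, p.Prime → p ∣ b → y < p) := by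
    intro A hA
    have h5 : ∀ n ∈ A, n ≠ 0 ∧ (n : ℝ) ≤ x := fun n hn => by
      have := Finset.mem_Icc.1 (hA hn)
      exact ⟨by omega, (Nat.le_floor_iff (by linarith)).1 this.2⟩
    refine ⟨h5, fun b hb => ?_⟩
    obtain ⟨n, hn, rfl⟩ := Finset.mem_image.1 hb
    refine ⟨roughPart_ne_zero y n, ?_, fun p hp hpd => lt_of_prime_dvd_roughPart hp hpd⟩
    refine le_trans ?_ (h5 n hn).2
    obtain ⟨m, hm, -⟩ := exists_eq_roughPart_mul y (h5 n hn).1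
    exact_mod_cast Nat.le_of_dvd (Nat.pos_of_ne_zero (h5 n hn).1) ⟨m, hm⟩
  have hvolA : ∀ (A : Finset ℕ) (B : ℝ), A ⊆ Finset.Icc 1 ⌊x⌋₊ →
      ∑ b ∈ A.image (roughPart y), (k : ℝ) ^ ArithmeticFunction.cardFactors b *
        friableCount (x / b) y ^ 2 ≤ B →
      MeasureTheory.volume {t : ℝ | t ∈ Set.Icc 1 T ∧
        ¬ ‖∑ n ∈ A, (n : ℂ) ^ (Complex.I * (t : ℂ))‖ ≤ lam} ≤
      ENNReal.ofReal (K * T * (B / lam ^ 2) ^ k) := by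
    intro A B hA hB
    obtain ⟨h5, h6⟩ := hmain A hA
    refine hvol T x A (roughPart y) k B lam hT (by linarith) hxT h5
      (fun n _ => roughPart_ne_zero y n)
      (fun ν hν => roughPart_prod y _ fun i _ => (h5 _ (hν i)).1) (le_trans ?_ hB) hlam
    refine Finset.sum_le_sum fun b _ => ?_
    exact mul_le_mul_of_nonneg_left
      (pow_le_pow_left₀ (Nat.cast_nonneg _) (card_filter_roughPart_le (y := y) h5 b) 2)
      (pow_nonneg hk0 _)
  constructor
  · obtain ⟨A, hA⟩ : ∃ A : Finset ℕ, A = Finset.Icc 1 ⌊x⌋₊ \ friableUpTo x y := ⟨_, rfl⟩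
    have hAsub : A ⊆ Finset.Icc 1 ⌊x⌋₊ := hA ▸ Finset.sdiff_subset
    have hzeta : ∀ t : ℝ, zetaSum x t - friableSum x y t =
        ∑ n ∈ A, (n : ℂ) ^ (Complex.I * (t : ℂ)) := fun t => by
      have : friableUpTo x y ⊆ Finset.Icc 1 ⌊x⌋₊ := fun n hn => by
        rw [mem_friableUpTo] at hn
        exact Finset.mem_Icc.2 ⟨Nat.one_le_iff_ne_zero.2 hn.2.1, (Nat.le_floor_iff' hn.2.1).2 hn.1⟩
      rw [zetaSum, friableSum, ← Finset.sum_sdiff this, hA]; ring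
    refine le_trans (MeasureTheory.measure_mono ?_) (hvolA A _ hAsub ?_)
    · rintro t ⟨ht1, ht2⟩
      exact ⟨ht1, by rw [← hzeta]; exact ht2⟩
    obtain ⟨h5, h6⟩ := hmain A hAsub
    -- A non-friable integer has rough part other than 1. So b = 1 can be added to the index set,
    -- and its contribution Ψ(x, y)² subtracted from the bound: this is the −1 after the
    -- exponential.
    have h1R : 1 ∉ A.image (roughPart y) := by
      intro h
      obtain ⟨n, hn, h1⟩ := Finset.mem_image.1 h
      obtain ⟨m, hm, hfr⟩ := exists_eq_roughPart_mul y (h5 n hn).1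
      rw [h1, one_mul] at hm
      rw [hA, Finset.mem_sdiff, mem_friableUpTo] at hn
      exact hn.2 ⟨(h5 n (by rw [hA, Finset.mem_sdiff, mem_friableUpTo]; exact hn)).2, hm ▸ hfr⟩
    have h7 := sum_pow_cardFactors_mul_friableCount_sq_le hx (by linarith) hks hhalf
      (insert 1 (A.image (roughPart y))) (fun b hb => by
        rcases Finset.mem_insert.1 hb with rfl | hb
        · exact ⟨one_ne_zero, by simpa using hx, fun p hp hpd =>
            absurd (Nat.dvd_one.1 hpd) hp.one_lt.ne'⟩
        · exact h6 b hb)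
    rw [Finset.sum_insert h1R] at h7
    simp only [ArithmeticFunction.cardFactors_one, pow_zero, Nat.cast_one, div_one, one_mul] at h7
    rw [hs2]
    linarith
  · refine hvolA (Finset.Icc 1 ⌊x⌋₊) _ (Finset.Subset.refl _) ?_
    rw [hs2]
    exact sum_pow_cardFactors_mul_friableCount_sq_le hx (by linarith) hks hhalf _
      (hmain _ (Finset.Subset.refl _)).2

/-! ### Trivial bounds and the first assertion. -/

theorem norm_sum_natCast_cpow_le (A : Finset ℕ) (hA : ∀ n ∈ A, n ≠ 0) (t : ℝ) :
    ‖∑ n ∈ A, (n : ℂ) ^ (Complex.I * (t : ℂ))‖ ≤ A.card := by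
  refine (norm_sum_le _ _).trans ?_
  rw [Finset.cast_card]
  refine Finset.sum_le_sum fun n hn => le_of_eq ?_
  rw [Complex.norm_natCast_cpow_of_pos (Nat.pos_of_ne_zero (hA n hn))]
  simp

theorem norm_zetaSum_le (x t : ℝ) : ‖zetaSum x t‖ ≤ ⌊x⌋₊ := by
  refine (norm_sum_natCast_cpow_le _ (fun n hn => ?_) t).trans (by simp)
  have := Finset.mem_Icc.1 hn
  omega

theorem norm_friableSum_le (x y t : ℝ) : ‖friableSum x y t‖ ≤ friableCount x y :=
  norm_sum_natCast_cpow_le _ (fun _ hn => (mem_friableUpTo.1 hn).2.1) t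

theorem log_le_of_le_rpow_third {x T : ℝ} (hx : 2 ≤ x) (hT : 1 ≤ T) (h : x ≤ T ^ (1 / 3 : ℝ)) :
    3 * Real.log x ≤ Real.log T := by
  have := Real.log_le_log (by linarith) h
  rw [Real.log_rpow (by linarith)] at this
  linarith

theorem rpow_one_sub_eq {T c : ℝ} (hT : 0 < T) :
    T ^ (1 - c) = T * Real.exp (-(Real.log T * c)) := by
  rw [Real.rpow_sub hT, Real.rpow_one, Real.rpow_def_of_pos hT, Real.exp_neg]
  rfl

theorem exists_zetaSum_sub_friableSum_large :
    ∃ C L₁ : ℝ, 0 < C ∧ 2 ≤ L₁ ∧ ∀ T x y : ℝ, 1 ≤ T → L₁ ≤ Real.log (Real.log T) → 2 ≤ x →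
      x ≤ T ^ (1 / 3 : ℝ) → Real.log x * Real.log T * Real.log (Real.log T) ^ 5 ≤ y →
      MeasureTheory.volume {t : ℝ | t ∈ Set.Icc 1 T ∧
          ¬ ‖zetaSum x t - friableSum x y t‖
            ≤ C * (friableCount x y / Real.log (Real.log T) ^ 2)}
        ≤ ENNReal.ofReal (T ^ (1 - 1 / Real.log x)) := by
  obtain ⟨K, C, hK, hC, h⟩ := exists_volume_zetaSum_le
  -- The square of this constant cancels the 14 C of the bound for exp − 1 and leaves e⁻²/K. The
  -- requirement log₂ T ≥ 7 C makes the exponent at most 1.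
  refine ⟨√(14 * C * Real.exp 2 * K), 7 * C, by positivity, by linarith, ?_⟩
  intro T x y hT hL hx hxT hy
  set lT := Real.log T with hlT
  set lx := Real.log x with hlx
  set L := Real.log lT with hLdef
  have hlx2 : 0.69 ≤ lx := by
    have := Real.log_le_log (by norm_num) hx
    linarith [Real.log_two_gt_d9]
  have h3 : 3 * lx ≤ lT := log_le_of_le_rpow_third hx hT hxT
  have hL7 : 7 ≤ L := by linarith
  have hL0 : 0 < L := by linarith
  have hlT0 : 0 < lT := by linarith
  have hLlT : L ≤ lT := (Real.log_le_sub_one_of_pos hlT0).trans (by linarith)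
  have hT0 : 0 < T := by linarith
  set y₀ := lx * lT * L ^ 5 with hy₀
  have hL51 : C ≤ L ^ 5 := by
    have : L ≤ L ^ 5 := le_self_pow₀ (by linarith) (by norm_num)
    linarith
  have hll : 0 < lx * lT := by positivity
  have hCll : C * (lx * lT) ≤ y := by
    refine le_trans ?_ hy
    rw [hy₀, mul_comm C]
    gcongr
  have hL5big : (7 : ℝ) ^ 5 ≤ L ^ 5 := pow_le_pow_left₀ (by norm_num) hL7 5
  have hy₀3 : 3 ≤ y₀ := by
    have : 0.69 * 2.07 ≤ lx * lT := mul_le_mul hlx2 (by linarith) (by norm_num) (by linarith)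
    rw [hy₀]
    nlinarith
  set r : ℝ := lT / lx with hr
  have hlx0 : 0 < lx := by linarith
  have hr3 : 3 ≤ r := by rw [hr, le_div_iff₀ hlx0]; exact h3
  -- The largest k with x^k ≤ T. Since r < k + 1 ≤ 2k, the saving e^(−2k) reaches T^(−1/log x).
  set k := ⌊r⌋₊ with hk
  have hkr : (k : ℝ) ≤ r := Nat.floor_le (by linarith)
  have hrk : r < k + 1 := Nat.lt_floor_add_one r
  have hk1 : 1 ≤ k := Nat.le_floor (by push_cast; linarith)
  have hk1' : (1 : ℝ) ≤ k := by exact_mod_cast hk1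
  have hklx : k * lx ≤ lT := by
    rw [hr, le_div_iff₀ hlx0] at hkr; exact hkr
  have hxk : x ^ k ≤ T := by
    rw [← Real.log_le_log_iff (by positivity) hT0, Real.log_pow]; exact hklx
  have hΨ := one_le_friableCount (show 1 ≤ x by linarith) y
  have hklx2 : k * lx ^ 2 ≤ lx * lT := by nlinarith
  have hmain := (h T x y (√(14 * C * Real.exp 2 * K) * (friableCount x y / L ^ 2)) k hT0
    (by linarith) (by linarith) (by
      refine le_trans ?_ hCll
      have : lx ^ 2 ≤ lx * lT := by nlinarith
      gcongr) (by
      have h1 : C * k * lx ^ 2 ≤ y := by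
        refine le_trans ?_ hCll
        rw [mul_assoc]; gcongr
      refine h1.trans (le_self_pow₀ (by linarith) (by norm_num))) hxk (by positivity)).1
  refine hmain.trans (ENNReal.ofReal_le_ofReal ?_)
  have hS : C * k * lx ^ 2 * Real.log y / y ≤ 7 * C / L ^ 4 := by
    have hly0 : Real.log y₀ ≤ 7 * L := by
      have : y₀ ≤ lT ^ 7 := by
        calc y₀ ≤ lT * lT * lT ^ 5 := by
              rw [hy₀]; gcongr; linarith
          _ = lT ^ 7 := by ring
      calc Real.log y₀ ≤ Real.log (lT ^ 7) := Real.log_le_log (by linarith) this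
        _ = 7 * L := by rw [Real.log_pow]; norm_num; rfl
    -- The function log y / y decreases beyond e, so the worst case is the least admissible y, whose
    -- logarithm is O(log₂ T).
    have hanti : Real.log y / y ≤ Real.log y₀ / y₀ := by
      have he := Real.exp_one_lt_d9
      exact Real.log_div_self_antitoneOn (show Real.exp 1 ≤ y₀ by linarith)
        (show Real.exp 1 ≤ y by linarith) hy
    calc C * k * lx ^ 2 * Real.log y / y = C * (k * lx ^ 2) * (Real.log y / y) := by ring
      _ ≤ C * (lx * lT) * (Real.log y₀ / y₀) := by
          have : 0 ≤ Real.log y / y := div_nonneg (Real.log_nonneg (by linarith)) (by linarith)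
          gcongr
      _ = C * Real.log y₀ / L ^ 5 := by rw [hy₀]; field_simp
      _ ≤ C * (7 * L) / L ^ 5 := by gcongr
      _ = 7 * C / L ^ 4 := by field_simp
  have hS0 : 0 ≤ C * k * lx ^ 2 * Real.log y / y := by
    have := Real.log_nonneg (show 1 ≤ y by linarith)
    have : 0 < y := by linarith
    positivity
  have hS1 : 7 * C / L ^ 4 ≤ 1 := by
    rw [div_le_one (by positivity)]
    have : L ≤ L ^ 4 := le_self_pow₀ (by linarith) (by norm_num)
    linarith
  have hexp : Real.exp (C * k * lx ^ 2 * Real.log y / y) - 1 ≤ 14 * C / L ^ 4 := by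
    have h1 := Real.abs_exp_sub_one_le (x := C * k * lx ^ 2 * Real.log y / y) (by
      rw [abs_of_nonneg hS0]; linarith)
    rw [abs_of_nonneg hS0] at h1
    have h2 := le_abs_self (Real.exp (C * k * lx ^ 2 * Real.log y / y) - 1)
    have h3 : 2 * (7 * C / L ^ 4) = 14 * C / L ^ 4 := by ring
    linarith
  have hexp0 : 0 ≤ Real.exp (C * k * lx ^ 2 * Real.log y / y) - 1 := by
    linarith [Real.one_le_exp hS0]
  have hratio : (Real.exp (C * k * lx ^ 2 * Real.log y / y) - 1) * friableCount x y ^ 2 /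
      (√(14 * C * Real.exp 2 * K) * (friableCount x y / L ^ 2)) ^ 2 ≤ Real.exp (-2) / K := by
    rw [mul_pow, Real.sq_sqrt (by positivity)]
    calc (Real.exp (C * k * lx ^ 2 * Real.log y / y) - 1) * friableCount x y ^ 2 /
          (14 * C * Real.exp 2 * K * (friableCount x y / L ^ 2) ^ 2)
        ≤ (14 * C / L ^ 4) * friableCount x y ^ 2 /
          (14 * C * Real.exp 2 * K * (friableCount x y / L ^ 2) ^ 2) := by gcongr
      _ = Real.exp (-2) / K := by
          rw [Real.exp_neg]; field_simp
  calc K * T * ((Real.exp (C * k * lx ^ 2 * Real.log y / y) - 1) * friableCount x y ^ 2 /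
      (√(14 * C * Real.exp 2 * K) * (friableCount x y / L ^ 2)) ^ 2) ^ k
      ≤ K * T * (Real.exp (-2) / K) ^ k := by gcongr
    _ = T * Real.exp (-2) ^ k * (K / K ^ k) := by rw [div_pow]; ring
    _ ≤ T * Real.exp (-2) ^ k * 1 := by
        gcongr
        rw [div_le_one (by positivity)]
        exact le_self_pow₀ hK (by omega)
    _ = T * Real.exp (-(2 * k)) := by rw [mul_one, ← Real.exp_nat_mul]; congr 2; ring
    _ ≤ T * Real.exp (-(lT * (1 / lx))) := by
        refine mul_le_mul_of_nonneg_left (Real.exp_le_exp.2 (neg_le_neg ?_)) hT0.le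
        rw [mul_one_div]
        change r ≤ 2 * k
        linarith
    _ = T ^ (1 - 1 / lx) := (rpow_one_sub_eq hT0).symm

theorem exists_zetaSum_sub_friableSum :
    ∃ C : ℝ, 0 < C ∧ ∀ T x y : ℝ, 1 ≤ T → 2 ≤ x → x ≤ T ^ (1 / 3 : ℝ) →
      Real.log x * Real.log T * Real.log (Real.log T) ^ 5 ≤ y →
      MeasureTheory.volume {t : ℝ | t ∈ Set.Icc 1 T ∧
          ¬ ‖zetaSum x t - friableSum x y t‖
            ≤ C * (friableCount x y / Real.log (Real.log T) ^ 2)}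
        ≤ ENNReal.ofReal (T ^ (1 - 1 / Real.log x)) := by
  obtain ⟨C, L₁, hC, hL₁, h⟩ := exists_zetaSum_sub_friableSum_large
  set T₁ := Real.exp (Real.exp L₁) with hT₁
  -- When log₂ T < L₁ both sums are bounded by T₁, and the added constant makes the inequality hold
  -- for every t.
  refine ⟨C + 2 * T₁ * L₁ ^ 2, by positivity, ?_⟩
  intro T x y hT hx hxT hy
  have h3 := log_le_of_le_rpow_third hx hT hxT
  have hlx2 : 0.69 ≤ Real.log x := by
    have := Real.log_le_log (by norm_num) hx
    linarith [Real.log_two_gt_d9]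
  have hL0 : 0 < Real.log (Real.log T) := Real.log_pos (by linarith)
  have hΨ := one_le_friableCount (show 1 ≤ x by linarith) y
  by_cases hL : L₁ ≤ Real.log (Real.log T)
  · refine le_trans (MeasureTheory.measure_mono ?_) (h T x y hT hL hx hxT hy)
    rintro t ⟨ht1, ht2⟩
    refine ⟨ht1, fun hle => ht2 (hle.trans ?_)⟩
    gcongr
    have : 0 ≤ 2 * T₁ * L₁ ^ 2 := by positivity
    linarith
  · push Not at hL
    have hTT₁ : T ≤ T₁ := by
      have h1 := (Real.log_lt_iff_lt_exp (by linarith)).1 hL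
      exact ((Real.log_lt_iff_lt_exp (by linarith)).1 h1).le
    have hempty : {t : ℝ | t ∈ Set.Icc 1 T ∧ ¬ ‖zetaSum x t - friableSum x y t‖
        ≤ (C + 2 * T₁ * L₁ ^ 2) * (friableCount x y / Real.log (Real.log T) ^ 2)} = ∅ := by
      rw [Set.eq_empty_iff_forall_notMem]
      rintro t ⟨-, ht⟩
      apply ht
      have hxT₁ : x ≤ T₁ := by
        refine hxT.trans (le_trans ?_ hTT₁)
        calc T ^ (1 / 3 : ℝ) ≤ T ^ (1 : ℝ) := Real.rpow_le_rpow_of_exponent_le hT (by norm_num)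
          _ = T := Real.rpow_one T
      have h1 : ‖zetaSum x t - friableSum x y t‖ ≤ 2 * T₁ := by
        refine (norm_sub_le _ _).trans ?_
        have := norm_zetaSum_le x t
        have := norm_friableSum_le x y t
        have := friableCount_le_self (show 0 ≤ x by linarith) y
        have := Nat.floor_le (show 0 ≤ x by linarith)
        linarith
      have hL₁L : Real.log (Real.log T) ^ 2 ≤ L₁ ^ 2 := by gcongr
      calc ‖zetaSum x t - friableSum x y t‖ ≤ 2 * T₁ := h1
        _ = (2 * T₁ * L₁ ^ 2) * (1 / L₁ ^ 2) := by field_simp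
        _ ≤ (C + 2 * T₁ * L₁ ^ 2) * (friableCount x y / Real.log (Real.log T) ^ 2) := by
            gcongr
            linarith
    rw [hempty, MeasureTheory.measure_empty]
    exact bot_le

/-! ### Positive density of friable integers when log X / log y is bounded. -/

/-- Induct on the power of √y. Primes in (√y, y] have reciprocal sum at least c/2, so Σ Ψ(X/p, y) ≫
X by induction, while each n ≤ √y^(r+3) is counted at most r + 3 times. -/
theorem exists_le_friableCount_of_le_pow (r : ℕ) : ∃ c y₁ : ℝ, 0 < c ∧ 4 ≤ y₁ ∧
    ∀ X y : ℝ, y₁ ≤ y → 1 ≤ X → X ≤ √y ^ (r + 2) → c * X ≤ friableCount X y := by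
  obtain ⟨K, hK, c, hc, hM⟩ := exists_sum_inv_primesIoc_lower
  have hK0 : 0 < K := by linarith
  -- The threshold for y is made independent of r, so that it survives the induction.
  suffices h : ∃ a : ℝ, 0 < a ∧ ∀ X y : ℝ, max 4 (K ^ 2) ≤ y → 1 ≤ X → X ≤ √y ^ (r + 2) →
      a * X ≤ friableCount X y by
    obtain ⟨a, ha, h⟩ := h
    exact ⟨a, max 4 (K ^ 2), ha, le_max_left _ _, h⟩
  induction r with
  | zero =>
    refine ⟨1 / 2, by norm_num, fun X y hy hX hXy => ?_⟩
    have hy4 : 4 ≤ y := (le_max_left _ _).trans hy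
    rw [zero_add, Real.sq_sqrt (by linarith)] at hXy
    rw [friableCount_eq_floor hXy]
    have h1 := Nat.lt_floor_add_one X
    have h2 : (1 : ℝ) ≤ ⌊X⌋₊ := by exact_mod_cast Nat.le_floor (by simpa using hX)
    linarith
  | succ r ih =>
    obtain ⟨a, ha, ih⟩ := ih
    refine ⟨min a (a * (c / 2) / (r + 3)), by positivity, fun X y hy hX hXy => ?_⟩
    have hy4 : 4 ≤ y := (le_max_left _ _).trans hy
    set v := √y with hv
    have hv2 : v ^ 2 = y := Real.sq_sqrt (by linarith)
    have hv0 : 0 ≤ v := Real.sqrt_nonneg _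
    have hKv : K ≤ v := by
      rw [hv]; exact Real.le_sqrt_of_sq_le ((le_max_right _ _).trans hy)
    have hv1 : 1 < v := by linarith
    by_cases hcase : X ≤ v ^ (r + 2)
    · exact (mul_le_mul_of_nonneg_right (min_le_left _ _) (by linarith)).trans
        (ih X y hy hX hcase)
    push Not at hcase
    have hlv : 0 < Real.log v := Real.log_pos hv1
    have hsum : c / 2 ≤ ∑ p ∈ primesIoc v y, (1 : ℝ) / p := by
      have h1 := hM v y hv1.le (by rw [← hv2]; nlinarith)
      rw [← hv2, Real.log_pow, sq, mul_div_assoc, mul_self_div_self] at h1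
      calc c / 2 = c * Real.log v / ((2 : ℕ) * Real.log v) := by push_cast; field_simp
        _ ≤ _ := by rw [← hv2, sq, mul_div_assoc]; exact h1
    have hfr : ∀ p ∈ primesIoc v y, IsFriable y p := fun p hp => by
      rw [mem_primesIoc hv0 (by linarith)] at hp
      exact isFriable_of_le hp.1.ne_zero hp.2.2
    have hlow : a * X * (c / 2) ≤ ∑ p ∈ primesIoc v y, friableCount (X / p) y := by
      calc a * X * (c / 2) ≤ a * X * ∑ p ∈ primesIoc v y, (1 : ℝ) / p := by gcongr
        _ = ∑ p ∈ primesIoc v y, a * (X / p) := by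
            rw [Finset.mul_sum]; refine Finset.sum_congr rfl fun p _ => by ring
        _ ≤ _ := by
            refine Finset.sum_le_sum fun p hp => ?_
            rw [mem_primesIoc hv0 (by linarith)] at hp
            have hp0 : (0 : ℝ) < p := by linarith [hp.2.1]
            apply ih (X / p) y hy
            · rw [le_div_iff₀ hp0, one_mul]
              calc (p : ℝ) ≤ v ^ 2 := by rw [hv2]; exact hp.2.2
                _ ≤ v ^ (r + 2) := pow_le_pow_right₀ hv1.le (by omega)
                _ ≤ X := hcase.le
            · rw [div_le_iff₀ hp0]
              calc X ≤ v ^ (r + 1 + 2) := hXy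
                _ = v ^ (r + 2) * v := by ring
                _ ≤ v ^ (r + 2) * p := by gcongr; exact hp.2.1.le
    have hup : ∑ p ∈ primesIoc v y, friableCount (X / p) y ≤ (r + 3) * friableCount X y := by
      have h2 := sum_friableUpTo_sum_dvd (x := X) (y := y) (primesIoc v y) hfr (fun _ => 1)
      simp only [one_mul, Finset.sum_const, nsmul_eq_mul, mul_one] at h2
      rw [← h2, mul_comm, friableCount, ← nsmul_eq_mul]
      apply Finset.sum_le_card_nsmul
      intro n hn
      rw [mem_friableUpTo] at hn
      set P := (primesIoc v y).filter (· ∣ n) with hP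
      have hdvd : ∏ p ∈ P, p ∣ n := Finset.prod_primes_dvd n
        (fun p hp => ((mem_primesIoc hv0 (by linarith)).1 (Finset.mem_filter.1 hp).1).1.prime)
        (fun p hp => (Finset.mem_filter.1 hp).2)
      have h3 : v ^ P.card ≤ v ^ (r + 3) := by
        calc v ^ P.card = ∏ _p ∈ P, v := by rw [Finset.prod_const]
          _ ≤ ∏ p ∈ P, (p : ℝ) := Finset.prod_le_prod (fun _ _ => hv0) fun p hp =>
              ((mem_primesIoc hv0 (by linarith)).1 (Finset.mem_filter.1 hp).1).2.1.le
          _ ≤ n := by rw [← Nat.cast_prod]; exact_mod_cast Nat.le_of_dvd (Nat.pos_of_ne_zero hn.2.1) hdvd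
          _ ≤ X := hn.1
          _ ≤ v ^ (r + 3) := hXy
      have h4 : P.card ≤ r + 3 := (pow_le_pow_iff_right₀ hv1).1 h3
      exact_mod_cast h4
    calc min a (a * (c / 2) / (r + 3)) * X ≤ a * (c / 2) / (r + 3) * X := by
          gcongr; exact min_le_right _ _
      _ = a * X * (c / 2) / (r + 3) := by ring
      _ ≤ friableCount X y := by
          rw [div_le_iff₀ (by positivity)]
          linarith

/-! ### Growth of the friable Chebyshev function. -/

theorem friablePsi_mono {V V' y : ℝ} (h : V ≤ V') : friablePsi V y ≤ friablePsi V' y :=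
  Finset.sum_le_sum_of_subset_of_nonneg (friableUpTo_mono h le_rfl)
    fun _ _ _ => ArithmeticFunction.vonMangoldt_nonneg

theorem friablePsi_le (V y : ℝ) (hV : 0 ≤ V) : friablePsi V y ≤ 6 * V := by
  calc friablePsi V y ≤ Chebyshev.psi V := by
        apply Finset.sum_le_sum_of_subset_of_nonneg
        · intro n hn
          rw [mem_friableUpTo] at hn
          exact Finset.mem_Ioc.2 ⟨Nat.pos_of_ne_zero hn.2.1, (Nat.le_floor_iff hV).2 hn.1⟩
        · intros; exact ArithmeticFunction.vonMangoldt_nonneg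
    _ ≤ (Real.log 4 + 4) * V := Chebyshev.psi_le_const_mul_self hV
    _ ≤ 6 * V := by
        gcongr
        have : Real.log 4 = 2 * Real.log 2 := by
          rw [show (4 : ℝ) = 2 ^ 2 by norm_num, Real.log_pow]; norm_num
        linarith [Real.log_two_lt_d9]

theorem theta_le_friablePsi {V y z : ℝ} (hz : 0 ≤ z) (hzV : z ≤ V) (hzy : z ≤ y) :
    Chebyshev.theta z ≤ friablePsi V y := by
  have h := theta_sub_theta hz
  rw [Chebyshev.theta_zero, sub_zero] at h
  rw [h]
  calc ∑ p ∈ primesIoc 0 z, Real.log p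
      = ∑ p ∈ primesIoc 0 z, ArithmeticFunction.vonMangoldt p := by
        refine Finset.sum_congr rfl fun p hp => ?_
        rw [mem_primesIoc le_rfl hz] at hp
        rw [ArithmeticFunction.vonMangoldt_apply_prime hp.1]
    _ ≤ _ := by
        apply Finset.sum_le_sum_of_subset_of_nonneg
        · intro p hp
          rw [mem_primesIoc le_rfl hz] at hp
          exact mem_friableUpTo.2 ⟨hp.2.2.trans hzV,
            isFriable_of_le hp.1.ne_zero (hp.2.2.trans hzy)⟩
        · intros; exact ArithmeticFunction.vonMangoldt_nonneg

/-- A prime q has at most one power in (V, 2V], so the new terms contribute at most log q for each q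
≤ y. -/
theorem friablePsi_two_mul_le {V y : ℝ} (hV : 0 ≤ V) (hy : 0 ≤ y) :
    friablePsi (2 * V) y ≤ friablePsi V y + Chebyshev.theta y := by
  classical
  have hsub : friableUpTo V y ⊆ friableUpTo (2 * V) y := friableUpTo_mono (by linarith) le_rfl
  rw [friablePsi, friablePsi, ← Finset.sum_sdiff hsub, add_comm]
  gcongr
  set D := (friableUpTo (2 * V) y \ friableUpTo V y).filter IsPrimePow with hD
  have h1 : ∑ d ∈ friableUpTo (2 * V) y \ friableUpTo V y, ArithmeticFunction.vonMangoldt d =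
      ∑ d ∈ D, Real.log d.minFac := by
    rw [hD, Finset.sum_filter]
    refine Finset.sum_congr rfl fun d _ => ?_
    rw [ArithmeticFunction.vonMangoldt_apply]
  rw [h1]
  have hθ := theta_sub_theta hy
  rw [Chebyshev.theta_zero, sub_zero] at hθ
  rw [hθ]
  have hDmem : ∀ d ∈ D, IsPrimePow d ∧ V < d ∧ (d : ℝ) ≤ 2 * V ∧ IsFriable y d := by
    intro d hd
    rw [hD, Finset.mem_filter, Finset.mem_sdiff, mem_friableUpTo, mem_friableUpTo] at hd
    obtain ⟨⟨⟨h2, h3⟩, h4⟩, h5⟩ := hd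
    refine ⟨h5, ?_, h2, h3⟩
    by_contra hle
    exact h4 ⟨not_lt.1 hle, h3⟩
  have hinj : Set.InjOn Nat.minFac (D : Set ℕ) := by
    intro d hd e he hde
    obtain ⟨hd1, hd2, hd3, -⟩ := hDmem d hd
    obtain ⟨he1, he2, he3, -⟩ := hDmem e he
    have hq : d.minFac.Prime := Nat.minFac_prime hd1.ne_one
    have key : ∀ i j : ℕ, V < (d.minFac : ℝ) ^ i → (d.minFac : ℝ) ^ j ≤ 2 * V → j ≤ i := by
      intro i j hi hj
      by_contra hlt
      push Not at hlt
      have hq2 : (2 : ℝ) ≤ d.minFac := by exact_mod_cast hq.two_le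
      have h6 : (d.minFac : ℝ) ^ (i + 1) ≤ (d.minFac : ℝ) ^ j :=
        pow_le_pow_right₀ (by linarith) hlt
      rw [pow_succ] at h6
      nlinarith
    have hd4 := hd1.minFac_pow_factorization_eq
    have he4 := he1.minFac_pow_factorization_eq
    rw [← hde] at he4
    rw [← hd4] at hd2 hd3
    rw [← he4] at he2 he3
    push_cast at hd2 hd3 he2 he3
    have h7 := key _ _ hd2 he3
    have h8 := key _ _ he2 hd3
    rw [← hd4, ← he4, le_antisymm h7 h8]
  rw [← Finset.sum_image (f := fun q : ℕ => Real.log q) hinj]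
  apply Finset.sum_le_sum_of_subset_of_nonneg
  · intro q hq
    obtain ⟨d, hd, rfl⟩ := Finset.mem_image.1 hq
    obtain ⟨hd1, -, -, hd2⟩ := hDmem d hd
    have hq' : d.minFac.Prime := Nat.minFac_prime hd1.ne_one
    rw [mem_primesIoc le_rfl hy]
    exact ⟨hq', by exact_mod_cast hq'.pos, hd2.2 _ hq' (Nat.minFac_dvd d)⟩
  · intro q hq _
    rw [mem_primesIoc le_rfl hy] at hq
    exact Real.log_nonneg (by exact_mod_cast hq.1.one_lt.le)

theorem friablePsi_two_pow_mul_le_add {V y : ℝ} (hV : 0 ≤ V) (hy : 0 ≤ y) (i : ℕ) :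
    friablePsi (2 ^ i * V) y ≤ friablePsi V y + i * Chebyshev.theta y := by
  induction i with
  | zero => simp
  | succ i ih =>
    have := friablePsi_two_mul_le (V := 2 ^ i * V) (by positivity) hy
    rw [pow_succ', mul_assoc]
    push_cast
    linarith

theorem friablePsi_two_pow_mul_le_mul {V y : ℝ} (hy : 0 ≤ y) (hV : y ≤ V) (i : ℕ) :
    friablePsi (2 ^ i * V) y ≤ 2 ^ i * friablePsi V y := by
  induction i with
  | zero => simp
  | succ i ih =>
    have hle : V ≤ 2 ^ i * V := le_mul_of_one_le_left (by linarith) (one_le_pow₀ (by norm_num))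
    have h1 := friablePsi_two_mul_le (V := 2 ^ i * V) (by linarith) hy
    have h2 := theta_le_friablePsi (V := 2 ^ i * V) hy (by linarith) le_rfl
    rw [pow_succ', mul_assoc, mul_assoc]
    linarith

/-- For V ≥ y each doubling adds at most θ(y), itself at most the current value, so growth is
linear. For V < y the function agrees with Chebyshev's up to constants; the + 1 covers V < 2, where
it vanishes. -/
theorem exists_friablePsi_mul_le : ∃ C : ℝ, 1 ≤ C ∧ ∀ V y w : ℝ, 1 ≤ V → 2 ≤ y → 1 ≤ w →
    friablePsi (w * V) y ≤ C * w * (friablePsi V y + 1) := by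
  obtain ⟨c, hc, hc1, hθ⟩ := exists_theta_lower
  refine ⟨12 / c, by rw [le_div_iff₀ hc]; linarith, fun V y w hV hy hw => ?_⟩
  have h12 : 12 ≤ 12 / c := by rw [le_div_iff₀ hc]; linarith
  have hψ := friablePsi_nonneg V y
  have hw0 : 0 < w := by linarith
  by_cases hVy : y ≤ V
  · obtain ⟨i, hi1, hi2⟩ := exists_nat_pow_near hw (one_lt_two (α := ℝ))
    calc friablePsi (w * V) y ≤ friablePsi (2 ^ (i + 1) * V) y :=
          friablePsi_mono (by gcongr)
      _ ≤ 2 ^ (i + 1) * friablePsi V y := friablePsi_two_pow_mul_le_mul (by linarith) hVy _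
      _ ≤ (12 / c * w) * (friablePsi V y + 1) := by
          apply mul_le_mul _ (by linarith) hψ (by positivity)
          rw [pow_succ]
          nlinarith
  · push Not at hVy
    have h1 := friablePsi_le (w * V) y (by positivity)
    refine h1.trans ?_
    by_cases hV2 : 2 ≤ V
    · have h2 := hθ V hV2
      have h3 := theta_le_friablePsi (V := V) (by linarith) le_rfl hVy.le
      calc 6 * (w * V) = 6 / c * w * (c * V) := by field_simp
        _ ≤ 12 / c * w * (friablePsi V y + 1) := by
            gcongr
            · norm_num
            · linarith
    · push Not at hV2
      calc 6 * (w * V) ≤ 12 * w * 1 := by nlinarith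
        _ ≤ 12 / c * w * (friablePsi V y + 1) := by
            gcongr
            linarith

/-! ### Local growth of Ψ and the lower bound for Ψ(x/y, y). -/

/-- Split dyadically by the size of Z/m: at most I ranges occur, each costing 2B. The bound is
required only at points Z/2^i ≥ X, where the growth estimates are available. -/
theorem sum_div_friableUpTo_le {X Z y B : ℝ} (hX : 0 < X) {I : ℕ} (hI : Z ≤ 2 ^ I * X)
    (hB : ∀ i < I, X ≤ Z / 2 ^ i → 2 ^ i * friableCount (Z / 2 ^ i) y ≤ B) (hB0 : 0 ≤ B) :
    ∑ m ∈ (friableUpTo Z y).filter (fun m : ℕ => X < m), Z / m ≤ 2 * I * B := by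
  classical
  calc ∑ m ∈ (friableUpTo Z y).filter (fun m : ℕ => X < m), Z / m
      ≤ ∑ m ∈ (friableUpTo Z y).filter (fun m : ℕ => X < m), ∑ i ∈ Finset.range I,
          if (m : ℝ) ≤ Z / 2 ^ i ∧ X ≤ Z / 2 ^ i then (2 : ℝ) ^ (i + 1) else 0 := by
        refine Finset.sum_le_sum fun m hm => ?_
        rw [Finset.mem_filter, mem_friableUpTo] at hm
        have hm0 : (0 : ℝ) < m := by linarith [hm.2]
        obtain ⟨i, hi1, hi2⟩ := exists_nat_pow_near
          (show 1 ≤ Z / m by rw [le_div_iff₀ hm0]; linarith [hm.1.1]) (one_lt_two (α := ℝ))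
        have hmi : (m : ℝ) ≤ Z / 2 ^ i := by
          rw [le_div_iff₀ hm0] at hi1
          rw [le_div_iff₀ (by positivity)]
          linarith
        have hiI : i < I := by
          by_contra hle
          push Not at hle
          have h1 : (2 : ℝ) ^ I ≤ 2 ^ i := pow_le_pow_right₀ (by norm_num) hle
          rw [le_div_iff₀ hm0] at hi1
          have h2 : (2 : ℝ) ^ I * m ≤ 2 ^ i * m := by gcongr
          have h3 : (2 : ℝ) ^ I * X < 2 ^ I * m := by gcongr; exact hm.2
          linarith
        refine le_trans hi2.le ?_
        have := Finset.single_le_sum (s := Finset.range I)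
          (f := fun i => if (m : ℝ) ≤ Z / 2 ^ i ∧ X ≤ Z / 2 ^ i then (2 : ℝ) ^ (i + 1) else 0)
          (fun j _ => by split_ifs <;> positivity) (Finset.mem_range.2 hiI)
        rwa [if_pos ⟨hmi, by linarith [hm.2]⟩] at this
    _ = ∑ i ∈ Finset.range I, ∑ m ∈ (friableUpTo Z y).filter (fun m : ℕ => X < m),
          if (m : ℝ) ≤ Z / 2 ^ i ∧ X ≤ Z / 2 ^ i then (2 : ℝ) ^ (i + 1) else 0 := Finset.sum_comm
    _ ≤ ∑ i ∈ Finset.range I, 2 * B := by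
        refine Finset.sum_le_sum fun i hi => ?_
        by_cases hXi : X ≤ Z / 2 ^ i
        · rw [← Finset.sum_filter, Finset.sum_const, nsmul_eq_mul]
          have hcard : ((((friableUpTo Z y).filter (fun m : ℕ => X < m)).filter
              (fun m : ℕ => (m : ℝ) ≤ Z / 2 ^ i ∧ X ≤ Z / 2 ^ i)).card : ℝ) ≤
              friableCount (Z / 2 ^ i) y := by
            unfold friableCount
            rw [Nat.cast_le]
            apply Finset.card_le_card
            intro m hm
            rw [Finset.mem_filter, Finset.mem_filter, mem_friableUpTo] at hm
            exact mem_friableUpTo.2 ⟨hm.2.1, hm.1.1.2⟩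
          have h4 := hB i (Finset.mem_range.1 hi) hXi
          calc _ ≤ friableCount (Z / 2 ^ i) y * 2 ^ (i + 1) := by gcongr
            _ = 2 * (2 ^ i * friableCount (Z / 2 ^ i) y) := by ring
            _ ≤ 2 * B := by linarith
        · rw [Finset.sum_eq_zero fun m _ => if_neg fun h => hXi h.2]
          linarith
    _ = 2 * I * B := by simp; ring

theorem exists_le_two_pow {y : ℝ} (hy : 2 ≤ y) : ∃ I : ℕ, y ≤ 2 ^ I ∧ (I : ℝ) ≤ 3 * Real.log y := by
  obtain ⟨n, hn1, hn2⟩ := exists_nat_pow_near (show 1 ≤ y by linarith) (one_lt_two (α := ℝ))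
  refine ⟨n + 1, hn2.le, ?_⟩
  have h1 : n * Real.log 2 ≤ Real.log y := by
    rw [← Real.log_pow]; exact Real.log_le_log (by positivity) hn1
  have h2 := Real.log_le_log (by norm_num) hy
  have h3 := Real.log_two_gt_d9
  push_cast
  have : (n : ℝ) * 0.69 ≤ n * Real.log 2 := by gcongr; linarith
  linarith

/-- In Hildebrand's identity at w X, the terms m > X are estimated by Chebyshev's bound; those with
m ≤ X are kept exact, to be compared with the identity at X. -/
theorem sum_log_friableUpTo_le_add {X w : ℝ} (y : ℝ) (hX : 0 < X) (hw : 1 ≤ w) :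
    ∑ n ∈ friableUpTo (w * X) y, Real.log n ≤
      ∑ m ∈ friableUpTo X y, friablePsi (w * (X / m)) y +
        6 * ∑ m ∈ (friableUpTo (w * X) y).filter (fun m : ℕ => X < m), w * X / m := by
  classical
  have hfil : (friableUpTo (w * X) y).filter (fun m : ℕ => ¬ X < m) = friableUpTo X y := by
    ext m
    rw [Finset.mem_filter, mem_friableUpTo, mem_friableUpTo, not_lt]
    constructor
    · rintro ⟨⟨-, h1⟩, h2⟩
      exact ⟨h2, h1⟩
    · rintro ⟨h1, h2⟩
      exact ⟨⟨by nlinarith, h2⟩, h1⟩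
  rw [sum_log_friableUpTo, ← Finset.sum_filter_add_sum_filter_not _ (fun m : ℕ => X < m), hfil,
    add_comm, Finset.mul_sum]
  apply add_le_add
  · refine le_of_eq (Finset.sum_congr rfl fun m _ => by rw [mul_div_assoc])
  · refine Finset.sum_le_sum fun m _ => friablePsi_le _ _ (by positivity)

/-- A bootstrap on the largest density M of friable integers at points w X. At a nearly extremal w,
the terms m ≤ X give O(w log X · Ψ(X, y)), and those m > X give O(log y · M w X), which is absorbed
because log X is much larger than log y. -/
theorem exists_friableCount_mul_le : ∃ K : ℝ, 1 ≤ K ∧ ∀ X y w : ℝ, 2 ≤ y → 1 ≤ X →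
    144 * Real.log y ≤ Real.log X → 1 ≤ w → w ≤ y →
      friableCount (w * X) y ≤ K * w * friableCount X y := by
  obtain ⟨C, hC, hψ⟩ := exists_friablePsi_mul_le
  refine ⟨4 * (1 + 2 * C), by linarith, fun X y w₀ hy hX hXy hw₀ hw₀y => ?_⟩
  have hX0 : 0 < X := by linarith
  have hly : 0.69 ≤ Real.log y := by
    have := Real.log_le_log (by norm_num) hy
    linarith [Real.log_two_gt_d9]
  set S := (fun w => friableCount (w * X) y / (w * X)) '' Set.Icc 1 y with hS
  have hbdd : BddAbove S := by
    refine ⟨1, ?_⟩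
    rintro _ ⟨w, ⟨hw1, -⟩, rfl⟩
    simp only
    rw [div_le_one (by positivity)]
    exact friableCount_le_self (by positivity) y
  set M := sSup S with hM
  have hle : ∀ w, 1 ≤ w → w ≤ y → friableCount (w * X) y ≤ M * (w * X) := fun w h1 h2 => by
    rw [← div_le_iff₀ (by positivity)]
    exact le_csSup hbdd ⟨w, ⟨h1, h2⟩, rfl⟩
  have hΨX := one_le_friableCount hX y
  have hMpos : 0 < M := by
    have := hle 1 le_rfl (by linarith)
    rw [one_mul] at this
    by_contra hneg
    push Not at hneg
    nlinarith
  -- Attainment of the supremum is not needed: half of it is enough.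
  obtain ⟨_, ⟨w, ⟨hw1, hwy⟩, rfl⟩, hwM⟩ := exists_lt_of_lt_csSup
    (show S.Nonempty from ⟨_, 1, ⟨le_rfl, by linarith⟩, rfl⟩) (show M / 2 < M by linarith)
  simp only at hwM
  have hw0 : 0 < w := by linarith
  rw [lt_div_iff₀ (by positivity)] at hwM
  obtain ⟨I, hI1, hI2⟩ := exists_le_two_pow hy
  have hII := sum_div_friableUpTo_le (X := X) (Z := w * X) (y := y) (B := M * (w * X)) hX0 (I := I)
    (by gcongr; linarith) (fun i _ hi => by
      have h2i : (0 : ℝ) < 2 ^ i := by positivity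
      have h1 : 1 ≤ w / 2 ^ i := by
        rw [le_div_iff₀ h2i] at hi ⊢
        nlinarith
      have h2 : w / 2 ^ i ≤ y := (div_le_self hw0.le (one_le_pow₀ (by norm_num))).trans hwy
      have h3 := hle (w / 2 ^ i) h1 h2
      rw [show w * X / 2 ^ i = w / 2 ^ i * X by ring]
      calc 2 ^ i * friableCount (w / 2 ^ i * X) y ≤ 2 ^ i * (M * (w / 2 ^ i * X)) := by gcongr
        _ = M * (w * X) := by field_simp) (by positivity)
  have hsplit := sum_log_friableUpTo_le_add (X := X) (w := w) y hX0 hw1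
  have hlX : 1 ≤ Real.log X := by linarith
  have hfirst : ∑ m ∈ friableUpTo X y, friablePsi (w * (X / m)) y ≤
      2 * C * w * Real.log X * friableCount X y := by
    calc ∑ m ∈ friableUpTo X y, friablePsi (w * (X / m)) y
        ≤ ∑ m ∈ friableUpTo X y, C * w * (friablePsi (X / m) y + 1) := by
          refine Finset.sum_le_sum fun m hm => hψ _ _ _ ?_ hy hw1
          rw [mem_friableUpTo] at hm
          have : (0 : ℝ) < m := by exact_mod_cast Nat.pos_of_ne_zero hm.2.1
          rw [le_div_iff₀ this]; linarith [hm.1]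
      _ = C * w * (∑ n ∈ friableUpTo X y, Real.log n + friableCount X y) := by
          rw [← Finset.mul_sum, Finset.sum_add_distrib, ← sum_log_friableUpTo, friableCount]
          simp
      _ ≤ C * w * (friableCount X y * Real.log X + friableCount X y * Real.log X) := by
          gcongr
          · exact sum_log_friableUpTo_le X y
          · nlinarith
      _ = _ := by ring
  have hlower : Real.log X * (friableCount (w * X) y - friableCount X y) ≤
      ∑ n ∈ friableUpTo (w * X) y, Real.log n := by
    classical
    have hsub : friableUpTo X y ⊆ friableUpTo (w * X) y :=
      friableUpTo_mono (by nlinarith) le_rfl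
    have hcard : friableCount (w * X) y - friableCount X y =
        ((friableUpTo (w * X) y \ friableUpTo X y).card : ℝ) := by
      rw [Finset.card_sdiff_of_subset hsub, Nat.cast_sub (Finset.card_le_card hsub)]; rfl
    rw [hcard, mul_comm, ← nsmul_eq_mul]
    refine le_trans (Finset.card_nsmul_le_sum _ _ _ fun n hn => ?_)
      (Finset.sum_le_sum_of_subset_of_nonneg Finset.sdiff_subset fun n _ _ =>
        Real.log_natCast_nonneg n)
    rw [Finset.mem_sdiff, mem_friableUpTo, mem_friableUpTo] at hn
    apply Real.log_le_log hX0
    by_contra hlt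
    exact hn.2 ⟨(not_le.1 hlt).le, hn.1.2⟩
  -- The origin of 144: I ≤ 3 log y gives 12 I ≤ 36 log y ≤ (log X)/4, leaving a quarter of the main
  -- term after absorption.
  have hI3 : 6 * (2 * (I : ℝ) * (M * (w * X))) ≤ Real.log X / 4 * (M * (w * X)) := by
    have : 12 * (I : ℝ) ≤ Real.log X / 4 := by linarith
    have h0 : 0 ≤ M * (w * X) := by positivity
    nlinarith
  have hA : Real.log X * (M / 2 * (w * X)) ≤ Real.log X * friableCount (w * X) y := by
    gcongr
  have hwΨ : Real.log X * friableCount X y ≤ w * (Real.log X * friableCount X y) :=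
    le_mul_of_one_le_left (by positivity) hw1
  have hfinal : Real.log X * (M * (w * X)) ≤
      Real.log X * (4 * (1 + 2 * C) * w * friableCount X y) := by
    nlinarith
  have hfinal2 := le_of_mul_le_mul_left hfinal (by linarith)
  have hMX : M * X ≤ 4 * (1 + 2 * C) * friableCount X y := by
    have : w * (M * X) ≤ w * (4 * (1 + 2 * C) * friableCount X y) := by linarith
    exact le_of_mul_le_mul_left this hw0
  calc friableCount (w₀ * X) y ≤ M * (w₀ * X) := hle w₀ hw₀ hw₀y
    _ = w₀ * (M * X) := by ring
    _ ≤ w₀ * (4 * (1 + 2 * C) * friableCount X y) := by gcongr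
    _ = _ := by ring

/-- For log x ≫ log y, compare two estimates of Σ log n at x: it is ≫ Ψ(x, y) log x since most
friable integers exceed √x, and ≪ y log y · Ψ(x/y, y) by Hildebrand's identity and local growth.
Otherwise positive density suffices. -/
theorem exists_friableCount_div_self_lower : ∃ c C : ℝ, 0 < c ∧ c ≤ 1 ∧ 4 ≤ C ∧ ∀ x y : ℝ, C ≤ y →
    C * Real.log x ≤ y → y ≤ x →
      c * (Real.log x / (y * Real.log y)) * friableCount x y ≤ friableCount (x / y) y := by
  obtain ⟨K, hK, hG⟩ := exists_friableCount_mul_le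
  obtain ⟨C₁, hC₁, h₁⟩ := exists_friableRatio_le_log_div
  obtain ⟨c₀, y₁, hc₀, hy₁, hBU⟩ := exists_le_friableCount_of_le_pow 290
  refine ⟨min 1 (min (c₀ / 145) (1 / (4 * (7 + 36 * K)))), max y₁ (2 * C₁), by positivity,
    min_le_left _ _, hy₁.trans (le_max_left _ _), ?_⟩
  set c := min 1 (min (c₀ / 145) (1 / (4 * (7 + 36 * K)))) with hc
  have hcc₀ : c ≤ c₀ / 145 := (min_le_right _ _).trans (min_le_left _ _)
  have hcK : c ≤ 1 / (4 * (7 + 36 * K)) := (min_le_right _ _).trans (min_le_right _ _)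
  intro x y hCy hxy hyx
  have hy₁y : y₁ ≤ y := (le_max_left _ _).trans hCy
  have hy4 : 4 ≤ y := hy₁.trans hy₁y
  have hy0 : 0 < y := by linarith
  have hx0 : 0 < x := by linarith
  have hly : 0.69 * 2 ≤ Real.log y := by
    have := Real.log_le_log (by norm_num) hy4
    rw [show (4 : ℝ) = 2 ^ 2 by norm_num, Real.log_pow] at this
    push_cast at this
    linarith [Real.log_two_gt_d9]
  have hlx : Real.log y ≤ Real.log x := Real.log_le_log hy0 hyx
  have hX1 : 1 ≤ x / y := by rw [le_div_iff₀ hy0]; linarith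
  by_cases hcase : Real.log x ≤ 145 * Real.log y
  -- The exponent 292 gives y^146, which covers log x ≤ 145 log y; beyond that log(x/y) ≥ 144 log y,
  -- as local growth demands.
  · have hX : x / y ≤ √y ^ (290 + 2) := by
      refine (div_le_self hx0.le (by linarith)).trans ?_
      rw [← Real.log_le_log_iff hx0 (by positivity), Real.log_pow, Real.log_sqrt hy0.le]
      push_cast
      linarith
    calc c * (Real.log x / (y * Real.log y)) * friableCount x y
        ≤ c₀ / 145 * (145 * Real.log y / (y * Real.log y)) * x := by
          have h1 := friableCount_le_self hx0.le y
          have h2 := friableCount_nonneg x y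
          have h3 : 0 ≤ Real.log x := by linarith
          have h4 : 0 < Real.log y := by linarith
          gcongr
      _ = c₀ * (x / y) := by field_simp
      _ ≤ _ := hBU _ _ hy₁y hX1 hX
  push Not at hcase
  set X := x / y with hXdef
  have hyX : y * X = x := by rw [hXdef]; field_simp
  have hlX : 144 * Real.log y ≤ Real.log X := by
    rw [hXdef, Real.log_div hx0.ne' hy0.ne']; linarith
  have hΨX : 0 ≤ friableCount X y := friableCount_nonneg _ _
  obtain ⟨I, hI1, hI2⟩ := exists_le_two_pow (show 2 ≤ y by linarith)
  have hII := sum_div_friableUpTo_le (X := X) (Z := y * X) (y := y) (B := K * y * friableCount X y)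
    (by linarith) (I := I) (by gcongr) (fun i _ hi => by
      have h2i : (0 : ℝ) < 2 ^ i := by positivity
      have h1 : 1 ≤ y / 2 ^ i := by
        rw [le_div_iff₀ h2i] at hi ⊢
        nlinarith
      have h2 : y / 2 ^ i ≤ y := div_le_self hy0.le (one_le_pow₀ (by norm_num))
      have h3 := hG X y (y / 2 ^ i) (by linarith) hX1 hlX h1 h2
      rw [show y * X / 2 ^ i = y / 2 ^ i * X by ring]
      calc 2 ^ i * friableCount (y / 2 ^ i * X) y
          ≤ 2 ^ i * (K * (y / 2 ^ i) * friableCount X y) := by gcongr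
        _ = K * y * friableCount X y := by field_simp) (by positivity)
  have hsplit := sum_log_friableUpTo_le_add (X := X) (w := y) y (by linarith) (by linarith)
  have hθ : Chebyshev.theta y ≤ 2 * y := by
    refine (Chebyshev.theta_le_log4_mul_x hy0.le).trans ?_
    have : Real.log 4 = 2 * Real.log 2 := by
      rw [show (4 : ℝ) = 2 ^ 2 by norm_num, Real.log_pow]; norm_num
    gcongr
    linarith [Real.log_two_lt_d9]
  have hlogxy : Real.log x ≤ y := by
    have h1 : 1 ≤ max y₁ (2 * C₁) := le_max_of_le_left (by linarith)
    have h0 : 0 ≤ Real.log x := by linarith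
    nlinarith
  have hfirst : ∑ m ∈ friableUpTo X y, friablePsi (y * (X / m)) y ≤
      7 * (y * Real.log y) * friableCount X y := by
    calc ∑ m ∈ friableUpTo X y, friablePsi (y * (X / m)) y
        ≤ ∑ m ∈ friableUpTo X y, (friablePsi (X / m) y + I * Chebyshev.theta y) := by
          refine Finset.sum_le_sum fun m _ => ?_
          have h0 : 0 ≤ X / m := by positivity
          -- The additive form of doubling is essential: multiplying by y costs only O(y log y) in
          -- total, without a factor y on ψ(X/m), which would lose a factor log x.
          refine le_trans (friablePsi_mono ?_) (friablePsi_two_pow_mul_le_add h0 hy0.le I)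
          gcongr
      _ = ∑ n ∈ friableUpTo X y, Real.log n + friableCount X y * (I * Chebyshev.theta y) := by
          rw [Finset.sum_add_distrib, ← sum_log_friableUpTo, friableCount]
          simp
      _ ≤ friableCount X y * Real.log X +
            friableCount X y * (3 * Real.log y * (2 * y)) := by
          have hθ0 := Chebyshev.theta_nonneg y
          gcongr
          exact sum_log_friableUpTo_le X y
      _ ≤ friableCount X y * (y * Real.log y) + friableCount X y * (3 * Real.log y * (2 * y)) := by
          have h1 : Real.log X ≤ Real.log x :=
            Real.log_le_log (by linarith) (div_le_self hx0.le (by linarith))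
          gcongr
          nlinarith
      _ = _ := by ring
  rw [hyX] at hsplit hII
  have hupper : ∑ n ∈ friableUpTo x y, Real.log n ≤
      (7 + 36 * K) * (y * Real.log y) * friableCount X y := by
    have h1 : 6 * (2 * (I : ℝ) * (K * y * friableCount X y)) ≤
        6 * (2 * (3 * Real.log y) * (K * y * friableCount X y)) := by gcongr
    nlinarith
  have hlower : Real.log x / 4 * friableCount x y ≤ ∑ n ∈ friableUpTo x y, Real.log n := by
    classical
    have hsq0 : 0 < √x := Real.sqrt_pos.2 hx0
    have hsqX : √x ≤ X := by
      rw [hXdef, le_div_iff₀ hy0, ← Real.log_le_log_iff (by positivity) hx0,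
        Real.log_mul hsq0.ne' hy0.ne', Real.log_sqrt hx0.le]
      linarith
    have hhalf : friableCount X y ≤ 1 / 2 * friableCount x y := by
      have h1 := friableCount_div_le (X := x) (y := y) (z := y) (x := x) (by linarith) le_rfl
      refine h1.trans (mul_le_mul_of_nonneg_right ?_ (friableCount_nonneg _ _))
      refine (h₁ x y y (by linarith) (by linarith) le_rfl).trans ?_
      rw [div_le_iff₀ hy0]
      have h2 : 2 * C₁ * Real.log x ≤ max y₁ (2 * C₁) * Real.log x := by
        have : 0 ≤ Real.log x := by linarith
        gcongr
        exact le_max_right _ _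
      linarith
    have hsub : friableUpTo X y ⊆ friableUpTo x y :=
      friableUpTo_mono (div_le_self hx0.le (by linarith)) le_rfl
    have hcard : friableCount x y - friableCount X y =
        ((friableUpTo x y \ friableUpTo X y).card : ℝ) := by
      rw [Finset.card_sdiff_of_subset hsub, Nat.cast_sub (Finset.card_le_card hsub)]; rfl
    calc Real.log x / 4 * friableCount x y
        ≤ (friableCount x y - friableCount X y) * (Real.log x / 2) := by
          have : 0 ≤ Real.log x := by linarith
          nlinarith
      _ = (friableUpTo x y \ friableUpTo X y).card • (Real.log x / 2) := by
          rw [hcard, nsmul_eq_mul]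
      _ ≤ ∑ n ∈ friableUpTo x y \ friableUpTo X y, Real.log n := by
          refine Finset.card_nsmul_le_sum _ _ _ fun n hn => ?_
          rw [Finset.mem_sdiff, mem_friableUpTo, mem_friableUpTo] at hn
          rw [← Real.log_sqrt hx0.le]
          apply Real.log_le_log hsq0
          by_contra hlt
          exact hn.2 ⟨(not_le.1 hlt).le.trans hsqX, hn.1.2⟩
      _ ≤ _ := Finset.sum_le_sum_of_subset_of_nonneg Finset.sdiff_subset fun n _ _ =>
          Real.log_natCast_nonneg n
  have hylog : 0 < y * Real.log y := by positivity
  have h7K : 0 < 7 + 36 * K := by linarith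
  calc c * (Real.log x / (y * Real.log y)) * friableCount x y
      ≤ 1 / (4 * (7 + 36 * K)) * (Real.log x / (y * Real.log y)) * friableCount x y := by
        have : 0 ≤ Real.log x := by linarith
        have := friableCount_nonneg x y
        gcongr
    _ = (Real.log x / 4 * friableCount x y) / ((7 + 36 * K) * (y * Real.log y)) := by
        field_simp
    _ ≤ friableCount X y := by
        rw [div_le_iff₀ (by positivity)]
        linarith

/-! ### Buchstab's identity and the growth of Ψ(x, y) in y. -/

theorem friableCount_prime_eq {x : ℝ} {p : ℕ} (hp : p.Prime) :
    friableCount x p = friableCount x (p - 1 : ℕ) + friableCount (x / p) p := by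
  classical
  rw [← card_friableUpTo_filter_dvd (isFriable_of_le hp.ne_zero le_rfl)]
  unfold friableCount
  rw [← Finset.card_filter_add_card_filter_not (s := friableUpTo x p) (p ∣ ·), Nat.cast_add, add_comm]
  congr 3
  ext n
  rw [Finset.mem_filter, mem_friableUpTo, mem_friableUpTo]
  constructor
  · rintro ⟨⟨h1, h2⟩, h3⟩
    refine ⟨h1, h2.1, fun q hq hqn => ?_⟩
    have h4 : q ≤ p := by exact_mod_cast h2.2 q hq hqn
    have h5 : q ≠ p := fun h => h3 (h ▸ hqn)
    exact_mod_cast (show q ≤ p - 1 by omega)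
  · rintro ⟨h1, h2⟩
    have hle : ((p - 1 : ℕ) : ℝ) ≤ p := by exact_mod_cast Nat.sub_le p 1
    refine ⟨⟨h1, h2.mono hle⟩, fun hpn => ?_⟩
    have h3 : p ≤ p - 1 := by exact_mod_cast h2.2 p hp hpn
    have := hp.pos
    omega

theorem friableCount_floor (x : ℝ) {y : ℝ} (hy : 0 ≤ y) :
    friableCount x y = friableCount x (⌊y⌋₊ : ℝ) := by
  unfold friableCount
  congr 2
  ext n
  rw [mem_friableUpTo, mem_friableUpTo]
  refine and_congr_right fun _ => and_congr_right fun _ => ?_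
  refine forall_congr' fun p => forall_congr' fun hp => forall_congr' fun _ => ?_
  rw [Nat.cast_le, Nat.le_floor_iff hy]

theorem exists_friableCount_exp_lower : ∃ c C K : ℝ, 0 < c ∧ 4 ≤ C ∧ 1 < K ∧ ∀ x z Y : ℝ, C ≤ z →
    C * Real.log x ≤ z → K * z ≤ Y → Y ≤ x →
      friableCount x z * Real.exp (c * (Real.log x * Real.log (Y / z) / Real.log Y ^ 2)) ≤
        friableCount x Y := by
  obtain ⟨c, C, hc, hc1, hC, hH⟩ := exists_friableCount_div_self_lower
  obtain ⟨K, hK, c', hc', hM⟩ := exists_sum_inv_primesIoc_lower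
  refine ⟨c * c' / 2, C, K, by positivity, hC, hK, ?_⟩
  intro x z Y hCz hxz hzY hYx
  have hz4 : 4 ≤ z := hC.trans hCz
  have hzY' : z ≤ Y := by nlinarith
  have hY0 : 0 < Y := by linarith
  have hlY : 1 < Real.log Y := by
    rw [Real.lt_log_iff_exp_lt hY0]
    linarith [Real.exp_one_lt_d9]
  have hlx : 0 < Real.log x := Real.log_pos (by linarith)
  -- Replacing log p by log Y turns the exponent into a multiple of Σ 1/p. As η(p) ≤ 1, exp(η(p)/2)
  -- ≤ 1 + η(p), hence the halves below.
  set η : ℕ → ℝ := fun p => c * (Real.log x / (p * Real.log Y)) with hη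
  have hstep : ∀ p : ℕ, p.Prime → z < p → (p : ℝ) ≤ Y →
      friableCount x (p - 1 : ℕ) * Real.exp (η p / 2) ≤ friableCount x p := by
    intro p hp hzp hpY
    have hp0 : (0 : ℝ) < p := by linarith
    have hlp : 0 < Real.log p := Real.log_pos (by linarith)
    have h1 := hH x p (by linarith) (by linarith) (by linarith)
    have h2 : η p ≤ c * (Real.log x / (p * Real.log p)) := by
      have := Real.log_le_log hp0 hpY
      simp only [hη]
      gcongr
    have hη0 : 0 ≤ η p := by simp only [hη]; positivity
    have hη1 : η p ≤ 1 := by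
      simp only [hη]
      have h3 : Real.log x / (p * Real.log Y) ≤ 1 := by
        rw [div_le_one (by positivity)]
        nlinarith
      calc c * (Real.log x / (p * Real.log Y)) ≤ 1 * 1 := by gcongr
        _ = 1 := one_mul 1
    have hmono : friableCount x (p - 1 : ℕ) ≤ friableCount x p :=
      friableCount_mono le_rfl (by exact_mod_cast Nat.sub_le p 1)
    have h4 : η p * friableCount x p ≤ friableCount (x / p) p :=
      (mul_le_mul_of_nonneg_right h2 (friableCount_nonneg _ _)).trans h1
    have h5 : Real.exp (η p / 2) ≤ 1 + η p := by
      have h6 := Real.abs_exp_sub_one_le (x := η p / 2) (by rw [abs_of_nonneg (by linarith)]; linarith)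
      rw [abs_of_nonneg (show 0 ≤ η p / 2 by linarith)] at h6
      linarith [le_abs_self (Real.exp (η p / 2) - 1)]
    have h7 := friableCount_nonneg x (p - 1 : ℕ)
    calc friableCount x (p - 1 : ℕ) * Real.exp (η p / 2)
        ≤ friableCount x (p - 1 : ℕ) * (1 + η p) := by gcongr
      _ = friableCount x (p - 1 : ℕ) + η p * friableCount x (p - 1 : ℕ) := by ring
      _ ≤ friableCount x (p - 1 : ℕ) + η p * friableCount x p := by gcongr
      _ ≤ friableCount x (p - 1 : ℕ) + friableCount (x / p) p := by gcongr
      _ = friableCount x p := (friableCount_prime_eq hp).symm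
  have hind : ∀ N : ℕ, ⌊z⌋₊ ≤ N → N ≤ ⌊Y⌋₊ →
      friableCount x (⌊z⌋₊ : ℝ) *
        Real.exp (∑ p ∈ (Finset.Ioc ⌊z⌋₊ N).filter Nat.Prime, η p / 2) ≤ friableCount x N := by
    intro N hN
    induction N, hN using Nat.le_induction with
    | base => intro _; simp
    | succ N hN ih =>
      intro hNY
      have ih' := ih (by omega)
      rw [← Finset.insert_Ioc_right_eq_Ioc_add_one hN, Finset.filter_insert]
      split_ifs with hp
      · rw [Finset.sum_insert (by simp), add_comm, Real.exp_add, ← mul_assoc]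
        have h8 := hstep (N + 1) hp (by
          rw [← Nat.floor_lt (by linarith)]; omega) ((Nat.le_floor_iff hY0.le).1 hNY)
        rw [Nat.add_sub_cancel] at h8
        exact (mul_le_mul_of_nonneg_right ih' (Real.exp_nonneg _)).trans h8
      · exact ih'.trans (friableCount_mono le_rfl (by push_cast; linarith))
  have hfin := hind ⌊Y⌋₊ (Nat.floor_le_floor hzY') le_rfl
  rw [← friableCount_floor x (by linarith), ← friableCount_floor x hY0.le] at hfin
  refine le_trans ?_ hfin
  have hsum := hM z Y (by linarith) hzY
  refine mul_le_mul_of_nonneg_left (Real.exp_le_exp.2 ?_) (friableCount_nonneg _ _)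
  change _ ≤ ∑ p ∈ primesIoc z Y, η p / 2
  calc c * c' / 2 * (Real.log x * Real.log (Y / z) / Real.log Y ^ 2)
      = c * Real.log x / (2 * Real.log Y) * (c' * Real.log (Y / z) / Real.log Y) := by
        field_simp
    _ ≤ c * Real.log x / (2 * Real.log Y) * ∑ p ∈ primesIoc z Y, (1 : ℝ) / p := by gcongr
    _ = _ := by
        rw [Finset.mul_sum]
        refine Finset.sum_congr rfl fun p _ => ?_
        simp only [hη]
        rw [div_mul_div_comm, mul_one]
        rw [mul_div_assoc', div_div]
        congr 1
        ring

/-! ### The second assertion. -/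

set_option maxHeartbeats 1000000 in
theorem exists_zetaSum_le_friableCount :
    ∃ T₀ : ℝ, ∀ T x : ℝ, T₀ ≤ T → 2 ≤ x → x ≤ T ^ (1 / 3 : ℝ) →
      MeasureTheory.volume {t : ℝ | t ∈ Set.Icc 1 T ∧
          ¬ ‖zetaSum x t‖
            ≤ friableCount x
                ((Real.log T + Real.log x ^ 2) * Real.log (Real.log T) ^ 5)}
        ≤ ENNReal.ofReal (T ^ (1 - 1 / Real.log (Real.log T) ^ 2)) := by
  obtain ⟨K, C, hK, hC, hvol⟩ := exists_volume_zetaSum_le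
  obtain ⟨c, C', K', hc, hC', hK', hR⟩ := exists_friableCount_exp_lower
  have hlK : 0 ≤ Real.log K := Real.log_nonneg hK
  -- Forces log₃ T ≥ 16(8C + 4)/c: the gain from the gap between z and Y carries a factor log₃ T
  -- that must beat the constants.
  set E := Real.exp (16 * (8 * C + 4) / c) with hE
  have hE0 : 0 < E := Real.exp_pos _
  set L₀ := 7 + C + C' + K' + 6 * Real.log K + E with hL₀
  refine ⟨Real.exp (Real.exp L₀), fun T x hT hx hxT => ?_⟩
  have hT0 : 0 < T := lt_of_lt_of_le (Real.exp_pos _) hT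
  have hT1 : 1 ≤ T := (Real.one_le_exp (Real.exp_nonneg _)).trans hT
  set lT := Real.log T with hlT
  set lx := Real.log x with hlx
  set L := Real.log lT with hLdef
  have hlTe : Real.exp L₀ ≤ lT := (Real.le_log_iff_exp_le hT0).2 hT
  have hlT0 : 0 < lT := lt_of_lt_of_le (Real.exp_pos _) hlTe
  have hL : L₀ ≤ L := (Real.le_log_iff_exp_le hlT0).2 hlTe
  have hexpL : Real.exp L = lT := Real.exp_log hlT0
  have hL7 : 7 ≤ L := by linarith
  have hL0 : 0 < L := by linarith
  have hlx2 : 0.69 ≤ lx := by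
    have := Real.log_le_log (by norm_num) hx
    linarith [Real.log_two_gt_d9]
  have hlx0 : 0 < lx := by linarith
  have h3 : 3 * lx ≤ lT := log_le_of_le_rpow_third hx hT1 hxT
  have hLlT : L ≤ lT := (Real.log_le_sub_one_of_pos hlT0).trans (by linarith)
  set W := lT + lx ^ 2 with hW
  have hWlT : lT ≤ W := le_add_of_nonneg_right (sq_nonneg lx)
  have hW0 : 0 < W := by linarith
  set Y := W * L ^ 5 with hY
  -- The cube makes the moment exponent O(log x / (log₂ T)²), while Y/z = (log₂ T)² gives an
  -- exponential gain larger by the factor log₃ T.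
  set z := W * L ^ 3 with hz
  by_cases hxY : x ≤ Y
  · have hempty : {t : ℝ | t ∈ Set.Icc 1 T ∧ ¬ ‖zetaSum x t‖ ≤ friableCount x Y} = ∅ := by
      rw [Set.eq_empty_iff_forall_notMem]
      rintro t ⟨-, ht⟩
      apply ht
      rw [friableCount_eq_floor hxY]
      exact norm_zetaSum_le x t
    rw [hempty, MeasureTheory.measure_empty]
    exact bot_le
  push Not at hxY
  have hpow3 : L ≤ L ^ 3 := le_self_pow₀ (by linarith) (by norm_num)
  have hpow6 : L ≤ L ^ 6 := le_self_pow₀ (by linarith) (by norm_num)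
  have hpow2 : L ≤ L ^ 2 := le_self_pow₀ (by linarith) (by norm_num)
  have hzL : W * L ≤ z := by rw [hz]; gcongr
  have hW1 : 1 ≤ W := by linarith
  have hLz : L ≤ z := (le_mul_of_one_le_left hL0.le hW1).trans hzL
  have hz0 : 0 < z := by linarith
  have hYz : Y = L ^ 2 * z := by rw [hY, hz]; ring
  have hlx2W : lx ^ 2 ≤ W := by rw [hW]; linarith
  have hlxW : lx ≤ W := by linarith
  set r : ℝ := lT / lx with hr
  have hr3 : 3 ≤ r := by rw [hr, le_div_iff₀ hlx0]; exact h3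
  set k := ⌊r⌋₊ with hk
  have hkr : (k : ℝ) ≤ r := Nat.floor_le (by linarith)
  have hrk : r < k + 1 := Nat.lt_floor_add_one r
  have hk1 : 1 ≤ k := Nat.le_floor (by push_cast; linarith)
  have hk1' : (1 : ℝ) ≤ k := by exact_mod_cast hk1
  have hklx : k * lx ≤ lT := by
    rw [hr, le_div_iff₀ hlx0] at hkr; exact hkr
  have hlTk : lT ≤ 2 * k * lx := by
    have h1 : r * lx = lT := by rw [hr]; field_simp
    have h2 : r * lx ≤ 2 * k * lx := by gcongr; linarith
    linarith
  have hxk : x ^ k ≤ T := by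
    rw [← Real.log_le_log_iff (by positivity) hT0, Real.log_pow]; exact hklx
  have hklx2 : k * lx ^ 2 ≤ lx * lT := by
    calc k * lx ^ 2 = lx * (k * lx) := by ring
      _ ≤ lx * lT := by gcongr
  have hΨz := one_le_friableCount (show 1 ≤ x by linarith) z
  have hΨY := one_le_friableCount (show 1 ≤ x by linarith) Y
  have hCz : C * lx ^ 2 ≤ z := by
    have h1 : C * lx ^ 2 ≤ L * W := by
      apply mul_le_mul (by linarith) hlx2W (by positivity) hL0.le
    linarith
  have hCkz : C * k * lx ^ 2 ≤ z ^ 2 := by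
    have h1 : lx * lT ≤ W * W := mul_le_mul hlxW hWlT hlT0.le hW0.le
    calc C * k * lx ^ 2 = C * (k * lx ^ 2) := by ring
      _ ≤ L ^ 6 * (W * W) := by
          apply mul_le_mul (by linarith) (hklx2.trans h1) (by positivity) (by positivity)
      _ = z ^ 2 := by rw [hz]; ring
  have hmain := (hvol T x z (friableCount x Y) k hT0 (by linarith) (by linarith) hCz hCkz hxk
    (by linarith)).2
  refine hmain.trans (ENNReal.ofReal_le_ofReal ?_)
  have hzY : z ≤ Y := by
    rw [hYz]; exact le_mul_of_one_le_left hz0.le (by linarith)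
  have hlogY : Real.log Y ≤ 8 * L := by
    have h1 : W ≤ lT ^ 3 := by
      have h2 : lx ^ 2 ≤ lT ^ 2 := by gcongr; linarith
      have h4 : lT + lT ^ 2 ≤ lT ^ 3 := by
        have h6 : 0 ≤ lT * (lT ^ 2 - lT - 1) :=
          mul_nonneg hlT0.le (by nlinarith only [hL7, hLlT])
        linarith
      linarith
    have h5 : Y ≤ lT ^ 8 := by
      calc Y ≤ lT ^ 3 * lT ^ 5 := by rw [hY]; gcongr
        _ = lT ^ 8 := by ring
    calc Real.log Y ≤ Real.log (lT ^ 8) := Real.log_le_log (by linarith) h5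
      _ = 8 * L := by rw [Real.log_pow]; norm_num; rfl
  have hlogz : Real.log z ≤ 8 * L := (Real.log_le_log hz0 hzY).trans hlogY
  have hlogz0 : 0 ≤ Real.log z := Real.log_nonneg (by linarith)
  have hlogY0 : 0 < Real.log Y := Real.log_pos (by linarith)
  have hS : C * k * lx ^ 2 * Real.log z / z ≤ 8 * C * (lx / L ^ 2) := by
    calc C * k * lx ^ 2 * Real.log z / z = C * (k * lx ^ 2) * Real.log z / z := by ring
      _ ≤ C * (lx * lT) * (8 * L) / (lT * L ^ 3) := by
          rw [hz]
          gcongr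
      _ = _ := by field_simp
  set δ := c * (lx * Real.log (Y / z) / Real.log Y ^ 2) with hδ
  have hgrow := hR x z Y (by linarith) (by
      have h1 : C' * lx ≤ L * W := mul_le_mul (by linarith) hlxW hlx0.le hL0.le
      linarith) (by
      rw [hYz]
      have : K' ≤ L ^ 2 := by linarith
      gcongr) hxY.le
  have hlogL : 16 * (8 * C + 4) / c ≤ Real.log L := by
    rw [Real.le_log_iff_exp_le hL0]
    change E ≤ L
    linarith
  have hδlow : (8 * C + 4) * (lx / L ^ 2) ≤ 2 * δ := by
    have h1 : Real.log (Y / z) = 2 * Real.log L := by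
      rw [hYz, mul_div_assoc, div_self hz0.ne', mul_one, Real.log_pow]; norm_num
    have hlL0 : 0 < Real.log L := Real.log_pos (by linarith)
    calc (8 * C + 4) * (lx / L ^ 2) = c / 16 * (16 * (8 * C + 4) / c) * (lx / L ^ 2) := by
          field_simp
      _ ≤ c / 16 * Real.log L * (lx / L ^ 2) := by gcongr
      _ = 2 * (c * (lx * (2 * Real.log L) / (8 * L) ^ 2)) := by field_simp; ring
      _ ≤ 2 * δ := by
          rw [hδ, h1]
          gcongr
  have hratio : Real.exp (C * k * lx ^ 2 * Real.log z / z) * friableCount x z ^ 2 /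
      friableCount x Y ^ 2 ≤ Real.exp (-(4 * (lx / L ^ 2))) := by
    rw [div_le_iff₀ (by positivity)]
    have h1 := pow_le_pow_left₀ (by positivity) hgrow 2
    rw [mul_pow] at h1
    have h2 : Real.exp δ ^ 2 = Real.exp (2 * δ) := by
      rw [← Real.exp_nat_mul]; push_cast; rfl
    rw [h2] at h1
    calc Real.exp (C * k * lx ^ 2 * Real.log z / z) * friableCount x z ^ 2
        ≤ Real.exp (-(4 * (lx / L ^ 2)) + 2 * δ) * friableCount x z ^ 2 := by
          gcongr
          linarith
      _ = Real.exp (-(4 * (lx / L ^ 2))) * (friableCount x z ^ 2 * Real.exp (2 * δ)) := by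
          rw [Real.exp_add]; ring
      _ ≤ _ := by gcongr
  -- Since 4 k log x ≥ 2 log T, one multiple of log T / (log₂ T)² is to spare, and it absorbs K.
  have hKT : Real.log K ≤ lT / L ^ 2 := by
    rw [le_div_iff₀ (by positivity)]
    have h1 := Real.pow_div_factorial_le_exp L hL0.le 3
    rw [hexpL] at h1
    have h2 : (Nat.factorial 3 : ℝ) = 6 := by norm_num [Nat.factorial]
    rw [h2] at h1
    have h3 : Real.log K ≤ L / 6 := by linarith
    calc Real.log K * L ^ 2 ≤ L / 6 * L ^ 2 := by gcongr
      _ = L ^ 3 / 6 := by ring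
      _ ≤ lT := h1
  calc K * T * (Real.exp (C * k * lx ^ 2 * Real.log z / z) * friableCount x z ^ 2 /
        friableCount x Y ^ 2) ^ k
      ≤ K * T * Real.exp (-(4 * (lx / L ^ 2))) ^ k := by gcongr
    _ = T * Real.exp (Real.log K - 4 * k * lx / L ^ 2) := by
        rw [← Real.exp_nat_mul, sub_eq_add_neg, Real.exp_add, Real.exp_log (by linarith)]
        rw [show (k : ℝ) * -(4 * (lx / L ^ 2)) = -(4 * k * lx / L ^ 2) by ring]
        ring
    _ ≤ T * Real.exp (-(lT * (1 / L ^ 2))) := by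
        refine mul_le_mul_of_nonneg_left (Real.exp_le_exp.2 ?_) hT0.le
        have h1 : lT / L ^ 2 ≤ 2 * k * lx / L ^ 2 := by gcongr
        have h2 : 4 * k * lx / L ^ 2 = 2 * (2 * k * lx / L ^ 2) := by ring
        rw [mul_one_div, h2]
        linarith
    _ = T ^ (1 - 1 / L ^ 2) := (rpow_one_sub_eq hT0).symm

theorem theorem1p1 :
    (∃ C : ℝ, 0 < C ∧ ∀ T x y : ℝ, 1 ≤ T → 2 ≤ x → x ≤ T ^ (1 / 3 : ℝ) →
      Real.log x * Real.log T * Real.log (Real.log T) ^ 5 ≤ y →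
      MeasureTheory.volume {t : ℝ | t ∈ Set.Icc 1 T ∧
          ¬ ‖zetaSum x t - friableSum x y t‖
            ≤ C * (friableCount x y / Real.log (Real.log T) ^ 2)}
        ≤ ENNReal.ofReal (T ^ (1 - 1 / Real.log x))) ∧
    (∃ T₀ : ℝ, ∀ T x : ℝ, T₀ ≤ T → 2 ≤ x → x ≤ T ^ (1 / 3 : ℝ) →
      MeasureTheory.volume {t : ℝ | t ∈ Set.Icc 1 T ∧
          ¬ ‖zetaSum x t‖
            ≤ friableCount x
                ((Real.log T + Real.log x ^ 2) * Real.log (Real.log T) ^ 5)}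
        ≤ ENNReal.ofReal (T ^ (1 - 1 / Real.log (Real.log T) ^ 2))) :=
  ⟨exists_zetaSum_sub_friableSum, exists_zetaSum_le_friableCount⟩
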